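/- Fix $c\in\mathbb N$. In the $k$-machine model, the $n$ vertices of a graph are partitioned among $k\ge 1$ machines, and an edge lives on the (at most two) machines that hold its endpoints. Machines communicate in synchronous rounds, and in each round each machine may send a message of at most $\log n$ bits to each machine; local computation is free. A machine knows $n$, $k$, its own number and its own vertices. The graph is undirected, with integer edge weights of absolute value at most $n^c$; it need not be connected, and MST means minimum spanning forest (a minimum-weight choice of a spanning tree in each component). An update inserts an absent edge with its weight, or deletes a present edge; only the machines on which the edge lives learn of it, and the next update arrives after the rounds for the current one are over. An Euler tour of a tree is a closed walk that crosses each edge once in each direction; it gives its $s$ directed edges the labels $0,\dots,s-1$ in the order of traversal, and $s$ is its size. The Euler-tour data structure for an MST $T$ of the current graph $G$ is: for one choice of Euler tours of the trees of $T$, each machine knows, of each edge of $G$ that lives on it, whether it is in $T$, and if so its two labels with their directions and the size of its tour; and for each neighbour of each of its vertices, the same data for one edge of $T$ at that neighbour. There is a constant $C$, depending only on $c$, such that for all $n$ and all $k\ge1$ there is a deterministic algorithm for which the following holds for every partition of the vertices. 1. Started on the graph without edges (with no communication), it maintains, through every finite sequence of updates, the Euler-tour data structure for an MST of the current graph, in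 at most $C$ communication rounds per update. 2. If the graph is initially an arbitrary graph with such weights, an MST $T$ of it has been computed, and each machine knows the weights of the edges that live on it and which of them are in $T$, then the data structure for $T$ is initialised in at most $C\lceil n/k\rceil$ rounds (that is, $O(n/k)$ rounds for $k\le n$), and from then on it is maintained as in 1. At the start and after every round, including the rounds within the initialisation and within an update, each machine uses at most $C\,(k+m_i)$ words of at most $C\log n$ bits, where $m_i$ is the number of edges of the current graph (for an update: the updated graph) that live on it. Here $\log n$ stands for $\lfloor\log_2 n\rfloor$. -/

import Mathlib

namespace KMachine

/-! ### Weighted graphs, minimum spanning forests, Euler tours -/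

/-- A weighted graph on the vertices `0, …, n - 1`.  Only the weights of edges of `graph`
are ever used. -/
structure WGraph (n : ℕ) where
  graph : SimpleGraph (Fin n)
  weight : Sym2 (Fin n) → ℤ

/-- All edge weights are integers of absolute value at most `n ^ c`. -/
def WGraph.WeightsBounded {n : ℕ} (G : WGraph n) (c : ℕ) : Prop :=
  ∀ e ∈ G.graph.edgeSet, |G.weight e| ≤ (n : ℤ) ^ c

/-- Total weight of the edges of the graph `T`. -/
noncomputable def totalWeight {n : ℕ} (w : Sym2 (Fin n) → ℤ) (T : SimpleGraph (Fin n)) : ℤ :=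
  ∑ e ∈ (Set.toFinite T.edgeSet).toFinset, w e

/-- `T` consists of a spanning tree of each connected component of `G`. -/
structure IsSpanningForest {n : ℕ} (G T : SimpleGraph (Fin n)) : Prop where
  le : T ≤ G
  acyclic : T.IsAcyclic
  spanning : ∀ u v, G.Reachable u v → T.Reachable u v

/-- `T` is a minimum spanning forest of `G` (a minimum spanning tree if `G` is connected). -/
structure IsMSF {n : ℕ} (G : WGraph n) (T : SimpleGraph (Fin n)) : Prop where
  spanningForest : IsSpanningForest G.graph T
  minimal : ∀ T', IsSpanningForest G.graph T' → totalWeight G.weight T ≤ totalWeight G.weight T'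

/-- The length of an Euler tour of the tree of `T` that contains `u`: the number of directed
edges (two for each edge) of that tree. -/
noncomputable def tourSize {n : ℕ} (T : SimpleGraph (Fin n)) (u : Fin n) : ℕ :=
  {d : Fin n × Fin n | T.Adj d.1 d.2 ∧ T.Reachable u d.1}.ncard

/-- `lab u v` is the time at which an Euler tour of the tree of `u` crosses the edge `uv` from
`u` to `v`.  In each tree, the `s` directed edges receive distinct times in `{0, …, s - 1}`
(so each time is used exactly once), and the directed edge crossed at time `t + 1` (modulo `s`)
starts where the one crossed at time `t` ends: the tour is a closed walk that crosses each edge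
exactly once in each direction. -/
structure IsEulerTour {n : ℕ} (T : SimpleGraph (Fin n)) (lab : Fin n → Fin n → ℕ) : Prop where
  lt : ∀ u v, T.Adj u v → lab u v < tourSize T u
  inj : ∀ u v u' v', T.Adj u v → T.Adj u' v' → T.Reachable u u' →
    lab u v = lab u' v' → u = u' ∧ v = v'
  next : ∀ u v u' v', T.Adj u v → T.Adj u' v' → T.Reachable u u' →
    lab u' v' = (lab u v + 1) % tourSize T u → u' = v

/-- The Euler tour record of a tree edge `uv`, read from `u`: the two integer values, with their
directions, and the size of the tour which the edge is in. -/
structure TourInfo where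
  /-- time of the traversal from `u` to `v` -/
  fwd : ℕ
  /-- time of the traversal from `v` to `u` -/
  bwd : ℕ
  size : ℕ

noncomputable def tourInfo {n : ℕ} (T : SimpleGraph (Fin n)) (lab : Fin n → Fin n → ℕ)
    (u v : Fin n) : TourInfo :=
  ⟨lab u v, lab v u, tourSize T u⟩

/-! ### Updates -/

/-- A single update: insertion of an edge with a weight, or deletion of an edge. -/
inductive Update (n : ℕ) where
  | insert (e : Sym2 (Fin n)) (x : ℤ) : Update n
  | delete (e : Sym2 (Fin n)) : Update n

def Update.edge {n : ℕ} : Update n → Sym2 (Fin n)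
  | .insert e _ => e
  | .delete e => e

/-- An edge that is inserted is absent and not a loop, and has a weight of absolute value at most
`n ^ c`; an edge that is deleted is present. -/
def Update.Valid {n : ℕ} (c : ℕ) (G : WGraph n) : Update n → Prop
  | .insert e x => ¬ e.IsDiag ∧ e ∉ G.graph.edgeSet ∧ |x| ≤ (n : ℤ) ^ c
  | .delete e => e ∈ G.graph.edgeSet

open Classical in
noncomputable def WGraph.apply {n : ℕ} (G : WGraph n) : Update n → WGraph n
  | .insert e x => ⟨G.graph ⊔ SimpleGraph.fromEdgeSet {e}, Function.update G.weight e x⟩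
  | .delete e => ⟨G.graph.deleteEdges {e}, G.weight⟩

/-- The graph after a finite sequence of updates. -/
noncomputable def WGraph.after {n : ℕ} (G : WGraph n) (us : List (Update n)) : WGraph n :=
  us.foldl WGraph.apply G

def ValidSeq {n : ℕ} (c : ℕ) : WGraph n → List (Update n) → Prop
  | _, [] => True
  | G, u :: us => u.Valid c G ∧ ValidSeq c (G.apply u) us

/-! ### The `k`-machine model

The vertices are partitioned among the machines `0, …, k - 1` by a map `home`.  A machine knows
`n`, `k`, its own number and the set of its own vertices, but not the rest of the partition.
Everything else it knows is in its memory, which is a list of words. -/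

abbrev Memory := List ℕ

/-- The memories of all machines. -/
abbrev Config (k : ℕ) := Fin k → Memory

/-- What crosses a link in one direction in one round: at most `log n` bits (`none` is silence). -/
abbrev Message (n : ℕ) := Option (BitVec (Nat.log 2 n))

/-- The set of vertices on machine `i`. -/
def hosted {n k : ℕ} (home : Fin n → Fin k) (i : Fin k) : Finset (Fin n) :=
  Finset.univ.filter fun v => home v = i

/-- The edge `e` lives on machine `i`: one of its endpoints does. -/
def LivesOn {n k : ℕ} (home : Fin n → Fin k) (e : Sym2 (Fin n)) (i : Fin k) : Prop :=
  ∃ v ∈ e, home v = i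

/-- The number of edges of `G` that live on machine `i`. -/
noncomputable def localEdges {n k : ℕ} (home : Fin n → Fin k) (G : SimpleGraph (Fin n))
    (i : Fin k) : ℕ :=
  {e | e ∈ G.edgeSet ∧ LivesOn home e i}.ncard

/-- The memory content `m` takes at most `C * s` words of at most `C * log n` bits each. -/
def FitsIn (n C s : ℕ) (m : Memory) : Prop :=
  m.length ≤ C * s ∧ ∀ x ∈ m, x < 2 ^ (C * Nat.log 2 n)

/-- A synchronous deterministic protocol.  The arguments of `send` are: the machine, its vertices,
the number of rounds since the protocol was started, its memory, and the recipient.  `recv`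
computes the new memory from the old one and the messages received from each machine. -/
structure Protocol (n k : ℕ) where
  send : Fin k → Finset (Fin n) → ℕ → Memory → Fin k → Message n
  recv : Fin k → Finset (Fin n) → ℕ → Memory → (Fin k → Message n) → Memory

/-- The configuration after `t` communication rounds of `P`, started from `σ`. -/
def Protocol.run {n k : ℕ} (P : Protocol n k) (home : Fin n → Fin k) (σ : Config k) :
    ℕ → Config k
  | 0 => σ
  | t + 1 => fun i =>
      P.recv i (hosted home i) t (P.run home σ t i)
        fun j => P.send j (hosted home j) t (P.run home σ t j) i

/-- What a machine is given about a graph and a spanning forest: for each pair of vertices either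
`none` (not an edge that lives on the machine) or the weight of the edge and whether it is in the
forest. -/
abbrev LocalInput (n : ℕ) := Sym2 (Fin n) → Option (ℤ × Bool)

open Classical in
noncomputable def localInput {n k : ℕ} (home : Fin n → Fin k) (G : WGraph n)
    (T : SimpleGraph (Fin n)) (i : Fin k) : LocalInput n :=
  fun e => if e ∈ G.graph.edgeSet ∧ LivesOn home e i then
    some (G.weight e, decide (e ∈ T.edgeSet)) else none

/-! ### Dynamic MST algorithms -/

/-- A deterministic dynamic MST algorithm for `n` vertices and `k` machines.  In each field the
first two arguments are the machine and the set of its vertices. -/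
structure DynAlg (n k : ℕ) where
  /-- memory at the start if the graph has no edges at all -/
  startEmpty : Fin k → Finset (Fin n) → Memory
  /-- memory at the start if the graph may have edges and a minimum spanning forest has been
  computed -/
  load : Fin k → Finset (Fin n) → LocalInput n → Memory
  /-- communication that initialises the data structure, after `load` -/
  initProtocol : Protocol n k
  /-- local reaction to the arrival of an update; the argument is `none` on machines that do not
  get to see the update -/
  accept : Fin k → Finset (Fin n) → Option (Update n) → Memory → Memory
  /-- communication for one update, after `accept` -/
  updateProtocol : Protocol n k
  /-- for an edge `uv`, with `u` on the machine: its Euler tour record, read from `u`, or `none`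
  if the edge is not in the forest -/
  readEdge : Fin k → Finset (Fin n) → Memory → Fin n → Fin n → Option TourInfo
  /-- for a neighbour `v` of a vertex on the machine: a vertex `x` such that `vx` is in the forest,
  and the Euler tour record of that edge, read from `v` -/
  readNeighbour : Fin k → Finset (Fin n) → Memory → Fin n → Option (Fin n × TourInfo)

variable {n k : ℕ}

/-- The memories hold the Euler tour data structure for the forest `T` of `G`: for some Euler tours
of the trees of `T`, each machine knows of each edge of `G` that lives on it whether it is in `T`,
and if so its tour record; and of each neighbour of its vertices the tour record of one tree edge
at that neighbour. -/
def DynAlg.Represents (A : DynAlg n k) (home : Fin n → Fin k) (G T : SimpleGraph (Fin n))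
    (σ : Config k) : Prop :=
  ∃ lab : Fin n → Fin n → ℕ, IsEulerTour T lab ∧
    ∀ u v, G.Adj u v →
      (T.Adj u v → A.readEdge (home u) (hosted home (home u)) (σ (home u)) u v =
        some (tourInfo T lab u v)) ∧
      (¬ T.Adj u v → A.readEdge (home u) (hosted home (home u)) (σ (home u)) u v = none) ∧
      (∃ x, T.Adj v x ∧ A.readNeighbour (home u) (hosted home (home u)) (σ (home u)) v =
        some (x, tourInfo T lab v x))

/-- Every machine `i` uses `O(k + m_i)` words of `O(log n)` bits, where `m_i` is the number of edges
of `G` that live on it; `C` is the implied constant. -/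
def SpaceOK (C : ℕ) (home : Fin n → Fin k) (G : SimpleGraph (Fin n)) (σ : Config k) : Prop :=
  ∀ i, FitsIn n C (k + localEdges home G i) (σ i)

/-- Start with the empty graph: no communication. -/
def DynAlg.emptyConfig (A : DynAlg n k) (home : Fin n → Fin k) : Config k :=
  fun i => A.startEmpty i (hosted home i)

/-- Start with the graph `G` and the minimum spanning forest `T`: the configuration after `t`
rounds of the initialisation. -/
noncomputable def DynAlg.initConfig (A : DynAlg n k) (home : Fin n → Fin k) (G : WGraph n)
    (T : SimpleGraph (Fin n)) (t : ℕ) : Config k :=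
  A.initProtocol.run home (fun i => A.load i (hosted home i) (localInput home G T i)) t

open Classical in
/-- The update `u` arrives, at the machines which its edge lives on and nowhere else. -/
noncomputable def DynAlg.deliver (A : DynAlg n k) (home : Fin n → Fin k) (σ : Config k)
    (u : Update n) : Config k :=
  fun i => A.accept i (hosted home i) (if LivesOn home u.edge i then some u else none) (σ i)

/-- The configuration `t` rounds after the arrival of the update `u`. -/
noncomputable def DynAlg.updateConfig (A : DynAlg n k) (home : Fin n → Fin k) (σ : Config k)
    (u : Update n) (t : ℕ) : Config k :=
  A.updateProtocol.run home (A.deliver home σ u) t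

/-- The configuration after a finite sequence of updates, with `R` communication rounds for each
of them. -/
noncomputable def DynAlg.after (A : DynAlg n k) (home : Fin n → Fin k) (R : ℕ) (σ : Config k)
    (us : List (Update n)) : Config k :=
  us.foldl (fun τ u => A.updateConfig home τ u R) σ

/-- From the graph `G` and the configuration `σ` on, with `R` rounds for each update, `A` maintains
a minimum spanning forest represented by Euler tours, whatever the updates are, and obeys the space
restriction in each round. -/
def DynAlg.Maintains (A : DynAlg n k) (c C R : ℕ) (home : Fin n → Fin k) (G : WGraph n)
    (σ : Config k) : Prop :=
  ∀ us : List (Update n), ValidSeq c G us →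
    (∃ T, IsMSF (G.after us) T ∧ A.Represents home (G.after us).graph T (A.after home R σ us)) ∧
    SpaceOK C home (G.after us).graph (A.after home R σ us) ∧
    ∀ u : Update n, u.Valid c (G.after us) → ∀ t ≤ R,
      SpaceOK C home ((G.after us).apply u).graph
        (A.updateConfig home (A.after home R σ us) u t)

end KMachine

/-! Cutting and joining trees changes an Euler tour by arithmetic on the labels alone. A constant
number of short announcements therefore lets every machine bring its own records up to date.

Tours. Rotate the tour of a tree so that it crosses `xy` from `x` to `y` at time 0, and let `g` be
the time of the return. The darts strictly between 0 and `g` form a tour of the side of `y`, those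
after `g` a tour of the side of `x` (`Tour.cut`). Conversely, a tour that starts at `a`, the dart
`ab`, a tour that starts at `b` and the dart `ba` form one tour (`Tour.link`). The label of any one
dart that leaves `v` tells on which side of a cut `v` lies (`Tour.reachable_iff`); this is why one
tree edge is recorded at each neighbour.

Forests. Every update amounts to at most one cut followed by at most one link. If `uv` is inserted
within a tree, a heaviest edge of the forest path from `u` to `v` is cut and a lightest edge across
that cut is linked, possibly the same edge again (`IsMSF.insert_exchange`). If `uv` joins two trees,
it is linked (`IsMSF.insert_link`). If a forest edge is deleted, it is cut and a lightest crossing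
edge, if any, is linked (`IsMSF.delete_exchange`, `IsMSF.delete_bridge`). Each machine proposes its
best candidate, and all take the best of the proposals.

Protocol. A `GState` is the global situation, its `view` what one machine stores of it. By
`view_cut` and `view_link` the new view is a function of the old one and of the announced data. So
`update_run` needs seven rounds with messages of `O(log n)` bits, and `BigProtocol.toProtocol` sends
these in a constant number of pieces.

Initialisation. Starting from the forest without edges, the edges of `T`, at most `n` of them, are
linked in batches of `k`. One machine may own a whole batch, so edge number `j` of a batch is first
sent to machine `j`, which then tells everyone: two rounds for each of `⌈n / k⌉` batches, after one
round in which the edges are numbered (`init_correct`).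

Space. A machine stores one word for each directed edge at its vertices, one word of auxiliary data,
and `k` partially received messages. -/

namespace KMachine
open SimpleGraph

/-! ### Components of a forest when one edge is added or deleted -/

section Forest
variable {V : Type*} {T : SimpleGraph V}

theorem reachable_induction {P : V → Prop} {u v : V} (h : T.Reachable u v) (hu : P u)
    (hstep : ∀ a b, T.Adj a b → P a → P b) : P v := by
  obtain ⟨w⟩ := h
  induction w with
  | nil => exact hu
  | cons hab _ ih => exact ih (hstep _ _ hab hu)

theorem reachable_of_adj_reachable {T' : SimpleGraph V} (h : ∀ a b, T.Adj a b → T'.Reachable a b)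
    {u v : V} (huv : T.Reachable u v) : T'.Reachable u v :=
  reachable_induction (P := fun v => T'.Reachable u v) huv (Reachable.refl _)
    fun a b hab ha => ha.trans (h a b hab)

theorem deleteEdges_singleton_adj {x y a b : V} :
    (T.deleteEdges {s(x, y)}).Adj a b ↔ T.Adj a b ∧ ¬ s(a, b) = s(x, y) := by
  simp [deleteEdges_adj]

theorem reachable_deleteEdge_or {x y v : V} (h : T.Reachable x v) :
    (T.deleteEdges {s(x, y)}).Reachable x v ∨ (T.deleteEdges {s(x, y)}).Reachable y v := by
  refine reachable_induction (P := fun v => (T.deleteEdges {s(x, y)}).Reachable x v ∨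
    (T.deleteEdges {s(x, y)}).Reachable y v) h (Or.inl (Reachable.refl _)) ?_
  intro a b hab ha
  by_cases he : s(a, b) = s(x, y)
  · rcases Sym2.eq_iff.1 he with ⟨_, rfl⟩ | ⟨_, rfl⟩
    · exact Or.inr (Reachable.refl _)
    · exact Or.inl (Reachable.refl _)
  · have : (T.deleteEdges {s(x, y)}).Reachable a b :=
      (deleteEdges_singleton_adj.2 ⟨hab, he⟩).reachable
    exact ha.imp (·.trans this) (·.trans this)

theorem deleteEdge_not_reachable (hT : T.IsAcyclic) {x y : V} (hxy : T.Adj x y) :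
    ¬ (T.deleteEdges {s(x, y)}).Reachable x y :=
  isBridge_iff.1 (isAcyclic_iff_forall_adj_isBridge.1 hT hxy)

theorem sup_edge_adj {a b : V} (hab : a ≠ b) {u v : V} :
    (T ⊔ edge a b).Adj u v ↔ T.Adj u v ∨ (u = a ∧ v = b) ∨ (u = b ∧ v = a) := by
  rw [sup_adj, edge_adj]
  constructor
  · tauto
  · rintro (h | ⟨rfl, rfl⟩ | ⟨rfl, rfl⟩)
    · exact Or.inl h
    · exact Or.inr ⟨Or.inl ⟨rfl, rfl⟩, hab⟩
    · exact Or.inr ⟨Or.inr ⟨rfl, rfl⟩, hab.symm⟩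

/-- `tid` names the components of `T`, each by one of its vertices. -/
structure NamesComponents (T : SimpleGraph V) (tid : V → V) : Prop where
  iff : ∀ u v, T.Reachable u v ↔ tid u = tid v
  idem : ∀ v, tid (tid v) = tid v

theorem NamesComponents.adj {tid : V → V} (h : NamesComponents T tid) {u v : V} (huv : T.Adj u v) :
    tid u = tid v := (h.iff u v).1 huv.reachable

open Classical in
theorem NamesComponents.sup_edge {tid : V → V} (h : NamesComponents T tid) {a b : V}
    (hab : tid a ≠ tid b) :
    NamesComponents (T ⊔ edge a b) (fun v => if tid v = tid b then tid a else tid v) := by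
  have hne : a ≠ b := fun h => hab (h ▸ rfl)
  have hedge : (T ⊔ edge a b).Reachable a b :=
    ((sup_edge_adj hne).2 (Or.inr (Or.inl ⟨rfl, rfl⟩))).reachable
  have mono : ∀ {u v}, tid u = tid v → (T ⊔ edge a b).Reachable u v := fun h' =>
    ((h.iff _ _).2 h').mono le_sup_left
  constructor
  · intro u v
    constructor
    · intro huv
      refine reachable_induction (P := fun v => (if tid u = tid b then tid a else tid u) =
        if tid v = tid b then tid a else tid v) huv rfl ?_
      intro p q hpq hp
      rw [hp]
      rcases (sup_edge_adj hne).1 hpq with h' | ⟨rfl, rfl⟩ | ⟨rfl, rfl⟩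
      · rw [h.adj h']
      · simp
      · simp
    · intro huv
      split_ifs at huv with h1 h2 h2
      · exact mono (h1.trans h2.symm)
      · exact (mono h1).trans (hedge.symm.trans (mono huv))
      · exact (mono huv).trans (hedge.trans (mono h2.symm))
      · exact mono huv
  · intro v
    have := h.idem
    split_ifs <;> grind

-- The pieces are named after the ends of the deleted edge, which every announcement of a cut
-- contains. The edge is a bridge, so each end lies in its own piece and the names stay idempotent.
open Classical in
theorem NamesComponents.deleteEdge {tid : V → V} (h : NamesComponents T tid) {x y : V}
    (hxy : T.Adj x y) (hT : T.IsAcyclic) :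
    NamesComponents (T.deleteEdges {s(x, y)}) (fun v => if tid v = tid x then
      if (T.deleteEdges {s(x, y)}).Reachable y v then y else x else tid v) := by
  have hbr := deleteEdge_not_reachable hT hxy
  set T' := T.deleteEdges {s(x, y)} with hT'
  have hxy' := h.adj hxy
  have hle : T' ≤ T := deleteEdges_le _
  have hid := h.idem
  have hne : x ≠ y := hxy.ne
  have side : ∀ v, tid v = tid x → ¬ T'.Reachable y v → T'.Reachable x v := fun v hv h' =>
    (reachable_deleteEdge_or ((h.iff _ _).2 hv.symm)).resolve_right h'
  constructor
  · intro u v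
    constructor
    · intro huv
      have h1 : tid u = tid v := (h.iff _ _).1 (huv.mono hle)
      have h2 : T'.Reachable y u ↔ T'.Reachable y v :=
        ⟨fun h' => h'.trans huv, fun h' => h'.trans huv.symm⟩
      simp only [h1, h2]
    · intro huv
      by_cases hu : tid u = tid x <;> by_cases hv : tid v = tid x
      · simp only [hu, hv, if_true] at huv
        by_cases h1 : T'.Reachable y u <;> by_cases h2 : T'.Reachable y v
        · exact h1.symm.trans h2
        · simp only [h1, h2, if_true, if_false] at huv; exact absurd huv.symm hne
        · simp only [h1, h2, if_true, if_false] at huv; exact absurd huv hne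
        · exact (side u hu h1).symm.trans (side v hv h2)
      · exfalso; grind
      · exfalso; grind
      · simp only [hu, hv, if_false] at huv
        refine reachable_induction (P := fun w => T'.Reachable u w) ((h.iff u v).2 huv)
          (Reachable.refl _) ?_ |> id
        intro p q hpq hp
        refine hp.trans (Adj.reachable (deleteEdges_singleton_adj.2 ⟨hpq, ?_⟩))
        intro he
        have hpx : tid p = tid x := by
          rcases Sym2.eq_iff.1 he with ⟨rfl, _⟩ | ⟨rfl, _⟩
          · rfl
          · exact hxy'.symm
        exact hu (((h.iff _ _).1 (hp.mono hle)).trans hpx)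
  · intro v
    by_cases hv : tid v = tid x
    · by_cases h1 : T'.Reachable y v
      · simp [hv, h1, ← hxy']
      · simp [hv, h1, hbr, reachable_comm]
    · simp [hv, hid]

end Forest

/-! ### Euler tours: rotating, cutting and linking -/

/-- A labelling of the darts of `T` by an Euler tour of each component; `tid` names the components,
and `sz` is the size of the tours. -/
structure Tour {V : Type*} (T : SimpleGraph V) (tid : V → V) (lab : V → V → ℕ) (sz : V → ℕ) :
    Prop where
  sz_congr : ∀ u v, tid u = tid v → sz u = sz v
  adj : ∀ u v, T.Adj u v → tid u = tid v
  lt : ∀ u v, T.Adj u v → lab u v < sz u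
  inj : ∀ u v u' v', T.Adj u v → T.Adj u' v' → tid u = tid u' → lab u v = lab u' v' →
    u = u' ∧ v = v'
  surj : ∀ w l, l < sz w → ∃ u v, T.Adj u v ∧ tid u = tid w ∧ lab u v = l
  next : ∀ u v u' v', T.Adj u v → T.Adj u' v' → tid u = tid u' →
    lab u' v' = (lab u v + 1) % sz u → u' = v

namespace Tour
variable {V : Type*} {T : SimpleGraph V} {tid : V → V} {lab : V → V → ℕ} {sz : V → ℕ}

/-- Starting all tours elsewhere. -/
theorem rotate (h : Tour T tid lab sz) (m : V → ℕ) (hm : ∀ u v, tid u = tid v → m u = m v) :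
    Tour T tid (fun u v => (lab u v + m u) % sz u) sz where
  sz_congr := h.sz_congr
  adj := h.adj
  lt u v huv := Nat.mod_lt _ (by have := h.lt u v huv; omega)
  inj u v u' v' huv huv' ht hl := by
    refine h.inj u v u' v' huv huv' ht ?_
    have h1 := h.lt u v huv
    have h2 := h.lt u' v' huv'
    simp only [← hm u u' ht, ← h.sz_congr u u' ht] at hl h2
    have := Nat.ModEq.add_right_cancel' _ hl
    rwa [Nat.ModEq, Nat.mod_eq_of_lt h1, Nat.mod_eq_of_lt h2] at this
  surj w l hl := by
    -- The dart whose new label is `l` had the label `l - m w` modulo the size; reducing `m w` first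
    -- keeps the subtraction within the natural numbers.
    obtain ⟨u, v, huv, hw, hlab⟩ := h.surj w ((l + (sz w - m w % sz w)) % sz w)
      (Nat.mod_lt _ (by omega))
    refine ⟨u, v, huv, hw, ?_⟩
    simp only [hlab, hm u w hw, h.sz_congr u w hw]
    have h3 : m w % sz w < sz w := Nat.mod_lt _ (by omega)
    rw [Nat.mod_add_mod, ← Nat.add_mod_mod, show l + (sz w - m w % sz w) + m w % sz w = l + sz w by omega,
      Nat.add_mod_right, Nat.mod_eq_of_lt hl]
  next u v u' v' huv huv' ht hl := by
    refine h.next u v u' v' huv huv' ht ?_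
    have h2 := h.lt u' v' huv'
    simp only [← hm u u' ht, ← h.sz_congr u u' ht] at hl h2
    rw [Nat.mod_add_mod, show lab u v + m u + 1 = lab u v + 1 + m u by omega] at hl
    have := Nat.ModEq.add_right_cancel' _ hl
    rwa [Nat.ModEq, Nat.mod_eq_of_lt h2] at this

/-- Between two crossings of the edge `xy`, a tour stays in one component of `T - xy`. -/
theorem reachable_of_between (h : Tour T tid lab sz) {x y z c : V} {l₀ l₁ : ℕ} (hz : T.Adj c z)
    (htz : tid c = tid x) (hl₀ : lab c z = l₀) (hl₁ : l₁ ≤ sz x)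
    (hno : ∀ a b, T.Adj a b → tid a = tid x → l₀ < lab a b → lab a b < l₁ → s(a, b) ≠ s(x, y)) :
    ∀ l a b, T.Adj a b → tid a = tid x → lab a b = l → l₀ < l → l < l₁ →
      (T.deleteEdges {s(x, y)}).Reachable z a ∧ (T.deleteEdges {s(x, y)}).Reachable z b := by
  intro l
  induction l with
  | zero => intro a b _ _ _ h'; omega
  | succ l ih =>
    intro a b hab hta hlab h0 h1
    have hs := h.sz_congr _ _ htz
    -- The dart at time `l + 1` starts where the one at time `l` ends, or at `z` if it is the first
    -- after `cz`.
    have key : (T.deleteEdges {s(x, y)}).Reachable z a := by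
      rcases Nat.lt_or_ge l₀ l with hlt | hge
      · obtain ⟨p, q, hpq, hp, hl⟩ := h.surj x l (by omega)
        have hq : a = q := h.next p q a b hpq hab (hp.trans hta.symm) (by
          rw [hlab, hl, h.sz_congr _ _ hp, Nat.mod_eq_of_lt (by omega)])
        exact hq ▸ (ih p q hpq hp hl hlt (by omega)).2
      · have hq : a = z := h.next c z a b hz hab (htz.trans hta.symm) (by
          rw [hlab, hl₀, hs, Nat.mod_eq_of_lt (by omega)]; omega)
        exact hq ▸ Reachable.refl _
    exact ⟨key, key.trans (Adj.reachable (deleteEdges_singleton_adj.2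
      ⟨hab, hno a b hab hta (by omega) (by omega)⟩))⟩

/-- The two crossings of `xy`, at time 0 and at time `lab y x`, split the tour into two intervals;
the first begins at `y`, the second at `x`. -/
theorem sides (h : Tour T tid lab sz) {x y : V} (hxy : T.Adj x y) (h0 : lab x y = 0)
    {a b : V} (hab : T.Adj a b) (hta : tid a = tid x) :
    (0 < lab a b → lab a b < lab y x → (T.deleteEdges {s(x, y)}).Reachable y a ∧
      (T.deleteEdges {s(x, y)}).Reachable y b) ∧
    (lab y x < lab a b → (T.deleteEdges {s(x, y)}).Reachable x a ∧
      (T.deleteEdges {s(x, y)}).Reachable x b) := by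
  have hyx : tid y = tid x := (h.adj _ _ hxy).symm
  have hs : lab y x < sz x := h.sz_congr _ _ hyx ▸ h.lt _ _ hxy.symm
  constructor
  · intro h1 h2
    refine h.reachable_of_between (l₀ := 0) (l₁ := lab y x) hxy rfl h0 hs.le ?_ _ a b hab hta rfl h1 h2
    rintro p q hpq hp hp1 hp2 he
    rcases Sym2.eq_iff.1 he with ⟨rfl, rfl⟩ | ⟨rfl, rfl⟩ <;> omega
  · intro h1
    refine h.reachable_of_between (l₁ := sz x) hxy.symm hyx rfl le_rfl ?_ _ a b hab hta rfl h1
      (h.sz_congr _ _ hta ▸ h.lt a b hab)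
    rintro p q hpq hp hp1 hp2 he
    rcases Sym2.eq_iff.1 he with ⟨rfl, rfl⟩ | ⟨rfl, rfl⟩ <;> omega

/-- The side of a vertex, from the label of any dart that starts there. -/
theorem reachable_iff (h : Tour T tid lab sz) (hT : T.IsAcyclic) {x y : V} (hxy : T.Adj x y)
    (h0 : lab x y = 0) {a b : V} (hab : T.Adj a b) (hta : tid a = tid x) :
    (T.deleteEdges {s(x, y)}).Reachable y a ↔ 0 < lab a b ∧ lab a b ≤ lab y x := by
  have hbr := deleteEdge_not_reachable hT hxy
  have hyx : tid y = tid x := (h.adj _ _ hxy).symm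
  obtain ⟨h1, h2⟩ := h.sides hxy h0 hab hta
  constructor
  · intro hr
    constructor
    · by_contra hc
      have := (h.inj a b x y hab hxy hta (by omega)).1
      exact hbr (this ▸ hr.symm)
    · by_contra hc
      exact hbr ((h2 (by omega)).1.trans hr.symm)
  · rintro ⟨h3, h4⟩
    rcases h4.lt_or_eq with h5 | h5
    · exact (h1 h3 h5).1
    · have := (h.inj a b y x hab hxy.symm (hta.trans hyx.symm) h5).1
      exact this ▸ Reachable.refl _

open Classical in
/-- Cutting the edge `xy` where a tour crosses it at time `0`. -/
theorem cut (h : Tour T tid lab sz) (hc : NamesComponents T tid) (hT : T.IsAcyclic) {x y : V}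
    (hxy : T.Adj x y) (h0 : lab x y = 0) :
    Tour (T.deleteEdges {s(x, y)})
      (fun v => if tid v = tid x then
        if (T.deleteEdges {s(x, y)}).Reachable y v then y else x else tid v)
      (fun u v => if tid u = tid x then
        if lab u v < lab y x then lab u v - 1 else lab u v - lab y x - 1 else lab u v)
      (fun v => if tid v = tid x then
        if (T.deleteEdges {s(x, y)}).Reachable y v then lab y x - 1 else sz x - lab y x - 1
        else sz v) := by
  have hn := hc.deleteEdge hxy hT
  have hside := fun a b => h.sides hxy h0 (a := a) (b := b)
  have hre := fun a b => h.reachable_iff hT hxy h0 (a := a) (b := b)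
  have hyx : tid y = tid x := (h.adj _ _ hxy).symm
  have hs : lab y x < sz x := h.sz_congr _ _ hyx ▸ h.lt _ _ hxy.symm
  have hbr := deleteEdge_not_reachable hT hxy
  have hadj : ∀ {a b}, (T.deleteEdges {s(x, y)}).Adj a b ↔ T.Adj a b ∧ ¬ s(a, b) = s(x, y) :=
    deleteEdges_singleton_adj
  set T' := T.deleteEdges {s(x, y)} with hT'
  have hid := hc.idem
  -- The new size `lab y x - 1` is thus no truncated subtraction.
  have hp : 0 < lab y x := by
    by_contra hp
    exact hxy.ne (h.inj x y y x hxy hxy.symm hyx.symm (by omega)).1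
  -- labels of the remaining darts
  have hlab : ∀ a b, T'.Adj a b → tid a = tid x → 0 < lab a b ∧ lab a b ≠ lab y x ∧
      lab a b < sz x ∧ (T'.Reachable y a ↔ lab a b < lab y x) := by
    intro a b hab hta
    obtain ⟨hab, he⟩ := hadj.1 hab
    have h1 : lab a b ≠ 0 := fun h1 => by
      obtain ⟨rfl, rfl⟩ := h.inj a b x y hab hxy hta (h1.trans h0.symm)
      exact he rfl
    have h2 : lab a b ≠ lab y x := fun h1 => by
      obtain ⟨rfl, rfl⟩ := h.inj a b y x hab hxy.symm (hta.trans hyx.symm) h1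
      exact he Sym2.eq_swap
    refine ⟨by omega, h2, h.sz_congr _ _ hta ▸ h.lt a b hab, ?_⟩
    rw [hre a b hab hta]; omega
  have hor : ∀ v, tid v = tid x → ¬ T'.Reachable y v → T'.Reachable x v := fun v hv h' =>
    (reachable_deleteEdge_or ((hc.iff _ _).2 hv.symm)).resolve_right h'
  have htid : ∀ u u', (if tid u = tid x then if T'.Reachable y u then y else x else tid u) =
      (if tid u' = tid x then if T'.Reachable y u' then y else x else tid u') →
      tid u = tid u' ∧ (T'.Reachable y u ↔ T'.Reachable y u') := by
    intro u u' he
    have := (hn.iff u u').2 he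
    exact ⟨(hc.iff _ _).1 (this.mono (deleteEdges_le _)),
      fun h' => h'.trans this, fun h' => h'.trans this.symm⟩
  refine ⟨?_, fun u v huv => hn.adj huv, ?_, ?_, ?_, ?_⟩
  · intro u v huv
    obtain ⟨h1, h2⟩ := htid u v huv
    simp only [h1, h2, h.sz_congr u v h1]
  · intro u v huv
    by_cases hu : tid u = tid x
    · obtain ⟨h1, h2, h3, h4⟩ := hlab u v huv hu
      by_cases h5 : lab u v < lab y x
      · simp only [hu, h4.2 h5, h5, if_true]; omega
      · simp only [hu, mt h4.1 h5, h5, if_true, if_false]; omega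
    · simp only [hu, if_false]; exact h.lt u v (hadj.1 huv).1
  · intro u v u' v' huv huv' ht hl
    obtain ⟨ht, hr⟩ := htid u u' ht
    refine h.inj u v u' v' (hadj.1 huv).1 (hadj.1 huv').1 ht ?_
    by_cases hu : tid u = tid x
    · have hu' := ht ▸ hu
      obtain ⟨h1, h2, h3, h4⟩ := hlab u v huv hu
      obtain ⟨h1', h2', h3', h4'⟩ := hlab u' v' huv' hu'
      have h6 : lab u v < lab y x ↔ lab u' v' < lab y x := by rw [← h4, ← h4', hr]
      by_cases h5 : lab u v < lab y x
      · simp only [hu, hu', h5, h6.1 h5, if_true] at hl; omega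
      · simp only [hu, hu', h5, mt h6.2 h5, if_true, if_false] at hl; omega
    · have hu' : tid u' ≠ tid x := ht ▸ hu
      simpa only [hu, hu', if_false] using hl
  · intro w l hl
    by_cases hw : tid w = tid x
    · by_cases h1 : T'.Reachable y w
      · simp only [hw, h1, if_true] at hl
        obtain ⟨a, b, hab, hta, hlb⟩ := h.surj x (l + 1) (by omega)
        have hab' : T'.Adj a b := hadj.2 ⟨hab, fun he => by
          rcases Sym2.eq_iff.1 he with ⟨rfl, rfl⟩ | ⟨rfl, rfl⟩ <;> omega⟩
        have h2 := ((hlab a b hab' hta).2.2.2).2 (by omega)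
        refine ⟨a, b, hab', ?_, ?_⟩
        · simp only [hta, hw, h1, h2, if_true]
        · simp only [hta, if_true]; rw [if_pos (by omega)]; omega
      · simp only [hw, h1, if_true, if_false] at hl
        obtain ⟨a, b, hab, hta, hlb⟩ := h.surj x (l + lab y x + 1) (by omega)
        have hab' : T'.Adj a b := hadj.2 ⟨hab, fun he => by
          rcases Sym2.eq_iff.1 he with ⟨rfl, rfl⟩ | ⟨rfl, rfl⟩ <;> omega⟩
        have h2 := mt ((hlab a b hab' hta).2.2.2).1 (by omega)
        refine ⟨a, b, hab', ?_, ?_⟩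
        · simp only [hta, hw, h1, h2, if_true, if_false]
        · simp only [hta, if_true]; rw [if_neg (by omega)]; omega
    · simp only [hw, if_false] at hl
      obtain ⟨a, b, hab, hta, hlb⟩ := h.surj w l hl
      have hta' : tid a ≠ tid x := fun h' => hw (hta ▸ h')
      refine ⟨a, b, hadj.2 ⟨hab, fun he => ?_⟩, ?_, ?_⟩
      · rcases Sym2.eq_iff.1 he with ⟨rfl, rfl⟩ | ⟨rfl, rfl⟩
        · exact hta' rfl
        · exact hta' hyx
      · simp only [hw, if_false, hta]
      · simp only [hta', if_false, hlb]
  · intro u v u' v' huv huv' ht hl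
    obtain ⟨ht, hr⟩ := htid u u' ht
    have huv0 := (hadj.1 huv).1
    have huv0' := (hadj.1 huv').1
    by_cases hu : tid u = tid x
    · have hu' := ht ▸ hu
      obtain ⟨h1, h2, h3, h4⟩ := hlab u v huv hu
      obtain ⟨h1', h2', h3', h4'⟩ := hlab u' v' huv' hu'
      have h6 : lab u v < lab y x ↔ lab u' v' < lab y x := by rw [← h4, ← h4', hr]
      have hsu := h.sz_congr _ _ hu
      by_cases h5 : lab u v < lab y x
      · simp only [hu, hu', h5, h6.1 h5, h4.2 h5, if_true] at hl
        rcases Nat.lt_or_ge (lab u v) (lab y x - 1) with h7 | h7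
        · rw [Nat.mod_eq_of_lt (by omega)] at hl
          exact h.next u v u' v' huv0 huv0' ht (by rw [hsu, Nat.mod_eq_of_lt] <;> omega)
        -- Wrap-around on the side of `y`: the dart just before the return `yx` ends at `y`, and the
        -- dart at time 1, just after `xy`, starts there.
        · rw [show lab u v - 1 + 1 = lab y x - 1 by omega, Nat.mod_self] at hl
          have e1 : u' = y := h.next x y u' v' hxy huv0' hu'.symm (by
            rw [Nat.mod_eq_of_lt] <;> omega)
          have e2 : y = v := h.next u v y x huv0 hxy.symm (hu.trans hyx.symm) (by
            rw [hsu, Nat.mod_eq_of_lt] <;> omega)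
          exact e1.trans e2
      · simp only [hu, hu', h5, mt h6.2 h5, mt h4.1 h5, if_true, if_false] at hl
        rcases Nat.lt_or_ge (lab u v) (sz x - 1) with h7 | h7
        · rw [Nat.mod_eq_of_lt (by omega)] at hl
          exact h.next u v u' v' huv0 huv0' ht (by rw [hsu, Nat.mod_eq_of_lt] <;> omega)
        -- Wrap-around on the side of `x`: the last dart of the old tour precedes `xy` and so ends
        -- at `x`, and the dart just after `yx` starts there.
        · rw [show lab u v - lab y x - 1 + 1 = sz x - lab y x - 1 by omega, Nat.mod_self] at hl
          have e1 : u' = x := h.next y x u' v' hxy.symm huv0' (hyx.trans hu'.symm) (by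
            rw [h.sz_congr _ _ hyx, Nat.mod_eq_of_lt] <;> omega)
          have e2 : x = v := h.next u v x y huv0 hxy hu (by
            rw [hsu, show lab u v + 1 = sz x by omega, Nat.mod_self, h0])
          exact e1.trans e2
    · have hu' : tid u' ≠ tid x := ht ▸ hu
      simp only [hu, hu', if_false] at hl
      exact h.next u v u' v' huv0 huv0' ht hl

open Classical in
/-- Joining two tours, which start at `a` and at `b`, along a new edge `ab`. -/
theorem link (h : Tour T tid lab sz) {a b : V} (hab : tid a ≠ tid b)
    (ha : ∀ u v, T.Adj u v → tid u = tid a → lab u v = 0 → u = a)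
    (hb : ∀ u v, T.Adj u v → tid u = tid b → lab u v = 0 → u = b) :
    Tour (T ⊔ edge a b) (fun v => if tid v = tid b then tid a else tid v)
      (fun u v => if u = a ∧ v = b then sz a else if u = b ∧ v = a then sz a + sz b + 1 else
        if tid u = tid a then lab u v else if tid u = tid b then sz a + 1 + lab u v else lab u v)
      (fun v => if tid v = tid a ∨ tid v = tid b then sz a + sz b + 2 else sz v) := by
  have hne : a ≠ b := fun h => hab (h ▸ rfl)
  have hnab : ¬ T.Adj a b := fun h' => hab (h.adj _ _ h')
  have hnba : ¬ T.Adj b a := fun h' => hab (h.adj _ _ h').symm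
  have hadj : ∀ {u v}, (T ⊔ edge a b).Adj u v ↔ T.Adj u v ∨ (u = a ∧ v = b) ∨ (u = b ∧ v = a) :=
    sup_edge_adj hne
  -- The joined tour: the tour of `a`, then `ab` at time `sz a`, the tour of `b` from `sz a + 1` on,
  -- and `ba` at the last time. An isolated end has an empty tour of size 0.
  set L : V → V → ℕ := fun u v => if u = a ∧ v = b then sz a else if u = b ∧ v = a then
    sz a + sz b + 1 else if tid u = tid a then lab u v else if tid u = tid b then
    sz a + 1 + lab u v else lab u v with hL
  have Lab : L a b = sz a := by simp [hL]
  have Lba : L b a = sz a + sz b + 1 := by simp [hL, hne.symm]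
  have LA : ∀ u v, T.Adj u v → tid u = tid a → L u v = lab u v ∧ lab u v < sz a := by
    intro u v huv hu
    have h1 : ¬ (u = a ∧ v = b) := by rintro ⟨rfl, rfl⟩; exact hnab huv
    have h2 : ¬ (u = b ∧ v = a) := by rintro ⟨rfl, rfl⟩; exact hnba huv
    exact ⟨by simp only [hL, h1, h2, hu, if_true, if_false], h.sz_congr _ _ hu ▸ h.lt u v huv⟩
  have LB : ∀ u v, T.Adj u v → tid u = tid b → L u v = sz a + 1 + lab u v ∧ lab u v < sz b := by
    intro u v huv hu
    have h1 : ¬ (u = a ∧ v = b) := by rintro ⟨rfl, rfl⟩; exact hnab huv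
    have h2 : ¬ (u = b ∧ v = a) := by rintro ⟨rfl, rfl⟩; exact hnba huv
    exact ⟨by simp only [hL, h1, h2, hu, hab.symm, if_true, if_false],
      h.sz_congr _ _ hu ▸ h.lt u v huv⟩
  have LC : ∀ u v, T.Adj u v → tid u ≠ tid a → tid u ≠ tid b → L u v = lab u v := by
    intro u v huv hu hu'
    have h1 : ¬ (u = a ∧ v = b) := by rintro ⟨rfl, rfl⟩; exact hu rfl
    have h2 : ¬ (u = b ∧ v = a) := by rintro ⟨rfl, rfl⟩; exact hu' rfl
    simp only [hL, h1, h2, hu, hu', if_false]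
  set M : V → V := fun v => if tid v = tid b then tid a else tid v with hM
  set Z : V → ℕ := fun v => if tid v = tid a ∨ tid v = tid b then sz a + sz b + 2 else sz v with hZ
  have ZA : ∀ v, tid v = tid a → Z v = sz a + sz b + 2 := fun v hv => by simp [hZ, hv]
  have ZB : ∀ v, tid v = tid b → Z v = sz a + sz b + 2 := fun v hv => by simp [hZ, hv]
  have ZC : ∀ v, tid v ≠ tid a → tid v ≠ tid b → Z v = sz v := fun v hv hv' => by simp [hZ, hv, hv']
  have hMM : ∀ u v, M u = M v → tid u = tid v ∨
      ((tid u = tid a ∨ tid u = tid b) ∧ (tid v = tid a ∨ tid v = tid b)) := by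
    intro u v; simp only [hM]; split_ifs <;> grind
  have cases : ∀ u v, (T ⊔ edge a b).Adj u v → (T.Adj u v ∧ tid u = tid a) ∨
      (T.Adj u v ∧ tid u = tid b) ∨ (T.Adj u v ∧ tid u ≠ tid a ∧ tid u ≠ tid b) ∨
      (u = a ∧ v = b) ∨ (u = b ∧ v = a) := by
    intro u v huv
    rcases hadj.1 huv with h1 | h1 | h1 <;> tauto
  refine ⟨?_, ?_, ?_, ?_, ?_, ?_⟩
  · intro u v huv
    rcases hMM u v huv with h1 | ⟨h1, h2⟩
    · simp only [hZ, h1, h.sz_congr u v h1]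
    · simp only [hZ, h1, h2, if_true]
  · intro u v huv
    rcases hadj.1 huv with h1 | ⟨rfl, rfl⟩ | ⟨rfl, rfl⟩
    · simp only [hM, h.adj u v h1]
    · simp [hM]
    · simp [hM]
  · intro u v huv
    rcases cases u v huv with ⟨h1, h2⟩ | ⟨h1, h2⟩ | ⟨h1, h2, h3⟩ | ⟨rfl, rfl⟩ | ⟨rfl, rfl⟩
    · have := LA u v h1 h2; rw [ZA u h2]; omega
    · have := LB u v h1 h2; rw [ZB u h2]; omega
    · rw [LC u v h1 h2 h3, ZC u h2 h3]; exact h.lt u v h1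
    · rw [Lab, ZA _ rfl]; omega
    · rw [Lba, ZB _ rfl]; omega
  · intro u v u' v' huv huv' ht hl
    have hm := hMM u u' ht
    rcases cases u v huv with ⟨h1, h2⟩ | ⟨h1, h2⟩ | ⟨h1, h2, h3⟩ | ⟨rfl, rfl⟩ | ⟨rfl, rfl⟩ <;>
    rcases cases u' v' huv' with ⟨h1', h2'⟩ | ⟨h1', h2'⟩ | ⟨h1', h2', h3'⟩ | ⟨rfl, rfl⟩ | ⟨rfl, rfl⟩
    · have e1 := LA u v h1 h2; have e2 := LA u' v' h1' h2'
      exact h.inj u v u' v' h1 h1' (h2.trans h2'.symm) (by omega)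
    · have e1 := LA u v h1 h2; have e2 := LB u' v' h1' h2'; omega
    · grind
    · have e1 := LA u v h1 h2; omega
    · have e1 := LA u v h1 h2; omega
    · have e1 := LB u v h1 h2; have e2 := LA u' v' h1' h2'; omega
    · have e1 := LB u v h1 h2; have e2 := LB u' v' h1' h2'
      exact h.inj u v u' v' h1 h1' (h2.trans h2'.symm) (by omega)
    · grind
    · have e1 := LB u v h1 h2; omega
    · have e1 := LB u v h1 h2; omega
    · grind
    · grind
    · have e1 := LC u v h1 h2 h3; have e2 := LC u' v' h1' h2' h3'
      refine h.inj u v u' v' h1 h1' ?_ (by omega)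
      tauto
    · grind
    · grind
    · have e1 := LA u' v' h1' h2'; omega
    · have e1 := LB u' v' h1' h2'; omega
    · grind
    · exact ⟨rfl, rfl⟩
    · omega
    · have e1 := LA u' v' h1' h2'; omega
    · have e1 := LB u' v' h1' h2'; omega
    · grind
    · omega
    · exact ⟨rfl, rfl⟩
  · intro w l hl
    by_cases hw : tid w = tid a ∨ tid w = tid b
    · have hMw : M w = tid a := by simp only [hM]; split_ifs <;> tauto
      have hMa : M a = tid a := by simp [hM]
      have hMb : M b = tid a := by simp [hM]
      have hl : l < sz a + sz b + 2 := by simpa only [hZ, hw, if_true] using hl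
      by_cases c1 : l < sz a
      · obtain ⟨u, v, huv, hu, hlb⟩ := h.surj a l c1
        refine ⟨u, v, hadj.2 (Or.inl huv), ?_, ?_⟩
        · rw [hMw, ← hMa]; simp only [hM, hu]
        · rw [(LA u v huv hu).1, hlb]
      · by_cases c2 : l = sz a
        · exact ⟨a, b, hadj.2 (by tauto), by rw [hMw, hMa], by rw [Lab, c2]⟩
        · by_cases c3 : l = sz a + sz b + 1
          · exact ⟨b, a, hadj.2 (by tauto), by rw [hMw, hMb], by rw [Lba, c3]⟩
          · obtain ⟨u, v, huv, hu, hlb⟩ := h.surj b (l - sz a - 1) (by omega)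
            refine ⟨u, v, hadj.2 (Or.inl huv), ?_, ?_⟩
            · rw [hMw, ← hMb]; simp only [hM, hu]
            · rw [(LB u v huv hu).1, hlb]; omega
    · push Not at hw
      rw [ZC w hw.1 hw.2] at hl
      obtain ⟨u, v, huv, hu, hlb⟩ := h.surj w l hl
      refine ⟨u, v, hadj.2 (Or.inl huv), ?_, ?_⟩
      · simp only [hM, hu]
      · rw [LC u v huv (hu ▸ hw.1) (hu ▸ hw.2), hlb]
  · -- consecutive darts
    have endA : ∀ u v, T.Adj u v → tid u = tid a → lab u v + 1 = sz a → v = a := by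
      intro u v huv hu hl
      -- The tour is closed, so its last dart ends where the dart at time 0 starts, which is `a`.
      obtain ⟨p, q, hpq, hp, hlb⟩ := h.surj a 0 (by omega)
      have e1 := ha p q hpq hp hlb
      have e2 := h.next u v p q huv hpq (hu.trans hp.symm) (by
        rw [h.sz_congr _ _ hu, hl, Nat.mod_self, hlb])
      exact e2.symm.trans e1
    have endB : ∀ u v, T.Adj u v → tid u = tid b → lab u v + 1 = sz b → v = b := by
      intro u v huv hu hl
      obtain ⟨p, q, hpq, hp, hlb⟩ := h.surj b 0 (by omega)
      have e1 := hb p q hpq hp hlb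
      have e2 := h.next u v p q huv hpq (hu.trans hp.symm) (by
        rw [h.sz_congr _ _ hu, hl, Nat.mod_self, hlb])
      exact e2.symm.trans e1
    intro u v u' v' huv huv' ht hl
    have hm := hMM u u' ht
    rcases cases u v huv with ⟨h1, h2⟩ | ⟨h1, h2⟩ | ⟨h1, h2, h3⟩ | ⟨rfl, rfl⟩ | ⟨rfl, rfl⟩
    · have e1 := LA u v h1 h2
      rw [ZA u h2, e1.1, Nat.mod_eq_of_lt (by omega)] at hl
      rcases cases u' v' huv' with ⟨h1', h2'⟩ | ⟨h1', h2'⟩ | ⟨h1', h2', h3'⟩ | ⟨rfl, rfl⟩ | ⟨rfl, rfl⟩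
      · have e2 := LA u' v' h1' h2'
        exact h.next u v u' v' h1 h1' (h2.trans h2'.symm) (by
          rw [h.sz_congr _ _ h2, Nat.mod_eq_of_lt] <;> omega)
      · have e2 := LB u' v' h1' h2'; omega
      · grind
      · exact (endA u v h1 h2 (by omega)).symm
      · omega
    · have e1 := LB u v h1 h2
      rw [ZB u h2, e1.1, Nat.mod_eq_of_lt (by omega)] at hl
      rcases cases u' v' huv' with ⟨h1', h2'⟩ | ⟨h1', h2'⟩ | ⟨h1', h2', h3'⟩ | ⟨rfl, rfl⟩ | ⟨rfl, rfl⟩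
      · have e2 := LA u' v' h1' h2'; omega
      · have e2 := LB u' v' h1' h2'
        exact h.next u v u' v' h1 h1' (h2.trans h2'.symm) (by
          rw [h.sz_congr _ _ h2, Nat.mod_eq_of_lt] <;> omega)
      · grind
      · omega
      · exact (endB u v h1 h2 (by omega)).symm
    · rw [ZC u h2 h3, LC u v h1 h2 h3] at hl
      have hu' : tid u = tid u' := by tauto
      have h1' : T.Adj u' v' := by
        rcases hadj.1 huv' with h' | ⟨rfl, rfl⟩ | ⟨rfl, rfl⟩
        · exact h'
        · exact absurd hu' h2
        · exact absurd hu' h3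
      rw [LC u' v' h1' (hu' ▸ h2) (hu' ▸ h3)] at hl
      exact h.next u v u' v' h1 h1' hu' hl
    · rw [ZA u rfl, Lab, Nat.mod_eq_of_lt (by omega)] at hl
      rcases cases u' v' huv' with ⟨h1', h2'⟩ | ⟨h1', h2'⟩ | ⟨h1', h2', h3'⟩ | ⟨rfl, rfl⟩ | ⟨rfl, rfl⟩
      · have e2 := LA u' v' h1' h2'; omega
      · have e2 := LB u' v' h1' h2'; exact hb u' v' h1' h2' (by omega)
      · grind
      · omega
      · rfl
    · rw [ZB u rfl, Lba, Nat.mod_self] at hl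
      rcases cases u' v' huv' with ⟨h1', h2'⟩ | ⟨h1', h2'⟩ | ⟨h1', h2', h3'⟩ | ⟨rfl, rfl⟩ | ⟨rfl, rfl⟩
      · have e2 := LA u' v' h1' h2'; exact ha u' v' h1' h2' (by omega)
      · have e2 := LB u' v' h1' h2'; omega
      · grind
      · rfl
      · omega

end Tour
end KMachine

/-! ### Tour sizes, and minimum spanning forests under insertions and deletions -/

namespace KMachine
open SimpleGraph

/-- The labels are a bijection between the darts of a tree and the numbers below `sz`. `Tour`
carries surjectivity for this count and for naming the dart at a given time. -/
theorem Tour.tourSize_eq {n : ℕ} {T : SimpleGraph (Fin n)} {tid : Fin n → Fin n}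
    {lab : Fin n → Fin n → ℕ} {sz : Fin n → ℕ} (h : Tour T tid lab sz)
    (hc : NamesComponents T tid) (u : Fin n) : tourSize T u = sz u := by
  rw [tourSize, ← Nat.card_coe_set_eq, ← Nat.card_fin (sz u)]
  refine Nat.card_congr (Equiv.ofBijective
    (fun d => (⟨lab d.1.1 d.1.2, by
      rw [h.sz_congr _ _ ((hc.iff _ _).1 d.2.2)]; exact h.lt _ _ d.2.1⟩ : Fin (sz u))) ⟨?_, ?_⟩)
  · rintro ⟨⟨a, b⟩, hab, hua⟩ ⟨⟨a', b'⟩, hab', hua'⟩ he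
    have := h.inj a b a' b' hab hab' ((hc.iff _ _).1 (hua.symm.trans hua')) (by simpa using he)
    simp [this.1, this.2]
  · rintro ⟨l, hl⟩
    obtain ⟨a, b, hab, hta, hlab⟩ := h.surj u l hl
    exact ⟨⟨(a, b), hab, (hc.iff _ _).2 hta.symm⟩, by simpa using hlab⟩

theorem Tour.isEulerTour {n : ℕ} {T : SimpleGraph (Fin n)} {tid : Fin n → Fin n}
    {lab : Fin n → Fin n → ℕ} {sz : Fin n → ℕ} (h : Tour T tid lab sz)
    (hc : NamesComponents T tid) : IsEulerTour T lab where
  lt u v huv := h.tourSize_eq hc u ▸ h.lt u v huv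
  inj u v u' v' h1 h2 h3 := h.inj u v u' v' h1 h2 ((hc.iff _ _).1 h3)
  next u v u' v' h1 h2 h3 h4 := h.next u v u' v' h1 h2 ((hc.iff _ _).1 h3)
    (h.tourSize_eq hc u ▸ h4)

theorem tourSize_le {n : ℕ} (T : SimpleGraph (Fin n)) (u : Fin n) : tourSize T u ≤ n ^ 2 := by
  refine (Set.ncard_le_card _).trans ?_
  simp [sq]

section Weight
variable {n : ℕ} {w : Sym2 (Fin n) → ℤ} {T : SimpleGraph (Fin n)}

theorem totalWeight_congr {w' : Sym2 (Fin n) → ℤ} (h : ∀ e ∈ T.edgeSet, w e = w' e) :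
    totalWeight w T = totalWeight w' T :=
  Finset.sum_congr rfl fun e he => h e (by simpa using he)

theorem totalWeight_sup_edge {a b : Fin n} (hab : a ≠ b) (hT : ¬ T.Adj a b) :
    totalWeight w (T ⊔ edge a b) = totalWeight w T + w s(a, b) := by
  classical
  rw [totalWeight, totalWeight, add_comm, ← Finset.sum_insert (by simpa using hT)]
  congr 1
  ext e
  simp [edgeSet_edge_of_ne hab]

theorem totalWeight_deleteEdge {x y : Fin n} (hT : T.Adj x y) :
    totalWeight w (T.deleteEdges {s(x, y)}) = totalWeight w T - w s(x, y) := by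
  classical
  rw [eq_sub_iff_add_eq, totalWeight, totalWeight, add_comm, ← Finset.sum_insert (by simp)]
  congr 1
  ext e
  simp only [edgeSet_deleteEdges, Finset.mem_insert, Set.Finite.mem_toFinset, Set.mem_sdiff,
    Set.mem_singleton_iff]
  constructor
  · rintro (rfl | h)
    · exact hT
    · exact h.1
  · intro h; by_cases he : e = s(x, y) <;> tauto

end Weight

section Spanning
variable {n : ℕ} {G F : SimpleGraph (Fin n)}

/-- The path from `a` to `b` in `F` must use `xy`, since otherwise it would survive the deletion. So
`a` and `b` lie on the two sides of `xy`, and `ab` reconnects these. -/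
theorem IsSpanningForest.exchange (h : IsSpanningForest G F) {x y a b : Fin n} (hxy : F.Adj x y)
    (hab : G.Adj a b) (hcross : ¬ (F.deleteEdges {s(x, y)}).Reachable a b) :
    IsSpanningForest G (F.deleteEdges {s(x, y)} ⊔ edge a b) := by
  have hF := deleteEdge_not_reachable h.acyclic hxy
  set D := F.deleteEdges {s(x, y)} with hD
  have hDF : D ≤ F := deleteEdges_le _
  have hadj : ∀ {u v}, (D ⊔ edge a b).Adj u v ↔ _ := sup_edge_adj hab.ne
  refine ⟨sup_le (hDF.trans h.le) (by simp [hab.ne, hab]),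
    (h.acyclic.anti hDF).sup_edge_of_not_reachable hcross, fun u v huv => ?_⟩
  have hedge : (D ⊔ edge a b).Reachable a b := (hadj.2 (by tauto)).reachable
  have mono : ∀ {u v}, D.Reachable u v → (D ⊔ edge a b).Reachable u v := fun h' =>
    h'.mono le_sup_left
  have hxy' : (D ⊔ edge a b).Reachable x y := by
    by_cases hxa : F.Reachable x a
    · have hxb : F.Reachable x b := hxa.trans (h.spanning _ _ hab.reachable)
      rcases reachable_deleteEdge_or hxa with h1 | h1 <;>
        rcases reachable_deleteEdge_or hxb with h2 | h2
      · exact absurd (h1.symm.trans h2) hcross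
      · exact (mono h1).trans (hedge.trans (mono h2).symm)
      · exact ((mono h1).trans (hedge.trans (mono h2).symm)).symm
      · exact absurd (h1.symm.trans h2) hcross
    · exfalso
      refine hcross (reachable_induction (P := fun v => D.Reachable a v)
        (h.spanning _ _ hab.reachable) (Reachable.refl _) ?_)
      intro p q hpq hp
      refine hp.trans (Adj.reachable (deleteEdges_singleton_adj.2 ⟨hpq, fun he => hxa ?_⟩))
      have hp' := hp.mono hDF
      rcases Sym2.eq_iff.1 he with ⟨rfl, _⟩ | ⟨rfl, _⟩
      · exact hp'.symm
      · exact hxy.reachable.trans hp'.symm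
  refine reachable_of_adj_reachable (fun p q hpq => ?_) (h.spanning u v huv)
  by_cases he : s(p, q) = s(x, y)
  · rcases Sym2.eq_iff.1 he with ⟨rfl, rfl⟩ | ⟨rfl, rfl⟩
    · exact hxy'
    · exact hxy'.symm
  · exact mono (deleteEdges_singleton_adj.2 ⟨hpq, he⟩).reachable

/-- The path from `u` to `v` leaves `S` along some edge. Paths in a forest are unique, so every walk
from `u` to `v` uses this edge. -/
theorem exists_separating_adj (hF : F.IsAcyclic) {u v : Fin n} (huv : F.Reachable u v)
    {S : Set (Fin n)} (hu : u ∈ S) (hv : v ∉ S) : ∃ p q, F.Adj p q ∧ p ∈ S ∧ q ∉ S ∧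
      ¬ (F.deleteEdges {s(p, q)}).Reachable u v := by
  classical
  obtain ⟨w⟩ := huv
  obtain ⟨d, hd, h1, h2⟩ := w.toPath.1.exists_boundary_dart S hu hv
  refine ⟨d.fst, d.snd, d.adj, h1, h2, fun hr => ?_⟩
  rw [reachable_deleteEdges_iff_exists_walk] at hr
  obtain ⟨q, hq⟩ := hr
  have := (hF.subsingleton_path u v).elim w.toPath q.toPath
  refine hq (q.edges_toPath_subset_edges ?_)
  rw [← this]
  exact List.mem_map_of_mem hd

end Spanning

section MSF
variable {n : ℕ} {G G' : WGraph n} {T : SimpleGraph (Fin n)} {u v : Fin n}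

/-- The two weight functions agree on the edges of `G`; this allows the optimality of `T` to be used
with the new weights. -/
theorem IsMSF.le_of_le (h : IsMSF G T) (hw : ∀ e ∈ G.graph.edgeSet, G'.weight e = G.weight e)
    {F : SimpleGraph (Fin n)} (hF : IsSpanningForest G.graph F) :
    totalWeight G'.weight T ≤ totalWeight G'.weight F := by
  have hsub : ∀ {F'}, IsSpanningForest G.graph F' → ∀ e ∈ F'.edgeSet, G'.weight e = G.weight e :=
    fun h' e he => hw e (edgeSet_mono h'.le he)
  rw [totalWeight_congr (hsub h.spanningForest), totalWeight_congr (hsub hF)]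
  exact h.minimal F hF

theorem totalWeight_exchange {w : Sym2 (Fin n) → ℤ} {F : SimpleGraph (Fin n)} {x y a b : Fin n}
    (hxy : F.Adj x y) (hab : ¬ (F.deleteEdges {s(x, y)}).Reachable a b) :
    totalWeight w (F.deleteEdges {s(x, y)} ⊔ edge a b) =
      totalWeight w F - w s(x, y) + w s(a, b) := by
  have hne : a ≠ b := by rintro rfl; exact hab (Reachable.refl _)
  rw [totalWeight_sup_edge hne fun h => hab h.reachable, totalWeight_deleteEdge hxy]

theorem le_of_not_adj (hg : G'.graph = G.graph ⊔ edge u v) (huv : u ≠ v)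
    {F : SimpleGraph (Fin n)} (hF : F ≤ G'.graph) (h : ¬ F.Adj u v) : F ≤ G.graph := by
  intro a b hab
  have := hF hab
  rw [hg, sup_edge_adj huv] at this
  rcases this with h1 | ⟨rfl, rfl⟩ | ⟨rfl, rfl⟩
  · exact h1
  · exact absurd hab h
  · exact absurd hab.symm h

theorem IsSpanningForest.of_le {G G' F : SimpleGraph (Fin n)} (h : IsSpanningForest G' F)
    (hG : G ≤ G') (hF : F ≤ G) : IsSpanningForest G F :=
  ⟨hF, h.acyclic, fun a b hab => h.spanning a b (hab.mono hG)⟩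

theorem IsSpanningForest.sup_edge (hF : IsSpanningForest G.graph T)
    (hg : G'.graph = G.graph ⊔ edge u v) (huv : T.Reachable u v) :
    IsSpanningForest G'.graph T := by
  refine ⟨hF.le.trans (hg ▸ le_sup_left), hF.acyclic, fun a b => reachable_of_adj_reachable ?_⟩
  intro p q hpq
  have hne : u ≠ v ∨ u = v := by tauto
  rcases hne with hne | rfl
  · rw [hg, sup_edge_adj hne] at hpq
    rcases hpq with h1 | ⟨rfl, rfl⟩ | ⟨rfl, rfl⟩
    · exact hF.spanning _ _ h1.reachable
    · exact huv
    · exact huv.symm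
  · rw [hg, SimpleGraph.sup_edge_self] at hpq
    exact hF.spanning _ _ hpq.reachable

/-- After the insertion of an edge within a tree, exchange a heaviest edge between its ends for
a lightest crossing edge. -/
theorem IsMSF.insert_exchange (h : IsMSF G T) (hg : G'.graph = G.graph ⊔ edge u v) (huv : u ≠ v)
    (hw : ∀ e ∈ G.graph.edgeSet, G'.weight e = G.weight e) (hT : T.Reachable u v)
    {x y a b : Fin n} (hxy : T.Adj x y) (hsep : ¬ (T.deleteEdges {s(x, y)}).Reachable u v)
    (hmax : ∀ x' y', T.Adj x' y' → ¬ (T.deleteEdges {s(x', y')}).Reachable u v →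
      G'.weight s(x', y') ≤ G'.weight s(x, y))
    (hab : G'.graph.Adj a b) (hcross : ¬ (T.deleteEdges {s(x, y)}).Reachable a b)
    (hmin : ∀ a' b', G'.graph.Adj a' b' → ¬ (T.deleteEdges {s(x, y)}).Reachable a' b' →
      G'.weight s(a, b) ≤ G'.weight s(a', b')) :
    IsMSF G' (T.deleteEdges {s(x, y)} ⊔ edge a b) := by
  have hGG' : G.graph ≤ G'.graph := hg ▸ le_sup_left
  have hT' := h.spanningForest.sup_edge hg hT
  refine ⟨hT'.exchange hxy hab hcross, fun F hF => ?_⟩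
  rw [totalWeight_exchange hxy hcross]
  have h1 := hmin x y (hT'.le hxy) (deleteEdge_not_reachable hT'.acyclic hxy)
  have h2 := hmin u v (hg ▸ (sup_edge_adj huv).2 (by tauto)) hsep
  -- If `F` contains `uv`, an edge `pq` of the `T`-path from `u` to `v` can replace it and gives a
  -- spanning forest of `G`. In weight, `T ≤ F - uv + pq`, `pq ≤ xy` and `ab ≤ uv`. Otherwise `F` is
  -- itself a spanning forest of `G`, and `ab ≤ xy` because `xy` crosses its own cut.
  by_cases hFuv : F.Adj u v
  · have hbr := deleteEdge_not_reachable hF.acyclic hFuv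
    obtain ⟨p, q, hpq, hp, hq, hs⟩ := exists_separating_adj hT'.acyclic hT
      (S := {z | (F.deleteEdges {s(u, v)}).Reachable u z}) (Reachable.refl _) hbr
    have hcr : ¬ (F.deleteEdges {s(u, v)}).Reachable p q := fun h' => hq (Reachable.trans hp h')
    have hex := hF.exchange hFuv (hT'.le hpq) hcr
    have hF2 : F.deleteEdges {s(u, v)} ⊔ edge p q ≤ G.graph := by
      refine sup_le (le_of_not_adj hg huv ((deleteEdges_le _).trans hF.le) (by simp)) ?_
      have := h.spanningForest.le hpq
      simp [this]
    have h3 := h.le_of_le hw (hex.of_le hGG' hF2)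
    rw [totalWeight_exchange hFuv hcr] at h3
    have h4 := hmax p q hpq hs
    linarith
  · have h3 := h.le_of_le hw (hF.of_le hGG' (le_of_not_adj hg huv hF.le hFuv))
    linarith

/-- Only the new edge can run between different trees of `T`, so `ab` is `uv`. It is a bridge of
`G'`, so every spanning forest of `G'` contains it and without it is a spanning forest of `G`. -/
theorem IsMSF.insert_link (h : IsMSF G T) (hg : G'.graph = G.graph ⊔ edge u v) (huv : u ≠ v)
    (hw : ∀ e ∈ G.graph.edgeSet, G'.weight e = G.weight e) (hT : ¬ T.Reachable u v)
    {a b : Fin n} (hab : G'.graph.Adj a b) (hcross : ¬ T.Reachable a b) :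
    IsMSF G' (T ⊔ edge a b) := by
  have hsf := h.spanningForest
  have hGG' : G.graph ≤ G'.graph := hg ▸ le_sup_left
  have hedge : edge a b = edge u v := by
    rw [hg, sup_edge_adj huv] at hab
    rcases hab with h1 | ⟨rfl, rfl⟩ | ⟨rfl, rfl⟩
    · exact absurd (hsf.spanning _ _ h1.reachable) hcross
    · rfl
    · exact edge_comm ..
  rw [hedge]
  have huv' : G'.graph.Adj u v := hg ▸ (sup_edge_adj huv).2 (by tauto)
  have hsp : IsSpanningForest G'.graph (T ⊔ edge u v) := by
    refine ⟨sup_le (hsf.le.trans hGG') (by simp [huv']), hsf.acyclic.sup_edge_of_not_reachable hT,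
      fun p q => reachable_of_adj_reachable ?_⟩
    intro p q hpq
    rw [hg, sup_edge_adj huv] at hpq
    rcases hpq with h1 | h1
    · exact (hsf.spanning _ _ h1.reachable).mono le_sup_left
    · exact ((sup_edge_adj huv).2 (Or.inr h1)).reachable
  refine ⟨hsp, fun F hF => ?_⟩
  have hFuv : F.Adj u v := by
    by_contra hFuv
    have := le_of_not_adj hg huv hF.le hFuv
    exact hT (reachable_of_adj_reachable (fun p q hpq => hsf.spanning _ _ (this hpq).reachable)
      (hF.spanning _ _ huv'.reachable))
  have hD : IsSpanningForest G.graph (F.deleteEdges {s(u, v)}) := by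
    refine ⟨le_of_not_adj hg huv ((deleteEdges_le _).trans hF.le) (by simp),
      hF.acyclic.anti (deleteEdges_le _), fun p q hpq => ?_⟩
    have hDG : F.deleteEdges {s(u, v)} ≤ G.graph :=
      le_of_not_adj hg huv ((deleteEdges_le _).trans hF.le) (by simp)
    have hback : ∀ {c d}, (F.deleteEdges {s(u, v)}).Reachable c d → T.Reachable c d :=
      fun h' => reachable_of_adj_reachable (fun c d hcd => hsf.spanning _ _ (hDG hcd).reachable) h'
    have hTpq := hsf.spanning _ _ hpq
    have hFpq := hF.spanning _ _ (hpq.mono hGG')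
    by_contra hn
    by_cases hup : F.Reachable u p
    · rcases reachable_deleteEdge_or (y := v) hup with h1 | h1 <;>
        rcases reachable_deleteEdge_or (y := v) (hup.trans hFpq) with h2 | h2
      · exact hn (h1.symm.trans h2)
      · exact hT ((hback h1).trans (hTpq.trans (hback h2).symm))
      · exact hT ((hback h2).trans (hTpq.symm.trans (hback h1).symm))
      · exact hn (h1.symm.trans h2)
    · refine hn (reachable_induction (P := fun z => (F.deleteEdges {s(u, v)}).Reachable p z) hFpq
        (Reachable.refl _) ?_)
      intro c d hcd hc
      refine hc.trans (Adj.reachable (deleteEdges_singleton_adj.2 ⟨hcd, fun he => hup ?_⟩))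
      have hc' := hc.mono (deleteEdges_le _)
      rcases Sym2.eq_iff.1 he with ⟨rfl, _⟩ | ⟨rfl, _⟩
      · exact hc'.symm
      · exact hFuv.reachable.trans hc'.symm
  have h3 := h.le_of_le hw hD
  rw [totalWeight_deleteEdge hFuv] at h3
  rw [totalWeight_sup_edge huv fun h' => hT h'.reachable]
  linarith

/-- A replacement edge exists, so a spanning forest `F` of `G'` spans `G` as well. Its path from `u`
to `v` crosses the cut `T - uv` at some `pq`; in weight, `T ≤ F - pq + uv` and `ab ≤ pq`. -/
theorem IsMSF.delete_exchange (h : IsMSF G T) (hg : G'.graph = G.graph.deleteEdges {s(u, v)})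
    (hw : ∀ e ∈ G.graph.edgeSet, G'.weight e = G.weight e) (hT : T.Adj u v)
    {a b : Fin n} (hab : G'.graph.Adj a b) (hcross : ¬ (T.deleteEdges {s(u, v)}).Reachable a b)
    (hmin : ∀ a' b', G'.graph.Adj a' b' → ¬ (T.deleteEdges {s(u, v)}).Reachable a' b' →
      G'.weight s(a, b) ≤ G'.weight s(a', b')) :
    IsMSF G' (T.deleteEdges {s(u, v)} ⊔ edge a b) := by
  have hGG' : G'.graph ≤ G.graph := hg ▸ deleteEdges_le _
  have hsf := h.spanningForest
  have hTD : T.deleteEdges {s(u, v)} ≤ G'.graph := by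
    intro p q hpq
    rw [deleteEdges_singleton_adj] at hpq
    rw [hg, deleteEdges_singleton_adj]
    exact ⟨hsf.le hpq.1, hpq.2⟩
  have hex := hsf.exchange hT (hGG' hab) hcross
  have hsp := hex.of_le hGG' (sup_le hTD (by simp [hab]))
  have huv' : G'.graph.Reachable u v :=
    (hex.spanning u v (hsf.le hT).reachable).mono (sup_le hTD (by simp [hab]))
  refine ⟨hsp, fun F hF => ?_⟩
  have hFG : IsSpanningForest G.graph F := by
    refine ⟨hF.le.trans hGG', hF.acyclic, fun p q => reachable_of_adj_reachable ?_⟩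
    intro c d hcd
    by_cases he : s(c, d) = s(u, v)
    · have := hF.spanning _ _ huv'
      rcases Sym2.eq_iff.1 he with ⟨rfl, rfl⟩ | ⟨rfl, rfl⟩
      · exact this
      · exact this.symm
    · exact hF.spanning _ _ (Adj.reachable (hg ▸ deleteEdges_singleton_adj.2 ⟨hcd, he⟩))
  obtain ⟨p, q, hpq, hp, hq, hs⟩ := exists_separating_adj hF.acyclic (hF.spanning _ _ huv')
    (S := {z | (T.deleteEdges {s(u, v)}).Reachable u z}) (Reachable.refl _)
    (deleteEdge_not_reachable hsf.acyclic hT)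
  have h1 := hmin p q (hF.le hpq) fun h' => hq (Reachable.trans hp h')
  have h2 := h.le_of_le hw (hFG.exchange hpq (hsf.le hT) hs)
  rw [totalWeight_exchange hpq hs] at h2
  rw [totalWeight_exchange hT hcross]
  linarith

/-- Here `uv` is a bridge of `G`, and adding it to a spanning forest of `G'` gives one of `G`. -/
theorem IsMSF.delete_bridge (h : IsMSF G T) (hg : G'.graph = G.graph.deleteEdges {s(u, v)})
    (hw : ∀ e ∈ G.graph.edgeSet, G'.weight e = G.weight e) (hT : T.Adj u v)
    (hno : ∀ a b, G'.graph.Adj a b → (T.deleteEdges {s(u, v)}).Reachable a b) :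
    IsMSF G' (T.deleteEdges {s(u, v)}) := by
  have hGG' : G'.graph ≤ G.graph := hg ▸ deleteEdges_le _
  have hsf := h.spanningForest
  have hTD : T.deleteEdges {s(u, v)} ≤ G'.graph := by
    intro p q hpq
    rw [deleteEdges_singleton_adj] at hpq
    rw [hg, deleteEdges_singleton_adj]
    exact ⟨hsf.le hpq.1, hpq.2⟩
  refine ⟨⟨hTD, hsf.acyclic.anti (deleteEdges_le _), fun p q => reachable_of_adj_reachable hno⟩,
    fun F hF => ?_⟩
  have hFuv : ¬ F.Reachable u v := fun h' => deleteEdge_not_reachable hsf.acyclic hT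
    (reachable_of_adj_reachable (fun p q hpq => hno p q (hF.le hpq)) h')
  have hedge : edge u v ≤ G.graph := by simp [hsf.le hT]
  have hFG : IsSpanningForest G.graph (F ⊔ edge u v) := by
    refine ⟨sup_le (hF.le.trans hGG') hedge, hF.acyclic.sup_edge_of_not_reachable hFuv,
      fun p q => reachable_of_adj_reachable ?_⟩
    intro c d hcd
    by_cases he : s(c, d) = s(u, v)
    · refine Adj.reachable ((sup_edge_adj hT.ne).2 (Or.inr ?_))
      exact Sym2.eq_iff.1 he
    · exact (hF.spanning _ _ (Adj.reachable
        (hg ▸ deleteEdges_singleton_adj.2 ⟨hcd, he⟩))).mono le_sup_left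
  have h2 := h.le_of_le hw hFG
  rw [totalWeight_sup_edge hT.ne fun h' => hFuv h'.reachable] at h2
  rw [totalWeight_deleteEdge hT]
  linarith

theorem IsMSF.delete_nontree (h : IsMSF G T) (hg : G'.graph = G.graph.deleteEdges {s(u, v)})
    (hw : ∀ e ∈ G.graph.edgeSet, G'.weight e = G.weight e) (hT : ¬ T.Adj u v) :
    IsMSF G' T := by
  have hGG' : G'.graph ≤ G.graph := hg ▸ deleteEdges_le _
  have hsf := h.spanningForest
  have hTG : T ≤ G'.graph := by
    intro p q hpq
    rw [hg, deleteEdges_singleton_adj]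
    refine ⟨hsf.le hpq, fun he => hT ?_⟩
    rcases Sym2.eq_iff.1 he with ⟨rfl, rfl⟩ | ⟨rfl, rfl⟩
    · exact hpq
    · exact hpq.symm
  refine ⟨hsf.of_le hGG' hTG, fun F hF => h.le_of_le hw ⟨hF.le.trans hGG', hF.acyclic, ?_⟩⟩
  exact fun p q hpq => hF.spanning _ _ ((hsf.spanning p q hpq).mono hTG)

end MSF
end KMachine

namespace KMachine
open SimpleGraph

/-! ### Records -/

/-- What is recorded about a vertex: the name of its tree, the size of the tour, and a neighbour in
the tree with the two labels of the edge to it. -/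
@[ext] structure VInfo (n : ℕ) where
  tid : Fin n
  sz : ℕ
  nb : Option (Fin n × ℕ × ℕ)

/-- The record of an edge, read from one end; `tree` holds the two labels of a forest edge. -/
@[ext] structure Rec (n : ℕ) where
  pay : ℤ × Bool
  src : VInfo n
  dst : VInfo n
  tree : Option (ℕ × ℕ)

/-- An edge which is to join two trees. -/
structure Item (n : ℕ) where
  a : Fin n
  b : Fin n
  ia : VInfo n
  ib : VInfo n

/-- An edge at which a tree is to be cut. -/
structure CutInfo (n : ℕ) where
  x : Fin n
  y : Fin n
  tid : Fin n
  sz : ℕ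
  f : ℕ
  g : ℕ

/-- What a machine records about the edges at its vertices. -/
abbrev View (n : ℕ) := Fin n → Fin n → Option (Rec n)

variable {n : ℕ}

/-- The label of some dart that starts at the vertex. -/
def VInfo.pos (i : VInfo n) : ℕ := (i.nb.map fun z => z.2.1).getD 0

namespace Item
variable (it : Item n)

/-- `pos` is the label of a dart that leaves the end in question; adding `sz - pos` modulo `sz`
starts the tour there, as `Tour.link` requires. The tour of `b` is then moved behind that of `a` and
the dart `ab`. -/
def relabel (t : Fin n) (l : ℕ) : ℕ :=
  if t = it.ia.tid then (l + (it.ia.sz - it.ia.pos)) % it.ia.sz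
  else if t = it.ib.tid then it.ia.sz + 1 + (l + (it.ib.sz - it.ib.pos)) % it.ib.sz
  else l

/-- A vertex has no recorded tree edge only if it is alone in its tree; as an end of the new edge it
then receives this one. -/
def mapV (v : Fin n) (i : VInfo n) : VInfo n where
  tid := if i.tid = it.ib.tid then it.ia.tid else i.tid
  sz := if i.tid = it.ia.tid ∨ i.tid = it.ib.tid then it.ia.sz + it.ib.sz + 2 else i.sz
  nb := (i.nb.map fun z => (z.1, it.relabel i.tid z.2.1, it.relabel i.tid z.2.2)).orElse fun _ =>
    if v = it.a then some (it.b, it.ia.sz, it.ia.sz + it.ib.sz + 1)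
    else if v = it.b then some (it.a, it.ia.sz + it.ib.sz + 1, it.ia.sz) else none

def mapRec (u v : Fin n) (r : Rec n) : Rec n where
  pay := r.pay
  src := it.mapV u r.src
  dst := it.mapV v r.dst
  tree := if u = it.a ∧ v = it.b then some (it.ia.sz, it.ia.sz + it.ib.sz + 1)
    else if u = it.b ∧ v = it.a then some (it.ia.sz + it.ib.sz + 1, it.ia.sz)
    else r.tree.map fun l => (it.relabel r.src.tid l.1, it.relabel r.src.tid l.2)

def mapView (V : View n) : View n := fun u v => (V u v).map (it.mapRec u v)

def mapItem (i : Item n) : Item n := ⟨i.a, i.b, it.mapV i.a i.ia, it.mapV i.b i.ib⟩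

end Item

-- The choice depends on the predicate alone. `GState.cut` and `CutInfo.endInfo` apply it to
-- predicates that turn out equal, so they choose the same neighbour.
open Classical in
noncomputable def someNbr (P : Fin n → Prop) : Option (Fin n) :=
  if h : ∃ z, P z then some h.choose else none

theorem someNbr_some {P : Fin n → Prop} {z : Fin n} (h : someNbr P = some z) : P z := by
  unfold someNbr at h
  split_ifs at h with hP
  exact (Option.some.inj h) ▸ hP.choose_spec

theorem someNbr_none {P : Fin n → Prop} (h : someNbr P = none) : ∀ z, ¬ P z := by
  unfold someNbr at h
  split_ifs at h with hP
  exact fun z hz => hP ⟨z, hz⟩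

namespace CutInfo
variable (ci : CutInfo n)

/-- The crossing from `x` to `y` gets the time 0, so that `ci.rot ci.g` is the time of the return.
-/
def rot (l : ℕ) : ℕ := (l + (ci.sz - ci.f)) % ci.sz

/-- The test for the vertices on the side of `y`. -/
def Far (l : ℕ) : Prop := 0 < ci.rot l ∧ ci.rot l ≤ ci.rot ci.g

instance (l : ℕ) : Decidable (ci.Far l) := inferInstanceAs (Decidable (_ ∧ _))

def relabel (t : Fin n) (l : ℕ) : ℕ :=
  if t = ci.tid then
    if ci.rot l < ci.rot ci.g then ci.rot l - 1 else ci.rot l - ci.rot ci.g - 1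
  else l

def newSz (far : Prop) [Decidable far] : ℕ :=
  if far then ci.rot ci.g - 1 else ci.sz - ci.rot ci.g - 1

/-- The edge recorded for an end may be the one that is cut, so the new data `vx` and `vy` come from
the machines of the ends, which see all edges there. Every other vertex keeps its recorded edge. -/
def mapV (vx vy : VInfo n) (v : Fin n) (i : VInfo n) : VInfo n :=
  if v = ci.x then vx else if v = ci.y then vy else if i.tid = ci.tid then
    ⟨if ci.Far i.pos then ci.y else ci.x, ci.newSz (ci.Far i.pos),
      i.nb.map fun z => (z.1, ci.relabel i.tid z.2.1, ci.relabel i.tid z.2.2)⟩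
  else i

def mapRec (vx vy : VInfo n) (u v : Fin n) (r : Rec n) : Rec n where
  pay := r.pay
  src := ci.mapV vx vy u r.src
  dst := ci.mapV vx vy v r.dst
  tree := if s(u, v) = s(ci.x, ci.y) then none
    else r.tree.map fun l => (ci.relabel r.src.tid l.1, ci.relabel r.src.tid l.2)

def mapView (vx vy : VInfo n) (V : View n) : View n :=
  fun u v => (V u v).map (ci.mapRec vx vy u v)

/-- What the machine of an end of the cut edge finds out about it. -/
noncomputable def endInfo (V : View n) (v : Fin n) : VInfo n where
  tid := v
  sz := ci.newSz (v = ci.y)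
  nb := (someNbr fun z => (∃ l, (V v z).bind Rec.tree = some l) ∧ ¬ s(v, z) = s(ci.x, ci.y)).bind
    fun z => ((V v z).bind Rec.tree).map
      fun l => (z, ci.relabel ci.tid l.1, ci.relabel ci.tid l.2)

end CutInfo

/-- What is known about an own vertex. -/
noncomputable def View.vinfo (V : View n) (v : Fin n) : VInfo n :=
  match someNbr (fun z => ∃ r, V v z = some r) with
  -- A vertex without edges is alone in its tree, whose name can then only be `v` because `tid` is
  -- idempotent.
  | none => ⟨v, 0, none⟩
  | some z => ((V v z).map Rec.src).getD ⟨v, 0, none⟩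

def View.add (V : View n) (h : Finset (Fin n)) (u v : Fin n) (pu pv : VInfo n) (p : ℤ × Bool) :
    View n := fun a b =>
  if a ∈ h ∧ s(a, b) = s(u, v) then
    some ⟨p, if a = u then pu else pv, if b = u then pu else pv, none⟩
  else V a b

def View.remove (V : View n) (e : Sym2 (Fin n)) : View n := fun a b =>
  if s(a, b) = e then none else V a b

/-! ### Global states -/

/-- The global state: a graph with a payload on the edges, a forest, and tours of its trees. -/
structure GState (n : ℕ) where
  H : SimpleGraph (Fin n)
  pay : Sym2 (Fin n) → ℤ × Bool
  T : SimpleGraph (Fin n)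
  lab : Fin n → Fin n → ℕ
  tid : Fin n → Fin n
  sz : Fin n → ℕ
  nb : Fin n → Option (Fin n)

namespace GState
variable (S : GState n)

/-- By `nb_none`, `nb` is undefined only at isolated vertices of the forest. At all others it
provides the label of a dart that starts there, which fixes the position of the vertex in its tour.
-/
structure Good (c : ℕ) : Prop where
  comp : NamesComponents S.T S.tid
  acyclic : S.T.IsAcyclic
  tour : Tour S.T S.tid S.lab S.sz
  le : S.T ≤ S.H
  nb_some : ∀ v x, S.nb v = some x → S.T.Adj v x
  nb_none : ∀ v, S.nb v = none → ∀ x, ¬ S.T.Adj v x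
  weight : ∀ e ∈ S.H.edgeSet, |(S.pay e).1| ≤ (n : ℤ) ^ c

def vinfo (v : Fin n) : VInfo n :=
  ⟨S.tid v, S.sz v, (S.nb v).map fun x => (x, S.lab v x, S.lab x v)⟩

open Classical in
noncomputable def record (u v : Fin n) : Rec n :=
  ⟨S.pay s(u, v), S.vinfo u, S.vinfo v, if S.T.Adj u v then some (S.lab u v, S.lab v u) else none⟩

open Classical in
noncomputable def view (h : Finset (Fin n)) : View n := fun u v =>
  if u ∈ h ∧ S.H.Adj u v then some (S.record u v) else none

def item (a b : Fin n) : Item n := ⟨a, b, S.vinfo a, S.vinfo b⟩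

def cutInfo (x y : Fin n) : CutInfo n := ⟨x, y, S.tid x, S.sz x, S.lab x y, S.lab y x⟩

def link (a b : Fin n) : GState n where
  H := S.H
  pay := S.pay
  T := S.T ⊔ edge a b
  lab u v := if u = a ∧ v = b then S.sz a else if u = b ∧ v = a then S.sz a + S.sz b + 1
    else (S.item a b).relabel (S.tid u) (S.lab u v)
  tid v := if S.tid v = S.tid b then S.tid a else S.tid v
  sz v := if S.tid v = S.tid a ∨ S.tid v = S.tid b then S.sz a + S.sz b + 2 else S.sz v
  nb v := (S.nb v).orElse fun _ => if v = a then some b else if v = b then some a else none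

open Classical in
noncomputable def cut (x y : Fin n) : GState n where
  H := S.H
  pay := S.pay
  T := S.T.deleteEdges {s(x, y)}
  lab u v := (S.cutInfo x y).relabel (S.tid u) (S.lab u v)
  tid v := if S.tid v = S.tid x then
    if (S.T.deleteEdges {s(x, y)}).Reachable y v then y else x else S.tid v
  sz v := if S.tid v = S.tid x then
    (S.cutInfo x y).newSz ((S.T.deleteEdges {s(x, y)}).Reachable y v) else S.sz v
  nb v := if v = x ∨ v = y then someNbr ((S.T.deleteEdges {s(x, y)}).Adj v) else S.nb v

end GState
end KMachine

/-! ### Cuts and links of global states, and their effect on the views -/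

namespace KMachine
open SimpleGraph

theorem NamesComponents.congr {V : Type*} {T : SimpleGraph V} {tid tid' : V → V}
    (h : NamesComponents T tid) (ht : ∀ v, tid v = tid' v) : NamesComponents T tid' :=
  funext ht ▸ h

theorem Tour.congr {V : Type*} {T : SimpleGraph V} {tid tid' : V → V}
    {lab lab' : V → V → ℕ} {sz sz' : V → ℕ} (h : Tour T tid lab sz) (ht : ∀ v, tid v = tid' v)
    (hl : ∀ u v, T.Adj u v → lab u v = lab' u v) (hs : ∀ v, sz v = sz' v) :
    Tour T tid' lab' sz' := by
  obtain rfl := funext ht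
  exact {
  sz_congr u v huv := by rw [← hs, ← hs]; exact h.sz_congr u v huv
  adj := h.adj
  lt u v huv := by rw [← hs, ← hl u v huv]; exact h.lt u v huv
  inj u v u' v' h1 h2 h3 h4 := h.inj u v u' v' h1 h2 h3 (by rwa [hl u v h1, hl u' v' h2])
  surj w l hl' := by
    obtain ⟨u, v, h1, h2, h3⟩ := h.surj w l (by rwa [hs])
    exact ⟨u, v, h1, h2, by rw [← hl u v h1, h3]⟩
  next u v u' v' h1 h2 h3 h4 := h.next u v u' v' h1 h2 h3 (by
    rwa [hl u v h1, hl u' v' h2, hs]) }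

variable {n c : ℕ} {S : GState n}

namespace GState.Good

theorem eq_of_nb_none (h : S.Good c) {u v : Fin n} (hu : S.nb u = none) (huv : S.tid u = S.tid v) :
    v = u :=
  reachable_induction (P := fun v => v = u) ((h.comp.iff u v).2 huv) rfl
    fun _ b hab ha => absurd (ha ▸ hab) (h.nb_none u hu b)

theorem pos_of_nb (h : S.Good c) {v x : Fin n} (hx : S.nb v = some x) :
    S.T.Adj v x ∧ (S.vinfo v).pos = S.lab v x := by
  refine ⟨h.nb_some v x hx, ?_⟩
  simp [VInfo.pos, vinfo, hx]

/-- The rotation by `sz a - pos` moves the dart from `a` to its recorded neighbour to time 0, and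
labels are injective. This supplies the hypotheses of `Tour.link` on where the tours start. -/
theorem corner (h : S.Good c) (a : Fin n) {u v : Fin n} (huv : S.T.Adj u v)
    (hu : S.tid u = S.tid a)
    (hl : (S.lab u v + (S.sz a - (S.vinfo a).pos)) % S.sz a = 0) : u = a := by
  cases hx : S.nb a with
  | none => exact h.eq_of_nb_none hx hu.symm
  | some x =>
    obtain ⟨hax, hp⟩ := h.pos_of_nb hx
    have hlt := h.tour.lt a x hax
    have hrot := h.tour.rotate (fun _ => S.sz a - (S.vinfo a).pos) fun _ _ _ => rfl
    refine (hrot.inj u v a x huv hax hu ?_).1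
    simp only [h.tour.sz_congr _ _ hu, hl]
    rw [hp, show S.lab a x + (S.sz a - S.lab a x) = S.sz a by omega, Nat.mod_self]

theorem link (h : S.Good c) {a b : Fin n} (hab : S.tid a ≠ S.tid b) (hH : S.H.Adj a b) :
    (S.link a b).Good c := by
  have hne : a ≠ b := hH.ne
  have hadj : ∀ {u v}, (S.T ⊔ edge a b).Adj u v ↔ _ := sup_edge_adj hne
  -- Only the two tours to be joined are rotated; the shift 0 leaves the others as they are.
  have hrot := h.tour.rotate (fun u => if S.tid u = S.tid a then S.sz a - (S.vinfo a).pos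
    else if S.tid u = S.tid b then S.sz b - (S.vinfo b).pos else 0)
    fun u v huv => by simp only [huv]
  have hlink := hrot.link hab (fun u v huv hu hl => h.corner a huv hu (by
      simpa only [hu, if_true, h.tour.sz_congr _ _ hu] using hl))
    (fun u v huv hu hl => h.corner b huv hu (by
      simpa only [hu, hab.symm, if_true, if_false, h.tour.sz_congr _ _ hu] using hl))
  refine ⟨?_, ?_, ?_, ?_, ?_, ?_, h.weight⟩
  · refine (h.comp.sup_edge hab).congr fun v => ?_
    simp only [GState.link]
    split_ifs <;> rfl
  · exact h.acyclic.sup_edge_of_not_reachable fun h' => hab ((h.comp.iff _ _).1 h')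
  · refine hlink.congr ?_ ?_ ?_
    · intro v; simp only [GState.link]; split_ifs <;> rfl
    · intro u v huv
      simp only [GState.link, Item.relabel, item, vinfo]
      rcases hadj.1 huv with h1 | ⟨rfl, rfl⟩ | ⟨rfl, rfl⟩
      · by_cases hu : S.tid u = S.tid a
        · simp only [hu, if_true, h.tour.sz_congr _ _ hu]
        · by_cases hu' : S.tid u = S.tid b
          · simp only [hu', hab.symm, if_true, if_false, h.tour.sz_congr _ _ hu']
          · simp only [hu, hu', if_false, Nat.add_zero, Nat.mod_eq_of_lt (h.tour.lt u v h1)]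
      · simp
      · simp [hne.symm]
    · intro v; simp only [GState.link]; split_ifs <;> rfl
  · exact sup_le h.le (by simp [hne, hH, GState.link])
  · intro v x hx
    simp only [GState.link] at hx
    refine hadj.2 ?_
    cases hv : S.nb v with
    | none => rw [hv] at hx; simp at hx; split_ifs at hx <;> simp_all
    | some z => rw [hv] at hx; simp at hx; exact Or.inl (hx ▸ h.nb_some v z hv)
  · intro v hv x hx
    simp only [GState.link] at hv
    cases hz : S.nb v with
    | none =>
      rw [hz] at hv
      rcases hadj.1 hx with h1 | ⟨rfl, rfl⟩ | ⟨rfl, rfl⟩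
      · exact h.nb_none v hz x h1
      · simp at hv
      · simp [hne.symm] at hv
    | some z => rw [hz] at hv; simp at hv

theorem vinfo_link (h : S.Good c) {a b : Fin n} (hab : S.tid a ≠ S.tid b) (v : Fin n) :
    (S.link a b).vinfo v = (S.item a b).mapV v (S.vinfo v) := by
  have hne : a ≠ b := fun h => hab (h ▸ rfl)
  ext1
  · rfl
  · rfl
  · simp only [vinfo, GState.link, Item.mapV]
    cases hv : S.nb v with
    | some x =>
      have hvx := h.nb_some v x hv
      have h1 : ¬ (v = a ∧ x = b) := by rintro ⟨rfl, rfl⟩; exact hab (h.tour.adj _ _ hvx)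
      have h2 : ¬ (v = b ∧ x = a) := by rintro ⟨rfl, rfl⟩; exact hab (h.tour.adj _ _ hvx).symm
      have h3 : ¬ (x = a ∧ v = b) := by tauto
      have h4 : ¬ (x = b ∧ v = a) := by tauto
      simp [h1, h2, h3, h4, h.tour.adj _ _ hvx]
    | none =>
      simp only [item, vinfo]
      by_cases h1 : v = a
      · subst h1; simp [hne.symm]
      · by_cases h2 : v = b
        · subst h2; simp [hne.symm]
        · simp [h1, h2]

theorem record_link (h : S.Good c) {a b : Fin n} (hab : S.tid a ≠ S.tid b) (u v : Fin n) :
    (S.link a b).record u v = (S.item a b).mapRec u v (S.record u v) := by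
  have hne : a ≠ b := fun h => hab (h ▸ rfl)
  have hadj : ∀ {u v}, (S.T ⊔ edge a b).Adj u v ↔ _ := sup_edge_adj hne
  ext1
  · rfl
  · exact h.vinfo_link hab u
  · exact h.vinfo_link hab v
  · simp only [record, Item.mapRec]
    have hT : (S.link a b).T.Adj u v ↔ _ := hadj (u := u) (v := v)
    by_cases h1 : u = a ∧ v = b
    · obtain ⟨rfl, rfl⟩ := h1
      rw [if_pos (hT.2 (by tauto))]
      simp [GState.link, item, vinfo, hne.symm]
    · by_cases h2 : u = b ∧ v = a
      · obtain ⟨rfl, rfl⟩ := h2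
        rw [if_pos (hT.2 (by tauto))]
        simp [GState.link, item, vinfo, hne, hne.symm]
      · have h3 : ¬ (v = a ∧ u = b) := by tauto
        have h4 : ¬ (v = b ∧ u = a) := by tauto
        have h1' : ¬ (u = (S.item a b).a ∧ v = (S.item a b).b) := h1
        have h2' : ¬ (u = (S.item a b).b ∧ v = (S.item a b).a) := h2
        by_cases h5 : S.T.Adj u v
        · simp only [hT, h1, h2, h1', h2', h5, if_false, if_true, or_false]
          simp only [GState.link, h1, h2, h3, h4, if_false]
          simp [h.tour.adj _ _ h5, vinfo]
        · simp only [hT, h1, h2, h1', h2', h5, if_false, or_false]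
          simp

/-- The right side needs only the old view and the item: whoever receives the item can compute the
new view without further communication. -/
theorem view_link (h : S.Good c) {a b : Fin n} (hab : S.tid a ≠ S.tid b) (hosts : Finset (Fin n)) :
    (S.link a b).view hosts = (S.item a b).mapView (S.view hosts) := by
  funext u v
  simp only [view, Item.mapView, h.record_link hab]
  have : (S.link a b).H = S.H := rfl
  rw [this]
  split_ifs <;> rfl

theorem mapItem_link (h : S.Good c) {a b : Fin n} (hab : S.tid a ≠ S.tid b) (p q : Fin n) :
    (S.item a b).mapItem (S.item p q) = (S.link a b).item p q := by
  simp only [Item.mapItem, item, h.vinfo_link hab]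

/-! Cutting -/

theorem rotated (h : S.Good c) (x y : Fin n) :
    Tour S.T S.tid (fun u v => (S.lab u v + if S.tid u = S.tid x then S.sz x - S.lab x y else 0) %
      S.sz u) S.sz :=
  h.tour.rotate (fun u => if S.tid u = S.tid x then S.sz x - S.lab x y else 0)
    fun u v huv => by simp only [huv]

theorem rotated_eq (h : S.Good c) {x y u : Fin n} (hu : S.tid u = S.tid x) (v : Fin n) :
    (S.lab u v + if S.tid u = S.tid x then S.sz x - S.lab x y else 0) % S.sz u =
      (S.cutInfo x y).rot (S.lab u v) := by
  simp only [hu, if_true, h.tour.sz_congr _ _ hu, CutInfo.rot, cutInfo]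

theorem rotated_zero (h : S.Good c) {x y : Fin n} (hxy : S.T.Adj x y) :
    (S.cutInfo x y).rot (S.lab x y) = 0 := by
  have := h.tour.lt x y hxy
  simp only [CutInfo.rot, cutInfo]
  rw [show S.lab x y + (S.sz x - S.lab x y) = S.sz x by omega, Nat.mod_self]

/-- The test reads a single label at `v`. Such a label exists, because every vertex of a tree that
contains the edge `xy` has a recorded neighbour. -/
theorem far_iff (h : S.Good c) {x y v : Fin n} (hxy : S.T.Adj x y) (hv : S.tid v = S.tid x) :
    (S.T.deleteEdges {s(x, y)}).Reachable y v ↔ (S.cutInfo x y).Far (S.vinfo v).pos := by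
  have hyx := (h.tour.adj x y hxy).symm
  cases hx : S.nb v with
  | none =>
    have := h.eq_of_nb_none hx hv
    exact absurd (this ▸ hxy) (h.nb_none v hx y)
  | some z =>
    obtain ⟨hvz, hp⟩ := h.pos_of_nb hx
    rw [(h.rotated x y).reachable_iff h.acyclic hxy
      ((h.rotated_eq rfl y).trans (h.rotated_zero hxy)) hvz hv, hp, CutInfo.Far,
      h.rotated_eq hv, h.rotated_eq hyx]
    rfl

/-- The edge `xy` lies on the path from `u` to `v` when these fall on different sides of it, and the
sides are read off the recorded positions. `cutCandidate` performs this test. -/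
theorem separates_iff (h : S.Good c) {x y u v : Fin n} (hxy : S.T.Adj x y)
    (huv : S.tid u = S.tid v) :
    ¬ (S.T.deleteEdges {s(x, y)}).Reachable u v ↔ S.tid x = S.tid u ∧
      ¬ ((S.cutInfo x y).Far (S.vinfo u).pos ↔ (S.cutInfo x y).Far (S.vinfo v).pos) := by
  classical
  have hc := h.comp.deleteEdge hxy h.acyclic
  rw [hc.iff]
  by_cases hu : S.tid u = S.tid x
  · have hv := huv.symm.trans hu
    rw [← h.far_iff hxy hu, ← h.far_iff hxy hv]
    simp only [hu, hv, if_true, true_and]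
    have := hxy.ne
    split_ifs <;> simp_all [eq_comm]
  · simp [← huv, hu, Ne.symm hu]

theorem cut (h : S.Good c) {x y : Fin n} (hxy : S.T.Adj x y) : (S.cut x y).Good c := by
  classical
  have hyx := (h.tour.adj x y hxy).symm
  have hcut := (h.rotated x y).cut h.comp h.acyclic hxy
    ((h.rotated_eq rfl y).trans (h.rotated_zero hxy))
  refine ⟨?_, h.acyclic.anti (deleteEdges_le _), ?_, (deleteEdges_le _).trans h.le, ?_, ?_, h.weight⟩
  · refine (h.comp.deleteEdge hxy h.acyclic).congr fun v => ?_
    simp only [GState.cut]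
    split_ifs <;> rfl
  · refine hcut.congr ?_ ?_ ?_
    · intro v; simp only [GState.cut]; split_ifs <;> rfl
    · intro u v huv
      have huv' : S.T.Adj u v := (deleteEdges_singleton_adj.1 huv).1
      by_cases hu : S.tid u = S.tid x
      · have h1 := h.rotated_eq (y := y) hu v
        have h2 := h.rotated_eq (y := y) hyx x
        simp only [hu, hyx, if_true] at h1 h2
        simp only [hu, hyx, if_true, h1, h2]
        have h3 : S.tid u = (S.cutInfo x y).tid := hu
        simp only [GState.cut, CutInfo.relabel, h3, if_true]
        rfl
      · simp only [hu, if_false, Nat.add_zero, Nat.mod_eq_of_lt (h.tour.lt u v huv')]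
        simp [GState.cut, CutInfo.relabel, cutInfo, hu]
    · intro v
      have h2 := h.rotated_eq (y := y) hyx x
      simp only [hyx, if_true] at h2
      simp only [hyx, if_true, h2, GState.cut, CutInfo.newSz]
      rfl
  · intro v z hz
    simp only [GState.cut] at hz
    split_ifs at hz with h1
    · exact someNbr_some hz
    · refine deleteEdges_singleton_adj.2 ⟨h.nb_some v z hz, fun he => h1 ?_⟩
      rcases Sym2.eq_iff.1 he with ⟨rfl, _⟩ | ⟨rfl, _⟩ <;> simp
  · intro v hv
    simp only [GState.cut] at hv
    split_ifs at hv with h1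
    · exact someNbr_none hv
    · exact fun z hz => h.nb_none v hv z (deleteEdges_singleton_adj.1 hz).1

theorem vinfo_cut (h : S.Good c) {x y : Fin n} (hxy : S.T.Adj x y) (v : Fin n) :
    (S.cut x y).vinfo v = (S.cutInfo x y).mapV ((S.cut x y).vinfo x) ((S.cut x y).vinfo y) v
      (S.vinfo v) := by
  classical
  unfold CutInfo.mapV
  by_cases h1 : v = (S.cutInfo x y).x
  · rw [if_pos h1, show v = x from h1]
  by_cases h2 : v = (S.cutInfo x y).y
  · rw [if_neg h1, if_pos h2, show v = y from h2]
  rw [if_neg h1, if_neg h2]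
  by_cases h3 : (S.vinfo v).tid = (S.cutInfo x y).tid
  · rw [if_pos h3]
    have h1 : v ≠ x := h1
    have h2 : v ≠ y := h2
    have h3 : S.tid v = S.tid x := h3
    have hf := h.far_iff hxy h3
    ext1
    · simp only [vinfo, GState.cut, h3, if_true]
      simp only [hf]; rfl
    · simp only [vinfo, GState.cut, h3, if_true]
      simp only [CutInfo.newSz, hf]; rfl
    · simp only [vinfo, GState.cut, h1, h2, or_false, if_false]
      cases hz : S.nb v with
      | none => rfl
      | some z => simp [h.tour.adj _ _ (h.nb_some v z hz)]
  · rw [if_neg h3]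
    have h1 : v ≠ x := h1
    have h2 : v ≠ y := h2
    have h3 : S.tid v ≠ S.tid x := h3
    ext1
    · simp only [vinfo, GState.cut, h3, if_false]
    · simp only [vinfo, GState.cut, h3, if_false]
    · simp only [vinfo, GState.cut, h1, h2, or_false, if_false]
      cases hz : S.nb v with
      | none => rfl
      | some z =>
        have := h.tour.adj _ _ (h.nb_some v z hz)
        simp [CutInfo.relabel, cutInfo, ← this, h3]

theorem record_cut (h : S.Good c) {x y : Fin n} (hxy : S.T.Adj x y) (u v : Fin n) :
    (S.cut x y).record u v = (S.cutInfo x y).mapRec ((S.cut x y).vinfo x) ((S.cut x y).vinfo y)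
      u v (S.record u v) := by
  classical
  ext1
  · rfl
  · exact h.vinfo_cut hxy u
  · exact h.vinfo_cut hxy v
  · simp only [record, CutInfo.mapRec]
    have hT : (S.cut x y).T.Adj u v ↔ S.T.Adj u v ∧ ¬ s(u, v) = s(x, y) :=
      deleteEdges_singleton_adj
    have e : s((S.cutInfo x y).x, (S.cutInfo x y).y) = s(x, y) := rfl
    by_cases h1 : s(u, v) = s(x, y)
    · simp only [hT, e, h1, not_true, and_false, if_false, if_true]
    · by_cases h2 : S.T.Adj u v
      · simp only [hT, e, h1, h2, not_false_iff, and_true, if_true, if_false]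
        simp [GState.cut, h.tour.adj _ _ h2, vinfo]
      · simp only [hT, e, h1, h2, false_and, if_false, Option.map_none]

theorem view_cut (h : S.Good c) {x y : Fin n} (hxy : S.T.Adj x y) (hosts : Finset (Fin n)) :
    (S.cut x y).view hosts = (S.cutInfo x y).mapView ((S.cut x y).vinfo x) ((S.cut x y).vinfo y)
      (S.view hosts) := by
  funext u v
  simp only [view, CutInfo.mapView, h.record_cut hxy]
  have : (S.cut x y).H = S.H := rfl
  rw [this]
  split_ifs <;> rfl

/-- The machine of an end has all edges at this end in its view, so it knows every forest edge from
which the new neighbour may be chosen. -/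
theorem endInfo_eq (h : S.Good c) {x y v : Fin n} (hxy : S.T.Adj x y) (hv : v = x ∨ v = y)
    {hosts : Finset (Fin n)} (hvh : v ∈ hosts) :
    (S.cutInfo x y).endInfo (S.view hosts) v = (S.cut x y).vinfo v := by
  classical
  have hyx := (h.tour.adj x y hxy).symm
  have hbr := deleteEdge_not_reachable h.acyclic hxy
  have hbr' : ¬ (S.T.deleteEdges {s(x, y)}).Reachable y x := fun h' => hbr h'.symm
  have hvx : S.tid v = S.tid x := by rcases hv with rfl | rfl; exacts [rfl, hyx]
  have hfar : (S.T.deleteEdges {s(x, y)}).Reachable y v ↔ v = y := by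
    rcases hv with rfl | rfl
    · simp [hbr', hxy.ne]
    · simp
  have htree : ∀ z l, ((S.view hosts) v z).bind Rec.tree = some l ↔
      S.T.Adj v z ∧ l = (S.lab v z, S.lab z v) := by
    intro z l
    by_cases h1 : S.T.Adj v z
    · simp [view, hvh, h.le h1, record, h1, eq_comm]
    · by_cases h2 : S.H.Adj v z
      · simp [view, hvh, h2, record, h1]
      · simp [view, h1, h2]
  ext1
  · simp only [CutInfo.endInfo, vinfo, GState.cut, hvx, if_true, hfar]
    rcases hv with rfl | rfl
    · simp [hxy.ne]
    · simp
  · simp only [CutInfo.endInfo, vinfo, GState.cut, hvx, if_true]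
    simp only [CutInfo.newSz, hfar]
    rfl
  · simp only [CutInfo.endInfo, vinfo, GState.cut, hv, if_true]
    have hP : (fun z => (∃ l, ((S.view hosts) v z).bind Rec.tree = some l) ∧
        ¬ s(v, z) = s((S.cutInfo x y).x, (S.cutInfo x y).y)) =
        (S.T.deleteEdges {s(x, y)}).Adj v := by
      funext z
      simp only [htree, deleteEdges_singleton_adj, cutInfo]
      simp
    rw [hP]
    cases hz : someNbr ((S.T.deleteEdges {s(x, y)}).Adj v) with
    | none => rfl
    | some z =>
      have hvz := (deleteEdges_singleton_adj.1 (someNbr_some hz)).1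
      have := (htree z _).2 ⟨hvz, rfl⟩
      simp only [Option.bind_some, this, Option.map_some, ← h.tour.adj _ _ hvz, hvx]
      rfl

theorem view_vinfo (h : S.Good c) {hosts : Finset (Fin n)} {v : Fin n} (hv : v ∈ hosts) :
    (S.view hosts).vinfo v = S.vinfo v := by
  classical
  unfold View.vinfo
  cases hz : someNbr (fun z => ∃ r, S.view hosts v z = some r) with
  | some z =>
    obtain ⟨r, hr⟩ := someNbr_some hz
    simp only [hr]
    simp only [view] at hr
    split_ifs at hr with h1
    simp only [Option.some.injEq] at hr
    simp [← hr, record]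
  | none =>
    have hno : ∀ x, ¬ S.H.Adj v x := fun x hx => someNbr_none hz x ⟨_, by simp [view, hv, hx]; rfl⟩
    have hnb : S.nb v = none := by
      cases hx : S.nb v with
      | none => rfl
      | some x => exact absurd (h.le (h.nb_some v x hx)) (hno x)
    ext1
    · exact (h.eq_of_nb_none hnb (h.comp.idem v).symm).symm
    · simp only [vinfo]
      by_contra hs
      obtain ⟨a, b, hab, ha, _⟩ := h.tour.surj v 0 (by omega)
      have := h.eq_of_nb_none hnb ha.symm
      exact hno b (h.le (this ▸ hab))
    · simp [vinfo, hnb]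

end GState.Good

/-! Changes of the graph -/

/-- Adding a non-forest edge. -/
noncomputable def GState.add (S : GState n) (u v : Fin n) (p : ℤ × Bool) : GState n :=
  open Classical in { S with H := S.H ⊔ edge u v, pay := Function.update S.pay s(u, v) p }

/-- Removing a non-forest edge. -/
def GState.remove (S : GState n) (e : Sym2 (Fin n)) : GState n :=
  { S with H := S.H.deleteEdges {e} }

namespace GState.Good

theorem add (h : S.Good c) {u v : Fin n} (huv : u ≠ v) {p : ℤ × Bool} (hp : |p.1| ≤ (n : ℤ) ^ c) :
    (S.add u v p).Good c := by
  refine ⟨h.comp, h.acyclic, h.tour, h.le.trans le_sup_left, h.nb_some, h.nb_none, ?_⟩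
  intro e he
  simp only [GState.add] at he ⊢
  by_cases h1 : e = s(u, v)
  · rw [h1]; simpa using hp
  · rw [Function.update_of_ne h1]
    refine h.weight e ?_
    simpa [edgeSet_edge_of_ne huv, h1] using he

theorem view_add (S : GState n) {u v : Fin n} (huv : u ≠ v) (p : ℤ × Bool)
    (hT : ¬ S.T.Adj u v) (hosts : Finset (Fin n)) :
    (S.add u v p).view hosts = (S.view hosts).add hosts u v (S.vinfo u) (S.vinfo v) p := by
  classical
  funext a b
  have hadj : (S.add u v p).H.Adj a b ↔ S.H.Adj a b ∨ s(a, b) = s(u, v) := by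
    rw [Sym2.eq_iff]; exact sup_edge_adj huv
  unfold view View.add
  by_cases h1 : s(a, b) = s(u, v)
  · by_cases h2 : a ∈ hosts
    · simp only [hadj, h1, h2, or_true, and_true, if_true, Option.some.injEq]
      ext1
      · simp [record, GState.add, h1]
      · rcases Sym2.eq_iff.1 h1 with ⟨rfl, rfl⟩ | ⟨rfl, rfl⟩
        · simp; rfl
        · simp [huv.symm]; rfl
      · rcases Sym2.eq_iff.1 h1 with ⟨rfl, rfl⟩ | ⟨rfl, rfl⟩
        · simp [huv.symm]; rfl
        · simp; rfl
      · have : ¬ S.T.Adj a b := fun h' => hT (by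
          rcases Sym2.eq_iff.1 h1 with ⟨rfl, rfl⟩ | ⟨rfl, rfl⟩
          · exact h'
          · exact h'.symm)
        exact if_neg this
    · simp [h2]
  · simp only [hadj, h1, or_false, and_false, if_false]
    have : (S.add u v p).record a b = S.record a b := by
      simp only [record, GState.add, vinfo, Function.update_of_ne h1]
      rfl
    rw [this]

theorem remove (h : S.Good c) {e : Sym2 (Fin n)} (he : e ∉ S.T.edgeSet) : (S.remove e).Good c := by
  refine ⟨h.comp, h.acyclic, h.tour, ?_, h.nb_some, h.nb_none, ?_⟩
  · intro a b hab
    simp only [GState.remove, deleteEdges_adj, Set.mem_singleton_iff]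
    exact ⟨h.le hab, fun h' => he (h' ▸ hab)⟩
  · intro e' he'
    simp only [GState.remove, edgeSet_deleteEdges] at he'
    exact h.weight e' he'.1

theorem view_remove (S : GState n) (e : Sym2 (Fin n)) (hosts : Finset (Fin n)) :
    (S.remove e).view hosts = (S.view hosts).remove e := by
  classical
  funext a b
  have hadj : (S.remove e).H.Adj a b ↔ S.H.Adj a b ∧ s(a, b) ≠ e := by
    simp [GState.remove, deleteEdges_adj]
  unfold view View.remove
  by_cases h1 : s(a, b) = e
  · simp [hadj, h1]
  · simp only [hadj, h1, ne_eq, not_false_iff, and_true, if_false]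
    rfl

end GState.Good
end KMachine

namespace KMachine

/-! ### Protocols with longer messages and with typed memories -/

/-- A protocol with numbers as messages and with memories in an arbitrary type. -/
structure BigProtocol (n k : ℕ) (σ : Type) where
  send : Fin k → Finset (Fin n) → ℕ → σ → Fin k → Option ℕ
  recv : Fin k → Finset (Fin n) → ℕ → σ → (Fin k → Option ℕ) → σ

variable {n k : ℕ} {σ : Type}

namespace BigProtocol

def run (P : BigProtocol n k σ) (home : Fin n → Fin k) (s : Fin k → σ) : ℕ → Fin k → σ
  | 0 => s
  | t + 1 => fun i =>
      P.recv i (hosted home i) t (P.run home s t i)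
        fun j => P.send j (hosted home j) t (P.run home s t j) i

/-- A prefix of a message can be 0; the shift by one distinguishes it from silence. -/
def optCode : Option ℕ → ℕ
  | none => 0
  | some x => x + 1

/-- Simulation with `B` rounds for each round: messages are cut into `B` pieces, and the parts that
have arrived stand in front of the memory. -/
def toProtocol (P : BigProtocol n k σ) (enc : σ → Memory) (dec : Memory → σ) (B : ℕ) :
    Protocol n k where
  send i h t m j :=
    (P.send i h (t / B) (dec (if t % B = 0 then m else m.drop k)) j).map fun x =>
      BitVec.ofNat (Nat.log 2 n) (x / 2 ^ (Nat.log 2 n * (B - 1 - t % B)))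
  recv i h t m ms :=
    let s := dec (if t % B = 0 then m else m.drop k)
    let acc : Fin k → Option ℕ := fun j => (ms j).map fun d =>
      (if t % B = 0 then 0 else m.getD j 0 - 1) * 2 ^ Nat.log 2 n + d.toNat
    if t % B + 1 = B then enc (P.recv i h (t / B) s acc)
    else List.ofFn (fun j => optCode (acc j)) ++ enc s

/-- The memory after `b` of the rounds that simulate one round. -/
def partialMemory (enc : σ → Memory) (L B b : ℕ) (s : σ) (ms : Fin k → Option ℕ) : Memory :=
  if b = 0 then enc s
  else List.ofFn (fun j => optCode ((ms j).map fun x => x / 2 ^ (L * (B - b)))) ++ enc s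

/-- In base `2 ^ L`, the next digit is appended to the leading digits of `x`; pieces are sent from
the most significant one on. -/
theorem chunk_step {x L d : ℕ} :
    x / 2 ^ (L * (d + 1)) * 2 ^ L + x / 2 ^ (L * d) % 2 ^ L = x / 2 ^ (L * d) := by
  rw [Nat.mul_succ, pow_add, ← Nat.div_div_eq_div_mul, mul_comm]
  exact Nat.div_add_mod _ _

variable {P : BigProtocol n k σ} {enc : σ → Memory} {dec : Memory → σ} {B : ℕ}

theorem toProtocol_step (hdec : ∀ s, dec (enc s) = s) {home : Fin n → Fin k} {s : Fin k → σ}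
    {q b : ℕ} (hb : b < B)
    (hlt : ∀ i j x, P.send i (hosted home i) q (s i) j = some x → x < 2 ^ (Nat.log 2 n * B))
    {c : Config k} (hc : ∀ i, c i = partialMemory enc (Nat.log 2 n) B b (s i) fun j =>
      P.send j (hosted home j) q (s j) i) (i : Fin k) :
    (P.toProtocol enc dec B).recv i (hosted home i) (q * B + b) (c i)
      (fun j => (P.toProtocol enc dec B).send j (hosted home j) (q * B + b) (c j) i) =
    if b + 1 = B then enc (P.recv i (hosted home i) q (s i) fun j =>
        P.send j (hosted home j) q (s j) i)
    else partialMemory enc (Nat.log 2 n) B (b + 1) (s i) fun j =>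
      P.send j (hosted home j) q (s j) i := by
  have hdiv : (q * B + b) / B = q := by
    rw [mul_comm, Nat.mul_add_div (by omega), Nat.div_eq_of_lt hb, add_zero]
  have hmod : (q * B + b) % B = b := by rw [mul_comm, Nat.mul_add_mod, Nat.mod_eq_of_lt hb]
  have hs : ∀ i, dec (if b = 0 then c i else (c i).drop k) = s i := by
    intro i
    rw [hc i, partialMemory]
    split_ifs with h
    · exact hdec _
    · rw [List.drop_left' (by simp)]; exact hdec _
  have hacc : (fun j : Fin k => ((P.send j (hosted home j) q (s j) i).map fun x =>
      BitVec.ofNat (Nat.log 2 n) (x / 2 ^ (Nat.log 2 n * (B - 1 - b)))).map fun d =>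
      (if b = 0 then 0 else (c i).getD j 0 - 1) * 2 ^ Nat.log 2 n + d.toNat) =
      fun j => (P.send j (hosted home j) q (s j) i).map fun x =>
        x / 2 ^ (Nat.log 2 n * (B - (b + 1))) := by
    funext j
    cases hx : P.send j (hosted home j) q (s j) i with
    | none => rfl
    | some x =>
      simp only [Option.map_some, Option.some.injEq, BitVec.toNat_ofNat]
      have e1 : B - 1 - b = B - (b + 1) := by omega
      have e2 : (if b = 0 then 0 else (c i).getD j 0 - 1) = x / 2 ^ (Nat.log 2 n * (B - b)) := by
        split_ifs with h
        -- Before the first piece the prefix is taken to be 0, which is right because the message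
        -- fits into `B` pieces.
        · rw [h, Nat.sub_zero, Nat.div_eq_of_lt (hlt j i x hx)]
        · rw [hc i, partialMemory, if_neg h, List.getD_append _ _ _ _ (by simp)]
          simp [List.getD_eq_getElem?_getD, hx, optCode]
      rw [e2, e1, show B - b = B - (b + 1) + 1 by omega]
      exact chunk_step
  simp only [toProtocol, hdiv, hmod, hs, hacc]
  by_cases h : b + 1 = B
  · simp only [h, if_true, Nat.sub_self, Nat.mul_zero, pow_zero, Nat.div_one, Option.map_id']
  · simp only [h, if_false, partialMemory, Nat.add_one_ne_zero]
    congr 2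
    funext j
    exact congrArg optCode (congrFun hacc j)

/-- Messages are known to be short only in rounds before `Q`, so the simulation is followed up to
the moment at which round `Q` would begin; this is the case `q = Q`, `b = 0`. -/
theorem toProtocol_run (hdec : ∀ s, dec (enc s) = s) {home : Fin n → Fin k} {s : Fin k → σ}
    {Q : ℕ} (hlt : ∀ q < Q, ∀ i j x,
      P.send i (hosted home i) q (P.run home s q i) j = some x → x < 2 ^ (Nat.log 2 n * B))
    (hB : 0 < B) : ∀ q b, q < Q ∧ b < B ∨ q = Q ∧ b = 0 →
      ∀ i, (P.toProtocol enc dec B).run home (fun i => enc (s i)) (q * B + b) i =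
        partialMemory enc (Nat.log 2 n) B b (P.run home s q i) fun j =>
          P.send j (hosted home j) q (P.run home s q j) i := by
  have inner : ∀ q < Q, (∀ i, (P.toProtocol enc dec B).run home (fun i => enc (s i)) (q * B) i =
      enc (P.run home s q i)) → ∀ b < B, ∀ i,
      (P.toProtocol enc dec B).run home (fun i => enc (s i)) (q * B + b) i =
        partialMemory enc (Nat.log 2 n) B b (P.run home s q i) fun j =>
          P.send j (hosted home j) q (P.run home s q j) i := by
    intro q hq h0 b
    induction b with
    | zero => intro _ i; simpa [partialMemory] using h0 i
    | succ b ih =>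
      intro hb i
      have := toProtocol_step hdec (by omega) (hlt q hq) (ih (by omega)) i
      rw [if_neg (by omega)] at this
      exact this
  have outer : ∀ q ≤ Q, ∀ i, (P.toProtocol enc dec B).run home (fun i => enc (s i)) (q * B) i =
      enc (P.run home s q i) := by
    intro q
    induction q with
    | zero => intro _ i; simp [Protocol.run, run]
    | succ q ih =>
      intro hq i
      have := toProtocol_step hdec (by omega) (hlt q (by omega))
        (inner q (by omega) (ih (by omega)) (B - 1) (by omega)) i
      rw [if_pos (by omega)] at this
      rw [show (q + 1) * B = q * B + (B - 1) + 1 by rw [Nat.succ_mul]; omega]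
      exact this
  rintro q b (⟨hq, hb⟩ | ⟨rfl, rfl⟩)
  · exact inner q hq (outer q hq.le) b hb
  · intro i; simpa [partialMemory] using outer q le_rfl i

theorem toProtocol_run_mul (hdec : ∀ s, dec (enc s) = s) {home : Fin n → Fin k} {s : Fin k → σ}
    {Q : ℕ} (hlt : ∀ q < Q, ∀ i j x,
      P.send i (hosted home i) q (P.run home s q i) j = some x → x < 2 ^ (Nat.log 2 n * B))
    (hB : 0 < B) : (P.toProtocol enc dec B).run home (fun i => enc (s i)) (Q * B) =
      fun i => enc (P.run home s Q i) := by
  funext i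
  simpa [partialMemory] using toProtocol_run hdec hlt hB Q 0 (Or.inr ⟨rfl, rfl⟩) i

/-- The prefixes cost `k` more words, each at most `2 ^ (log n * B)`. As `log n` is positive, the
last 1 in `C + B + 1` makes this bound strict. -/
theorem toProtocol_fitsIn (hdec : ∀ s, dec (enc s) = s) {home : Fin n → Fin k} {s : Fin k → σ}
    {Q : ℕ} (hlt : ∀ q < Q, ∀ i j x,
      P.send i (hosted home i) q (P.run home s q i) j = some x → x < 2 ^ (Nat.log 2 n * B))
    (hB : 0 < B) (hn : 2 ≤ n) {C : ℕ} {m : Fin k → ℕ}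
    (hfit : ∀ q ≤ Q, ∀ i, FitsIn n C (k + m i) (enc (P.run home s q i))) {t : ℕ}
    (ht : t ≤ Q * B) (i : Fin k) :
    FitsIn n (C + B + 1) (k + m i)
      ((P.toProtocol enc dec B).run home (fun i => enc (s i)) t i) := by
  have hL : 0 < Nat.log 2 n := Nat.log_pos (by omega) hn
  have hcase : t / B < Q ∧ t % B < B ∨ t / B = Q ∧ t % B = 0 := by
    have h1 := Nat.mod_lt t hB
    have h2 := Nat.div_add_mod t B
    rcases Nat.lt_or_ge (t / B) Q with h | h
    · exact Or.inl ⟨h, h1⟩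
    · have h3 : Q * B ≤ B * (t / B) := by rw [mul_comm]; exact Nat.mul_le_mul_left _ h
      have h4 : t % B = 0 := by omega
      refine Or.inr ⟨?_, h4⟩
      have h5 : B * (t / B) ≤ B * Q := by rw [mul_comm B Q]; omega
      exact le_antisymm (Nat.le_of_mul_le_mul_left h5 hB) h
  have key := toProtocol_run hdec hlt hB (t / B) (t % B) hcase i
  rw [show t / B * B + t % B = t by rw [mul_comm]; exact Nat.div_add_mod t B] at key
  rw [key, partialMemory]
  have hq : t / B ≤ Q := by omega
  obtain ⟨hf1, hf2⟩ := hfit _ hq i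
  have hpow : 2 ^ (C * Nat.log 2 n) ≤ 2 ^ ((C + B + 1) * Nat.log 2 n) :=
    Nat.pow_le_pow_right (by omega) (Nat.mul_le_mul_right _ (by omega))
  split_ifs with hb
  · refine ⟨hf1.trans (Nat.mul_le_mul_right _ (by omega)), fun x hx => (hf2 x hx).trans_le hpow⟩
  · constructor
    · rw [List.length_append, List.length_ofFn]
      nlinarith
    · intro x hx
      rw [List.mem_append] at hx
      rcases hx with hx | hx
      · rw [List.mem_ofFn] at hx
        obtain ⟨j, rfl⟩ := hx
        cases hs : P.send j (hosted home j) (t / B) (P.run home s (t / B) j) i with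
        | none => exact Nat.pow_pos (by omega)
        | some y =>
          have h1 := hlt _ (by omega) j i y hs
          have h2 : y / 2 ^ (Nat.log 2 n * (B - t % B)) ≤ y := Nat.div_le_self _ _
          have h3 : 2 ^ (Nat.log 2 n * B) < 2 ^ ((C + B + 1) * Nat.log 2 n) :=
            Nat.pow_lt_pow_right (by omega) (by nlinarith)
          simp only [Option.map_some, optCode]
          omega
      · exact (hf2 x hx).trans_le hpow

end BigProtocol
end KMachine

namespace KMachine
open SimpleGraph Encodable

/-! ### Encodings -/

/-- What a machine remembers between rounds besides its view. -/
structure Aux (n : ℕ) where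
  pend : Option (Fin n × Fin n × Option ℤ)
  pu : Option (VInfo n)
  pv : Option (VInfo n)
  ci : Option (CutInfo n)
  vx : Option (VInfo n)
  offset : ℕ
  relay : Option (Item n)

variable {n k : ℕ}

instance : Encodable (VInfo n) := Encodable.ofEquiv (Fin n × ℕ × Option (Fin n × ℕ × ℕ))
  ⟨fun i => (i.tid, i.sz, i.nb), fun t => ⟨t.1, t.2.1, t.2.2⟩, fun _ => rfl, fun _ => rfl⟩

instance : Encodable (Rec n) := Encodable.ofEquiv ((ℤ × Bool) × VInfo n × VInfo n × Option (ℕ × ℕ))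
  ⟨fun i => (i.pay, i.src, i.dst, i.tree), fun t => ⟨t.1, t.2.1, t.2.2.1, t.2.2.2⟩,
    fun _ => rfl, fun _ => rfl⟩

instance : Encodable (Item n) := Encodable.ofEquiv (Fin n × Fin n × VInfo n × VInfo n)
  ⟨fun i => (i.a, i.b, i.ia, i.ib), fun t => ⟨t.1, t.2.1, t.2.2.1, t.2.2.2⟩,
    fun _ => rfl, fun _ => rfl⟩

instance : Encodable (CutInfo n) := Encodable.ofEquiv (Fin n × Fin n × Fin n × ℕ × ℕ × ℕ)
  ⟨fun i => (i.x, i.y, i.tid, i.sz, i.f, i.g),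
    fun t => ⟨t.1, t.2.1, t.2.2.1, t.2.2.2.1, t.2.2.2.2.1, t.2.2.2.2.2⟩, fun _ => rfl, fun _ => rfl⟩

instance : Encodable (Aux n) := Encodable.ofEquiv
  (Option (Fin n × Fin n × Option ℤ) × Option (VInfo n) × Option (VInfo n) × Option (CutInfo n) ×
    Option (VInfo n) × ℕ × Option (Item n))
  ⟨fun i => (i.pend, i.pu, i.pv, i.ci, i.vx, i.offset, i.relay),
    fun t => ⟨t.1, t.2.1, t.2.2.1, t.2.2.2.1, t.2.2.2.2.1, t.2.2.2.2.2.1, t.2.2.2.2.2.2⟩,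
    fun _ => rfl, fun _ => rfl⟩

def Aux.idle : Aux n := ⟨none, none, none, none, none, 0, none⟩

/-- The state of a machine. -/
abbrev MState (n : ℕ) := Aux n × View n

/-- The first word holds the auxiliary data, and each directed edge at an own vertex takes one more.
Such a word names its edge, so the order of the list plays no role in decoding. -/
noncomputable def enc (s : MState n) : Memory :=
  encode s.1 :: (Finset.univ : Finset (Fin n × Fin n)).toList.filterMap fun p =>
    (s.2 p.1 p.2).map fun r => encode (p.1, p.2, r)

open Classical in
noncomputable def dec (m : Memory) : MState n :=
  ((decode (m.headD 0)).getD Aux.idle, fun a b =>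
    if h : ∃ r : Rec n, encode (a, b, r) ∈ m.tail then some h.choose else none)

theorem mem_tail_enc {s : MState n} {a b : Fin n} {r : Rec n} :
    encode (a, b, r) ∈ (enc s).tail ↔ s.2 a b = some r := by
  simp only [enc, List.tail_cons, List.mem_filterMap, Finset.mem_toList, Finset.mem_univ, true_and,
    Option.map_eq_some_iff]
  constructor
  · rintro ⟨p, r', h1, h2⟩
    have := encode_injective h2
    simp only [Prod.mk.injEq] at this
    obtain ⟨rfl, rfl, rfl⟩ := this
    exact h1
  · intro h
    exact ⟨(a, b), r, h, rfl⟩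

theorem dec_enc (s : MState n) : dec (enc s) = s := by
  obtain ⟨x, V⟩ := s
  refine Prod.ext ?_ ?_
  · simp [dec, enc]
  · funext a b
    by_cases h : ∃ r : Rec n, encode (a, b, r) ∈ (enc (x, V)).tail
    · refine (dif_pos h).trans ?_
      exact (mem_tail_enc (s := (x, V)).1 h.choose_spec).symm
    · refine (dif_neg h).trans ?_
      cases hV : V a b with
      | none => exact hV.symm
      | some r => exact absurd ⟨r, mem_tail_enc.2 hV⟩ h

/-! ### Bounds -/

/-- The code of `x` is less than `n ^ p`. -/
def Bd {α : Type*} [Encodable α] (n p : ℕ) (x : α) : Prop := encode x < n ^ p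

section Bd
variable {α β : Type*} [Encodable α] [Encodable β]

theorem Bd.mono {p q : ℕ} {x : α} (hn : 2 ≤ n) (h : Bd n p x) (hpq : p ≤ q) : Bd n q x :=
  h.trans_le (Nat.pow_le_pow_right (by omega) hpq)

/-- `Nat.pair` stays below the square of one more than the larger argument, so a pair doubles the
exponent. The exponents below come from such doublings and from 1 for each option, rounded up in
places. -/
theorem Bd.pair {p : ℕ} {x : α} {y : β} (hx : Bd n p x) (hy : Bd n p y) : Bd n (2 * p) (x, y) := by
  unfold Bd at *
  rw [encode_prod_val]
  refine (Nat.pair_lt_max_add_one_sq _ _).trans_le ?_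
  rw [mul_comm, pow_mul]
  exact Nat.pow_le_pow_left (by omega) _

theorem Bd.none (hn : 2 ≤ n) (p : ℕ) : Bd n p (none : Option α) :=
  Nat.pow_pos (by omega)

theorem Bd.some {p : ℕ} {x : α} (hn : 2 ≤ n) (hx : Bd n p x) : Bd n (p + 1) (some x) := by
  unfold Bd at *
  rw [encode_some, pow_succ]
  nlinarith

theorem Bd.option {p : ℕ} {o : Option α} (hn : 2 ≤ n) (h : ∀ x ∈ o, Bd n p x) : Bd n (p + 1) o := by
  cases o with
  | none => exact Bd.none hn _
  | some x => exact Bd.some hn (h x rfl)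

theorem Bd.fin (v : Fin n) : Bd n 1 v := by
  have : encode v = v.val := rfl
  simp [Bd, this]

theorem Bd.nat {p x : ℕ} (h : x < n ^ p) : Bd n p x := h

/-- The code is at most `2 * n ^ c + 1 < 4 * n ^ c`, and `4 ≤ n ^ 2`. -/
theorem Bd.int {c : ℕ} {x : ℤ} (hn : 2 ≤ n) (h : |x| ≤ (n : ℤ) ^ c) : Bd n (c + 2) x := by
  have h1 : encode x ≤ 2 * x.natAbs + 1 := by
    have h0 : encode x = Equiv.intEquivNat x := rfl
    rw [h0]
    cases x with
    | ofNat m =>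
      have : Equiv.intEquivNat (Int.ofNat m) = 2 * m := rfl
      rw [this]; simp
    | negSucc m =>
      have : Equiv.intEquivNat (Int.negSucc m) = 2 * m + 1 := rfl
      rw [this]; simp
  have h2 : x.natAbs ≤ n ^ c := by
    zify; exact h
  have h3 : 0 < n ^ c := Nat.pow_pos (by omega)
  have h4 : n ^ (c + 2) = n ^ c * (n * n) := by ring
  have h5 : n ^ c * 4 ≤ n ^ c * (n * n) := Nat.mul_le_mul_left _ (by nlinarith)
  unfold Bd
  omega

theorem Bd.bool (hn : 2 ≤ n) (b : Bool) : Bd n 1 b := by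
  cases b <;> simp [Bd] <;> omega

/-- Since `log n ≥ 1`, one has `n ≤ 2 ^ (2 * log n)`; the factor 2 pays for rounding the logarithm
down. -/
theorem Bd.lt_pow {p : ℕ} {x : α} (h : Bd n p x) (hn : 2 ≤ n) :
    encode x < 2 ^ (Nat.log 2 n * (2 * p)) := by
  have hL : 0 < Nat.log 2 n := Nat.log_pos (by omega) hn
  have h1 : n ≤ 2 ^ (Nat.log 2 n * 2) :=
    (Nat.lt_pow_succ_log_self (by omega) n).le.trans (Nat.pow_le_pow_right (by omega) (by omega))
  calc encode x < n ^ p := h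
    _ ≤ (2 ^ (Nat.log 2 n * 2)) ^ p := Nat.pow_le_pow_left h1 _
    _ = _ := by rw [← pow_mul, mul_assoc]

end Bd

/-- An exponent which is large enough for everything that is stored or sent. -/
def bigExp (c : ℕ) : ℕ := 200000 * (c + 1)

namespace GState.Good
variable {c : ℕ} {S : GState n}

theorem sz_lt (h : S.Good c) (hn : 2 ≤ n) (v : Fin n) : S.sz v < n ^ 3 := by
  have h1 := tourSize_le S.T v
  rw [h.tour.tourSize_eq h.comp] at h1
  exact h1.trans_lt (Nat.pow_lt_pow_right (by omega) (by omega))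

theorem lab_lt (h : S.Good c) (hn : 2 ≤ n) {u v : Fin n} (huv : S.T.Adj u v) :
    S.lab u v < n ^ 3 := (h.tour.lt u v huv).trans (h.sz_lt hn u)

/-- Labels and sizes are below `n ^ 3`, and from the inside out `52 = 2 * (2 * (2 * (2 * 3) + 1))`.
-/
theorem bd_vinfo (h : S.Good c) (hn : 2 ≤ n) (v : Fin n) : Bd n 52 (S.vinfo v) := by
  have h1 : Bd n 52 (S.tid v, S.sz v, (S.nb v).map fun x => (x, S.lab v x, S.lab x v)) := by
    refine Bd.pair (p := 26) ((Bd.fin _).mono hn (by omega)) (Bd.pair (p := 13)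
      ((Bd.nat (h.sz_lt hn v)).mono hn (by omega)) (Bd.option (p := 12) hn ?_))
    intro x hx
    rw [Option.mem_def, Option.map_eq_some_iff] at hx
    obtain ⟨z, hz, rfl⟩ := hx
    have hvz := h.nb_some v z hz
    exact Bd.pair (p := 6) ((Bd.fin _).mono hn (by omega)) (Bd.pair (p := 3)
      (Bd.nat (h.lab_lt hn hvz)) (Bd.nat (h.lab_lt hn hvz.symm)))
  exact h1

theorem bd_item (h : S.Good c) (hn : 2 ≤ n) (a b : Fin n) : Bd n 416 (S.item a b) := by
  have h1 : Bd n 416 (a, b, S.vinfo a, S.vinfo b) :=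
    Bd.pair (p := 208) ((Bd.fin _).mono hn (by omega)) (Bd.pair (p := 104)
      ((Bd.fin _).mono hn (by omega)) (Bd.pair (h.bd_vinfo hn a) (h.bd_vinfo hn b)))
  exact h1

theorem bd_cutInfo (h : S.Good c) (hn : 2 ≤ n) {x y : Fin n} (hxy : S.T.Adj x y) :
    Bd n 96 (S.cutInfo x y) := by
  have h1 : Bd n 96 (x, y, S.tid x, S.sz x, S.lab x y, S.lab y x) :=
    Bd.pair (p := 48) ((Bd.fin _).mono hn (by omega)) (Bd.pair (p := 24)
      ((Bd.fin _).mono hn (by omega)) (Bd.pair (p := 12) ((Bd.fin _).mono hn (by omega))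
        (Bd.pair (p := 6) ((Bd.nat (h.sz_lt hn x)).mono hn (by omega))
          (Bd.pair (p := 3) (Bd.nat (h.lab_lt hn hxy)) (Bd.nat (h.lab_lt hn hxy.symm))))))
  exact h1

theorem bd_entry (h : S.Good c) (hn : 2 ≤ n) {u v : Fin n} (huv : S.H.Adj u v) :
    Bd n (32 * (2 * c + 56)) (u, v, S.record u v) := by
  have hp : |(S.pay s(u, v)).1| ≤ (n : ℤ) ^ c := h.weight _ huv
  have h1 : Bd n (8 * (2 * c + 56)) (S.pay s(u, v), S.vinfo u, S.vinfo v,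
      (S.record u v).tree) := by
    rw [show 8 * (2 * c + 56) = 2 * (2 * (2 * (2 * c + 56))) by ring]
    have hpay : Bd n (2 * (c + 2)) (S.pay s(u, v)) :=
      Bd.pair (x := (S.pay s(u, v)).1) (y := (S.pay s(u, v)).2) (Bd.int hn hp)
        ((Bd.bool hn _).mono hn (by omega))
    refine Bd.pair (hpay.mono hn (by omega)) (Bd.pair ((h.bd_vinfo hn u).mono hn (by omega))
      (Bd.pair ((h.bd_vinfo hn v).mono hn (by omega)) (Bd.mono (p := 7) hn ?_ (by omega))))
    refine Bd.option (p := 6) hn ?_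
    intro x hx
    simp only [record, Option.mem_def] at hx
    split_ifs at hx with hT
    simp only [Option.some.injEq] at hx
    exact hx ▸ Bd.pair (p := 3) (Bd.nat (h.lab_lt hn hT)) (Bd.nat (h.lab_lt hn hT.symm))
  have h2 : Bd n (8 * (2 * c + 56)) (S.record u v) := h1
  rw [show 32 * (2 * c + 56) = 2 * (2 * (8 * (2 * c + 56))) by ring]
  exact Bd.pair ((Bd.fin _).mono hn (by omega)) (Bd.pair ((Bd.fin _).mono hn (by omega)) h2)

end GState.Good

/-- All the components of `x` have small codes. -/
structure Aux.Small (x : Aux n) (c : ℕ) : Prop where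
  pend : ∀ z ∈ x.pend, ∀ w ∈ z.2.2, |w| ≤ (n : ℤ) ^ c
  pu : ∀ z ∈ x.pu, Bd n 52 z
  pv : ∀ z ∈ x.pv, Bd n 52 z
  ci : ∀ z ∈ x.ci, Bd n 96 z
  vx : ∀ z ∈ x.vx, Bd n 52 z
  offset : x.offset < n ^ 3
  relay : ∀ z ∈ x.relay, Bd n 416 z

theorem bd_upd {c : ℕ} (hn : 2 ≤ n) {z : Fin n × Fin n × Option ℤ}
    (h : ∀ w ∈ z.2.2, |w| ≤ (n : ℤ) ^ c) : Bd n (4 * (c + 3)) z := by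
  rw [show 4 * (c + 3) = 2 * (2 * (c + 3)) by ring]
  exact Bd.pair (x := z.1) (y := z.2) ((Bd.fin _).mono hn (by omega))
    (Bd.pair (x := z.2.1) (y := z.2.2) ((Bd.fin _).mono hn (by omega))
      (Bd.option hn fun w hw => Bd.int hn (h w hw)))

theorem Aux.Small.bd {x : Aux n} {c : ℕ} (h : x.Small c) (hn : 2 ≤ n) :
    Bd n (64 * (4 * (c + 3) + 420)) x := by
  have h1 : Bd n (64 * (4 * (c + 3) + 420))
      (x.pend, x.pu, x.pv, x.ci, x.vx, x.offset, x.relay) := by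
    have opt : ∀ {α : Type} [Encodable α] {o : Option α} {p q : ℕ}, (∀ z ∈ o, Bd n p z) →
        p + 1 ≤ q → Bd n q o := fun h hq => (Bd.option hn h).mono hn hq
    rw [show 64 * (4 * (c + 3) + 420) = 2 * (2 * (2 * (2 * (2 * (2 * (4 * (c + 3) + 420))))))
      by ring]
    exact Bd.pair (opt (fun z hz => bd_upd hn (h.pend z hz)) (by omega))
      (Bd.pair (opt h.pu (by omega)) (Bd.pair (opt h.pv (by omega)) (Bd.pair (opt h.ci (by omega))
        (Bd.pair (opt h.vx (by omega)) (Bd.pair ((Bd.nat h.offset).mono hn (by omega))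
          (opt h.relay (by omega)))))))
  exact h1

theorem Aux.small_idle {c : ℕ} (hn : 2 ≤ n) : (Aux.idle : Aux n).Small c :=
  ⟨by simp [Aux.idle], by simp [Aux.idle], by simp [Aux.idle], by simp [Aux.idle],
    by simp [Aux.idle], Nat.pow_pos (by omega), by simp [Aux.idle]⟩

/-- A dart is determined by its edge and by whether it starts at the smaller end. -/
theorem card_darts_le (home : Fin n → Fin k) (H : SimpleGraph (Fin n)) (i : Fin k) :
    {p : Fin n × Fin n | home p.1 = i ∧ H.Adj p.1 p.2}.ncard ≤ 2 * localEdges home H i := by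
  classical
  rw [localEdges, mul_comm, ← Nat.card_coe_set_eq, ← Nat.card_coe_set_eq]
  have : Nat.card {e // e ∈ H.edgeSet ∧ LivesOn home e i} * 2 =
      Nat.card ({e // e ∈ H.edgeSet ∧ LivesOn home e i} × Bool) := by simp
  refine le_of_le_of_eq ?_ this.symm
  refine Nat.card_le_card_of_injective
    (fun p => (⟨s(p.1.1, p.1.2), p.2.2, p.1.1, by simp, p.2.1⟩, decide (p.1.1 < p.1.2))) ?_
  rintro ⟨⟨a, b⟩, h1, h2⟩ ⟨⟨a', b'⟩, h1', h2'⟩ h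
  simp only [Prod.mk.injEq, Subtype.mk.injEq, decide_eq_decide] at h
  obtain ⟨h3, h4⟩ := h
  rcases Sym2.eq_iff.1 h3 with ⟨rfl, rfl⟩ | ⟨rfl, rfl⟩
  · rfl
  · have := h2.ne
    dsimp at *
    exfalso
    omega

theorem length_enc (x : Aux n) (S : GState n) (home : Fin n → Fin k) (i : Fin k) :
    (enc (x, S.view (hosted home i))).length ≤ 1 + 2 * localEdges home S.H i := by
  classical
  have h1 : (enc (x, S.view (hosted home i))).length =
      1 + ((Finset.univ : Finset (Fin n × Fin n)).toList.filterMap fun p =>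
        (S.view (hosted home i) p.1 p.2).map fun r => encode (p.1, p.2, r)).length := by
    simp [enc, add_comm]
  rw [h1, List.length_filterMap_eq_countP]
  refine Nat.add_le_add_left (le_trans ?_ (card_darts_le home S.H i)) 1
  rw [List.countP_eq_length_filter,
    ← List.toFinset_card_of_nodup ((Finset.nodup_toList _).filter _), ← Set.ncard_coe_finset]
  refine Set.ncard_le_ncard ?_ (Set.toFinite _)
  rintro ⟨a, b⟩ hab
  simp only [Option.isSome_map, List.toFinset_filter, Finset.toList_toFinset,
    Finset.coe_filter, Finset.mem_univ, true_and, Set.mem_ofPred_eq, GState.view] at hab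
  split_ifs at hab with hp
  · simpa [hosted] using hp
  · simp at hab

/-- The slack of one edge in `hm` is for an edge under deletion, which is still stored while the
bound already refers to the graph without it. There are at most `2 * m + 3` words, hence at most `5
* (k + m)` as `k ≥ 1`. -/
theorem fitsIn_enc {c : ℕ} (hn : 2 ≤ n) {x : Aux n} (hx : x.Small c) {S : GState n} (h : S.Good c)
    (home : Fin n → Fin k) (hk : 0 < k) (i : Fin k) {m : ℕ} (hm : localEdges home S.H i ≤ m + 1) :
    FitsIn n (2 * bigExp c) (k + m) (enc (x, S.view (hosted home i))) := by
  have hb : ∀ {α : Type} [Encodable α] {y : α} {p : ℕ}, Bd n p y → p ≤ bigExp c →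
      encode y < 2 ^ (2 * bigExp c * Nat.log 2 n) := by
    intro α _ y p hy hp
    rw [mul_comm]
    exact (hy.mono hn hp).lt_pow hn
  constructor
  · refine (length_enc x S home i).trans ?_
    have : 5 ≤ 2 * bigExp c := by unfold bigExp; omega
    nlinarith
  · intro y hy
    simp only [enc, List.mem_cons, List.mem_filterMap, Option.map_eq_some_iff] at hy
    rcases hy with rfl | ⟨p, _, r, hr, rfl⟩
    · exact hb (hx.bd hn) (by unfold bigExp; omega)
    · simp only [GState.view] at hr
      split_ifs at hr with hp
      simp only [Option.some.injEq] at hr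
      exact hr ▸ hb (h.bd_entry hn hp.2) (by unfold bigExp; omega)

end KMachine

namespace KMachine
open SimpleGraph Encodable

variable {n k c : ℕ}

/-! ### Choosing a best candidate -/

open Classical in
/-- A candidate with the least key. -/
noncomputable def pick {ι β : Type*} (key : β → ℤ) (f : ι → Option β) : Option β :=
  if h : ∃ b, (∃ i, f i = some b) ∧ ∀ j b', f j = some b' → key b ≤ key b' then some h.choose
  else none

section pick
variable {ι β : Type*} {key : β → ℤ} {f : ι → Option β}

theorem pick_some {b : β} (h : pick key f = some b) :
    (∃ i, f i = some b) ∧ ∀ j b', f j = some b' → key b ≤ key b' := by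
  unfold pick at h
  split_ifs at h with h'
  exact (Option.some.inj h) ▸ h'.choose_spec

theorem pick_none [Finite ι] (h : pick key f = none) (i : ι) : f i = none := by
  unfold pick at h
  split_ifs at h with h'
  by_contra hi
  refine h' ?_
  obtain ⟨b, hb⟩ := Option.ne_none_iff_exists'.1 hi
  have hfin : {b | ∃ i, f i = some b}.Finite := by
    refine (Set.finite_range fun i => (f i).getD b).subset ?_
    rintro b' ⟨i, hi⟩
    exact ⟨i, by simp [hi]⟩
  obtain ⟨m, hm, hmin⟩ := Set.exists_min_image _ key hfin ⟨b, i, hb⟩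
  exact ⟨m, hm, fun j b' hj => hmin b' ⟨j, hj⟩⟩

theorem pick_eq_none (h : ∀ i, f i = none) : pick key f = none := by
  cases hp : pick key f with
  | none => rfl
  | some b => obtain ⟨⟨i, hi⟩, _⟩ := pick_some hp; simp [h i] at hi

theorem pick_eq_some [Finite ι] {b : β} (i : ι) (hi : f i = some b)
    (h : ∀ j b', f j = some b' → b' = b) : pick key f = some b := by
  cases hp : pick key f with
  | none => simp [pick_none hp i] at hi
  | some b' => obtain ⟨⟨j, hj⟩, _⟩ := pick_some hp; rw [h j b' hj]

/-- Each machine proposes its best candidate; the best proposal is then best among all candidates.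
-/
theorem pick_pick_some {κ : Type*} [Finite κ] {g : ι → κ → Option β} {b : β}
    (h : pick key (fun i => pick key (g i)) = some b) :
    (∃ i j, g i j = some b) ∧ ∀ i j b', g i j = some b' → key b ≤ key b' := by
  obtain ⟨⟨i, hi⟩, hmin⟩ := pick_some h
  obtain ⟨⟨j, hj⟩, _⟩ := pick_some hi
  refine ⟨⟨i, j, hj⟩, fun i' j' b' hb' => ?_⟩
  cases hp : pick key (g i') with
  | none => simp [pick_none hp j'] at hb'
  | some d => exact (hmin i' d hp).trans ((pick_some hp).2 j' b' hb')

theorem pick_pick_none {κ : Type*} [Finite ι] [Finite κ] {g : ι → κ → Option β}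
    (h : pick key (fun i => pick key (g i)) = none) (i : ι) (j : κ) : g i j = none :=
  pick_none (pick_none h i) j

end pick

/-! ### The protocol for an update -/

def received (β : Type) [Encodable β] (ms : Fin k → Option ℕ) : Fin k → Option β :=
  fun j => (ms j).bind decode

theorem received_encode {β : Type} [Encodable β] (f : Fin k → Option β) :
    received β (fun j => (f j).map encode) = f := by
  funext j
  cases h : f j <;> simp [received, h]

/-- The tree edges at which a tree may be cut. -/
def cutCandidate (x : Aux n) (V : View n) (a b : Fin n) : Option (ℤ × CutInfo n) :=
  match x.pend, x.pu, x.pv with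
  | some (u, v, w), some pu, some pv => (V a b).bind fun r => r.tree.bind fun l =>
      let ci : CutInfo n := ⟨a, b, r.src.tid, r.src.sz, l.1, l.2⟩
      if (w.isSome ∧ pu.tid = pv.tid ∧ r.src.tid = pu.tid ∧ ¬ (ci.Far pu.pos ↔ ci.Far pv.pos)) ∨
          (w.isNone ∧ s(a, b) = s(u, v)) then some (r.pay.1, ci) else none
  | _, _, _ => none

/-- The edges which may join two trees. -/
def linkCandidate (V : View n) (a b : Fin n) : Option (ℤ × Item n) :=
  (V a b).bind fun r =>
    if r.src.tid ≠ r.dst.tid then some (r.pay.1, ⟨a, b, r.src, r.dst⟩) else none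

noncomputable def bestCut (x : Aux n) (V : View n) : Option (ℤ × CutInfo n) :=
  pick (fun p => -p.1) fun p : Fin n × Fin n => cutCandidate x V p.1 p.2

noncomputable def bestLink (V : View n) : Option (ℤ × Item n) :=
  pick Prod.fst fun p : Fin n × Fin n => linkCandidate V p.1 p.2

def View.insertPending (x : Aux n) (h : Finset (Fin n)) (V : View n) : View n :=
  match x.pend, x.pu, x.pv with
  | some (u, v, some w), some pu, some pv => V.add h u v pu pv (w, false)
  | _, _, _ => V

def View.cutPending (x : Aux n) (vy : Option (VInfo n)) (V : View n) : View n :=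
  match x.ci, x.vx, vy with
  | some ci, some vx, some vy => ci.mapView vx vy V
  | _, _, _ => V

def View.deletePending (x : Aux n) (V : View n) : View n :=
  match x.pend with
  | some (u, v, none) => V.remove s(u, v)
  | _ => V

def View.linkWith (it : Option (Item n)) (V : View n) : View n :=
  match it with
  | some it => it.mapView V
  | none => V

/-- Rounds: the update is announced; its ends are announced; a cut is chosen; the ends of the cut
are announced; a link is chosen. -/
noncomputable def updateBig (n k : ℕ) : BigProtocol n k (MState n) where
  send _ h t s _ :=
    match t with
    | 0 => s.1.pend.map encode
    | 1 => (s.1.pend.bind fun z => if z.1 ∈ h then some (s.2.vinfo z.1) else none).map encode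
    | 2 => (s.1.pend.bind fun z => if z.2.1 ∈ h then some (s.2.vinfo z.2.1) else none).map encode
    | 3 => (bestCut s.1 s.2).map encode
    | 4 => (s.1.ci.bind fun ci => if ci.x ∈ h then some (ci.endInfo s.2 ci.x) else none).map encode
    | 5 => (s.1.ci.bind fun ci => if ci.y ∈ h then some (ci.endInfo s.2 ci.y) else none).map encode
    | 6 => (bestLink s.2).map encode
    | _ => none
  recv _ h t s ms :=
    match t with
    | 0 => ({ s.1 with pend := pick (fun _ => 0) (received _ ms) }, s.2)
    | 1 => ({ s.1 with pu := pick (fun _ => 0) (received _ ms) }, s.2)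
    -- The new edge enters as a non-forest edge once the data of both its ends are known; the last
    -- round decides whether it joins the forest.
    | 2 => let x : Aux n := { s.1 with pv := pick (fun _ => 0) (received _ ms) }
      (x, s.2.insertPending x h)
    | 3 => ({ s.1 with ci := (pick (fun p => -p.1) (received (ℤ × CutInfo n) ms)).map Prod.snd }, s.2)
    | 4 => ({ s.1 with vx := pick (fun _ => 0) (received _ ms) }, s.2)
    -- The cut comes before the deletion, because only a non-forest edge can be removed from the
    -- graph with the forest still contained in it.
    | 5 => (s.1, (s.2.cutPending s.1 (pick (fun _ => 0) (received _ ms))).deletePending s.1)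
    | 6 => (Aux.idle, s.2.linkWith ((pick Prod.fst (received (ℤ × Item n) ms)).map Prod.snd))
    | _ => s

/-- One round. -/
def BigProtocol.step {σ : Type} (P : BigProtocol n k σ) (home : Fin n → Fin k) (t : ℕ)
    (s : Fin k → σ) : Fin k → σ :=
  fun i => P.recv i (hosted home i) t (s i) fun j => P.send j (hosted home j) t (s j) i

/-- All machines have the view of `S` and the same auxiliary data. -/
noncomputable def GState.states (S : GState n) (x : Aux n) (home : Fin n → Fin k) :
    Fin k → MState n :=
  fun i => (x, S.view (hosted home i))

/-- Inserting an edge of weight `w`, if there is one to insert. -/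
noncomputable def GState.insertEdge (S : GState n) (u v : Fin n) : Option ℤ → GState n
  | some w => S.add u v (w, false)
  | none => S

/-- Removing an edge, if none is to be inserted. -/
def GState.deleteEdge (S : GState n) (u v : Fin n) : Option ℤ → GState n
  | some _ => S
  | none => S.remove s(u, v)

theorem mem_hosted {home : Fin n → Fin k} {i : Fin k} {v : Fin n} :
    v ∈ hosted home i ↔ home v = i := by simp [hosted]

theorem pick_hosted {β : Type*} (home : Fin n → Fin k) (v : Fin n) (key : β → ℤ)
    (f : Fin k → β) : pick key (fun j => if v ∈ hosted home j then some (f j) else none) =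
      some (f (home v)) := by
  refine pick_eq_some (home v) (by simp [mem_hosted]) ?_
  intro j b hb
  split_ifs at hb with h
  rw [mem_hosted] at h
  rw [h]; exact (Option.some.inj hb).symm

theorem cutCandidate_eq_some {S : GState n} {hosts : Finset (Fin n)} {u v : Fin n} {w : Option ℤ}
    {x : Aux n} (hx : x.pend = some (u, v, w)) (hpu : x.pu = some (S.vinfo u))
    (hpv : x.pv = some (S.vinfo v)) (hS : S.T ≤ S.H) {a b : Fin n} {r : ℤ × CutInfo n} :
    cutCandidate x (S.view hosts) a b = some r ↔ a ∈ hosts ∧ S.T.Adj a b ∧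
      ((w.isSome ∧ S.tid u = S.tid v ∧ S.tid a = S.tid u ∧
        ¬ ((S.cutInfo a b).Far (S.vinfo u).pos ↔ (S.cutInfo a b).Far (S.vinfo v).pos)) ∨
        (w.isNone ∧ s(a, b) = s(u, v))) ∧ r = ((S.pay s(a, b)).1, S.cutInfo a b) := by
  classical
  simp only [cutCandidate, hx, hpu, hpv, GState.view]
  by_cases h1 : a ∈ hosts ∧ S.H.Adj a b
  · rw [if_pos h1]
    by_cases h2 : S.T.Adj a b
    · simp only [Option.bind_some, GState.record, h2, if_true, h1.1, true_and]
      constructor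
      · intro h
        split_ifs at h with h3
        exact ⟨h3, (Option.some.inj h).symm⟩
      · rintro ⟨h3, rfl⟩
        exact if_pos h3
    · simp [GState.record, h2]
  · rw [if_neg h1]
    simp only [Option.bind_none, reduceCtorEq, false_iff]
    exact fun h => h1 ⟨h.1, hS h.2.1⟩

theorem linkCandidate_eq_some {S : GState n} {hosts : Finset (Fin n)} {a b : Fin n}
    {r : ℤ × Item n} : linkCandidate (S.view hosts) a b = some r ↔ a ∈ hosts ∧ S.H.Adj a b ∧
      S.tid a ≠ S.tid b ∧ r = ((S.pay s(a, b)).1, S.item a b) := by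
  classical
  simp only [linkCandidate, GState.view]
  by_cases h1 : a ∈ hosts ∧ S.H.Adj a b
  · rw [if_pos h1]
    simp only [Option.bind_some, h1.1, h1.2, true_and]
    constructor
    · intro h
      split_ifs at h with h3
      exact ⟨h3, (Option.some.inj h).symm⟩
    · rintro ⟨h3, rfl⟩
      exact if_pos h3
  · rw [if_neg h1]
    simp only [Option.bind_none, reduceCtorEq, false_iff]
    exact fun h => h1 ⟨h.1, h.2.1⟩

/-! ### The effect of each round of an update on the global state -/

section Steps
variable {home : Fin n → Fin k} {S : GState n}

/-- All machines that announce the update send the same message, so any choice among the messages is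
right. -/
theorem step_zero {u v : Fin n} {w : Option ℤ} {x : Fin k → Aux n} {y : Aux n}
    (hx : ∀ i, { x i with pend := some (u, v, w) } = y)
    (h1 : ∀ i z, (x i).pend = some z → z = (u, v, w)) (h2 : ∃ i, (x i).pend = some (u, v, w)) :
    (updateBig n k).step home 0 (fun i => (x i, S.view (hosted home i))) = S.states y home := by
  funext i
  simp only [BigProtocol.step, updateBig, GState.states]
  obtain ⟨i₀, h0⟩ := h2
  rw [received_encode (fun j => (x j).pend), pick_eq_some i₀ h0 h1, hx]

theorem step_one (h : S.Good c) {x : Aux n} {u v : Fin n} {w : Option ℤ}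
    (hx : x.pend = some (u, v, w)) : (updateBig n k).step home 1 (S.states x home) =
      S.states { x with pu := some (S.vinfo u) } home := by
  funext i
  simp only [BigProtocol.step, updateBig, GState.states, hx, Option.bind_some]
  rw [received_encode (fun j => if u ∈ hosted home j then
    some ((S.view (hosted home j)).vinfo u) else none), pick_hosted,
    h.view_vinfo (mem_hosted.2 rfl)]

theorem step_two (h : S.Good c) {x : Aux n} {u v : Fin n} {w : Option ℤ}
    (hx : x.pend = some (u, v, w)) (hpu : x.pu = some (S.vinfo u)) (huv : u ≠ v)
    (hT : w.isSome → ¬ S.T.Adj u v) : (updateBig n k).step home 2 (S.states x home) =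
      (S.insertEdge u v w).states
        { x with pv := some (S.vinfo v) } home := by
  funext i
  simp only [BigProtocol.step, updateBig, GState.states, hx, Option.bind_some]
  rw [received_encode (fun j => if v ∈ hosted home j then
    some ((S.view (hosted home j)).vinfo v) else none), pick_hosted,
    h.view_vinfo (mem_hosted.2 rfl)]
  simp only [View.insertPending, hpu]
  cases w with
  | none => rfl
  | some w => simp only [GState.insertEdge, GState.Good.view_add S huv _ (hT rfl)]

/-- `ok` describes the edges that may be cut without reference to machines or labels: for an
insertion the edges of the forest path from `u` to `v`, for a deletion `uv` itself. Minimising the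
negated weight finds a heaviest one. -/
theorem step_three (h : S.Good c) {x : Aux n} {u v : Fin n} {w : Option ℤ}
    (hx : x.pend = some (u, v, w)) (hpu : x.pu = some (S.vinfo u)) (hpv : x.pv = some (S.vinfo v)) :
    ∃ ci : Option (CutInfo n), (updateBig n k).step home 3 (S.states x home) =
      S.states { x with ci := ci } home ∧
      let ok := fun a b => S.T.Adj a b ∧ ((w.isSome ∧ S.T.Reachable u v ∧
        ¬ (S.T.deleteEdges {s(a, b)}).Reachable u v) ∨ (w.isNone ∧ s(a, b) = s(u, v)))
      ((ci = none ∧ ∀ a b, ¬ ok a b) ∨ ∃ a b, ci = some (S.cutInfo a b) ∧ ok a b ∧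
        ∀ a' b', ok a' b' → (S.pay s(a', b')).1 ≤ (S.pay s(a, b)).1) := by
  set g : Fin k → Fin n × Fin n → Option (ℤ × CutInfo n) :=
    fun j p => cutCandidate x (S.view (hosted home j)) p.1 p.2 with hg
  refine ⟨(pick (fun p => -p.1) fun j => pick (fun p => -p.1) (g j)).map Prod.snd, ?_, ?_⟩
  · funext i
    simp only [BigProtocol.step, updateBig, GState.states]
    rw [received_encode (fun j => bestCut x (S.view (hosted home j)))]
    rfl
  · intro ok
    have hok : ∀ a b, ok a b ↔ ∃ j r, g j (a, b) = some r := by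
      intro a b
      simp only [hg, cutCandidate_eq_some hx hpu hpv h.le]
      constructor
      · rintro ⟨h1, h2⟩
        refine ⟨home a, _, mem_hosted.2 rfl, h1, h2.imp ?_ id, rfl⟩
        rintro ⟨h2, h3, h4⟩
        have h3' := (h.comp.iff _ _).1 h3
        exact ⟨h2, h3', (h.separates_iff h1 h3').1 h4⟩
      · rintro ⟨j, r, _, h1, h2, _⟩
        refine ⟨h1, h2.imp ?_ id⟩
        rintro ⟨h2, h3, h4⟩
        exact ⟨h2, (h.comp.iff _ _).2 h3, (h.separates_iff h1 h3).2 h4⟩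
    cases hp : pick (fun p => -p.1) fun j => pick (fun p => -p.1) (g j) with
    | none =>
      refine Or.inl ⟨rfl, fun a b hab => ?_⟩
      obtain ⟨j, r, hr⟩ := (hok a b).1 hab
      simp [pick_pick_none hp j (a, b)] at hr
    | some r =>
      obtain ⟨⟨j, ⟨a, b⟩, hr⟩, hmin⟩ := pick_pick_some hp
      have hab := (hok a b).2 ⟨j, r, hr⟩
      obtain ⟨_, _, _, rfl⟩ := (cutCandidate_eq_some hx hpu hpv h.le).1 hr
      refine Or.inr ⟨a, b, rfl, hab, fun a' b' hab' => ?_⟩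
      obtain ⟨j', r', hr'⟩ := (hok a' b').1 hab'
      have := hmin j' (a', b') r' hr'
      obtain ⟨_, _, _, rfl⟩ := (cutCandidate_eq_some hx hpu hpv h.le).1 hr'
      simpa using this

theorem step_four_none {x : Aux n} (hx : x.ci = none) (hvx : x.vx = none) :
    (updateBig n k).step home 4 (S.states x home) = S.states x home := by
  funext i
  simp only [BigProtocol.step, updateBig, GState.states, hx, Option.bind_none]
  rw [received_encode (fun _ => none), pick_eq_none fun _ => rfl]
  cases x; simp_all

theorem step_four (h : S.Good c) {x : Aux n} {a b : Fin n} (hx : x.ci = some (S.cutInfo a b))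
    (hab : S.T.Adj a b) : (updateBig n k).step home 4 (S.states x home) =
      S.states { x with vx := some ((S.cut a b).vinfo a) } home := by
  funext i
  simp only [BigProtocol.step, updateBig, GState.states, hx, Option.bind_some]
  rw [received_encode (fun j => if (S.cutInfo a b).x ∈ hosted home j then
    some ((S.cutInfo a b).endInfo (S.view (hosted home j)) (S.cutInfo a b).x) else none), pick_hosted]
  have e : (S.cutInfo a b).x = a := rfl
  rw [e, h.endInfo_eq hab (Or.inl rfl) (mem_hosted.2 rfl)]

theorem deletePending_eq {x : Aux n} {u v : Fin n} {w : Option ℤ} (hx : x.pend = some (u, v, w))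
    (hosts : Finset (Fin n)) : (S.view hosts).deletePending x =
      (S.deleteEdge u v w).view hosts := by
  cases w with
  | none => simp only [View.deletePending, hx, GState.deleteEdge, GState.Good.view_remove]
  | some w => simp only [View.deletePending, hx, GState.deleteEdge]

theorem step_five_none {x : Aux n} (hx : x.ci = none) {u v : Fin n} {w : Option ℤ}
    (hpend : x.pend = some (u, v, w)) : (updateBig n k).step home 5 (S.states x home) =
      (S.deleteEdge u v w).states x home := by
  funext i
  simp only [BigProtocol.step, updateBig, GState.states]
  have : ∀ (vy : Option (VInfo n)) (V : View n), V.cutPending x vy = V := by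
    intro vy V; simp only [View.cutPending, hx]
  rw [this, deletePending_eq hpend]

theorem step_five (h : S.Good c) {x : Aux n} {a b : Fin n} (hx : x.ci = some (S.cutInfo a b))
    (hvx : x.vx = some ((S.cut a b).vinfo a)) (hab : S.T.Adj a b) {u v : Fin n} {w : Option ℤ}
    (hpend : x.pend = some (u, v, w)) : (updateBig n k).step home 5 (S.states x home) =
      ((S.cut a b).deleteEdge u v w).states x home := by
  funext i
  simp only [BigProtocol.step, updateBig, GState.states, hx, Option.bind_some]
  rw [received_encode (fun j => if (S.cutInfo a b).y ∈ hosted home j then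
    some ((S.cutInfo a b).endInfo (S.view (hosted home j)) (S.cutInfo a b).y) else none), pick_hosted]
  have e : (S.cutInfo a b).y = b := rfl
  rw [e, h.endInfo_eq hab (Or.inr rfl) (mem_hosted.2 rfl)]
  simp only [View.cutPending, hx, hvx]
  rw [← h.view_cut hab, deletePending_eq hpend]

/-- Candidates are recognised by the different tree names at their ends; if there are none, the
forest spans the graph. -/
theorem step_six (h : S.Good c) {x : Aux n} : ∃ S' : GState n,
    (updateBig n k).step home 6 (S.states x home) = S'.states Aux.idle home ∧
      ((S' = S ∧ ∀ a b, S.H.Adj a b → S.T.Reachable a b) ∨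
      ∃ a b, S' = S.link a b ∧ S.H.Adj a b ∧ ¬ S.T.Reachable a b ∧
        ∀ a' b', S.H.Adj a' b' → ¬ S.T.Reachable a' b' →
          (S.pay s(a, b)).1 ≤ (S.pay s(a', b')).1) := by
  set g : Fin k → Fin n × Fin n → Option (ℤ × Item n) :=
    fun j p => linkCandidate (S.view (hosted home j)) p.1 p.2 with hg
  have hok : ∀ a b, (S.H.Adj a b ∧ ¬ S.T.Reachable a b) ↔ ∃ j r, g j (a, b) = some r := by
    intro a b
    simp only [hg, linkCandidate_eq_some, h.comp.iff]
    constructor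
    · rintro ⟨h1, h2⟩
      exact ⟨home a, _, mem_hosted.2 rfl, h1, h2, rfl⟩
    · rintro ⟨j, r, _, h1, h2, _⟩
      exact ⟨h1, h2⟩
  have hstep : (updateBig n k).step home 6 (S.states x home) = fun i => (Aux.idle,
      (S.view (hosted home i)).linkWith
        ((pick Prod.fst fun j => pick Prod.fst (g j)).map Prod.snd)) := by
    funext i
    simp only [BigProtocol.step, updateBig, GState.states]
    rw [received_encode (fun j => bestLink (S.view (hosted home j)))]
    rfl
  rw [hstep]
  cases hp : pick Prod.fst fun j => pick Prod.fst (g j) with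
  | none =>
    refine ⟨S, rfl, Or.inl ⟨rfl, fun a b hab => ?_⟩⟩
    by_contra hn
    obtain ⟨j, r, hr⟩ := (hok a b).1 ⟨hab, hn⟩
    simp [pick_pick_none hp j (a, b)] at hr
  | some r =>
    obtain ⟨⟨j, ⟨a, b⟩, hr⟩, hmin⟩ := pick_pick_some hp
    have hab := (hok a b).2 ⟨j, r, hr⟩
    obtain ⟨_, _, ht, rfl⟩ := linkCandidate_eq_some.1 hr
    refine ⟨S.link a b, ?_, Or.inr ⟨a, b, rfl, hab.1, hab.2, fun a' b' h1 h2 => ?_⟩⟩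
    · funext i
      simp only [GState.states, h.view_link ht]
      rfl
    · obtain ⟨j', r', hr'⟩ := (hok a' b').1 ⟨h1, h2⟩
      have := hmin j' (a', b') r' hr'
      obtain ⟨_, _, _, rfl⟩ := linkCandidate_eq_some.1 hr'
      exact this

end Steps
end KMachine

/-! ### Correctness of an update -/

namespace KMachine
open SimpleGraph Encodable

variable {n k c : ℕ}

/-- `S` is a state for the graph `G`. -/
structure Rep (c : ℕ) (G : WGraph n) (S : GState n) : Prop where
  good : S.Good c
  graph : S.H = G.graph
  weight : ∀ e ∈ G.graph.edgeSet, (S.pay e).1 = G.weight e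
  msf : IsMSF G S.T

theorem BigProtocol.run_succ {σ : Type} (P : BigProtocol n k σ) (home : Fin n → Fin k)
    (s : Fin k → σ) (t : ℕ) : P.run home s (t + 1) = P.step home t (P.run home s t) := rfl

/-- The state of machine `i` is small, for a graph with at most `m + 1` edges there. -/
def SmallState (c : ℕ) (home : Fin n → Fin k) (i : Fin k) (m : ℕ) (s : MState n) : Prop :=
  ∃ (x : Aux n) (S : GState n), x.Small c ∧ S.Good c ∧ localEdges home S.H i ≤ m + 1 ∧
    s = (x, S.view (hosted home i))

theorem localEdges_le {home : Fin n → Fin k} {H G : SimpleGraph (Fin n)} {u v : Fin n}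
    (h : H ≤ G ⊔ edge u v) (i : Fin k) : localEdges home H i ≤ localEdges home G i + 1 := by
  unfold localEdges
  refine (Set.ncard_le_ncard (t := insert s(u, v) {e | e ∈ G.edgeSet ∧ LivesOn home e i}) ?_
    (Set.toFinite _)).trans (Set.ncard_insert_le _ _)
  rintro e ⟨he, hl⟩
  have := edgeSet_mono h he
  rw [edgeSet_sup] at this
  rcases this with h1 | h1
  · exact Or.inr ⟨h1, hl⟩
  · left
    simp only [edge, edgeSet_fromEdgeSet] at h1
    exact h1.1

/-- `hci` is demanded in rounds 4 and 5 only: in round 6 the cut has been made, and `ci` no longer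
describes a forest edge. -/
theorem update_send_lt (hn : 2 ≤ n) {home : Fin n → Fin k} {i j : Fin k} {x : Aux n} {S : GState n}
    (hx : x.Small c) (h : S.Good c) {t : ℕ}
    (hci : t = 4 ∨ t = 5 → ∀ ci ∈ x.ci, ∃ a b, ci = S.cutInfo a b ∧ S.T.Adj a b) {y : ℕ}
    (hy : (updateBig n k).send i (hosted home i) t (x, S.view (hosted home i)) j = some y) :
    y < 2 ^ (Nat.log 2 n * (2 * bigExp c)) := by
  have key : ∀ {β : Type} [Encodable β] {o : Option β} {p : ℕ}, (∀ z ∈ o, Bd n p z) →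
      p ≤ bigExp c → o.map encode = some y → y < 2 ^ (Nat.log 2 n * (2 * bigExp c)) := by
    intro β _ o p ho hp hoy
    obtain ⟨z, hz, rfl⟩ := Option.map_eq_some_iff.1 hoy
    exact ((ho z hz).mono hn hp).lt_pow hn
  have hvinfo : ∀ v, ∀ z ∈ (if v ∈ hosted home i then some ((S.view (hosted home i)).vinfo v)
      else none), Bd n 52 z := by
    intro v z hz
    split_ifs at hz with hv
    · rw [h.view_vinfo hv, Option.mem_some_iff] at hz
      exact hz ▸ h.bd_vinfo hn v
    · simp at hz
  have hend : t = 4 ∨ t = 5 → ∀ ci ∈ x.ci, ∀ v, v = ci.x ∨ v = ci.y → ∀ z ∈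
      (if v ∈ hosted home i then some (ci.endInfo (S.view (hosted home i)) v) else none),
      Bd n 52 z := by
    intro ht ci hc v hv z hz
    obtain ⟨a, b, rfl, hab⟩ := hci ht ci hc
    split_ifs at hz with hvh
    · rw [h.endInfo_eq hab hv hvh, Option.mem_some_iff] at hz
      exact hz ▸ (h.cut hab).bd_vinfo hn v
    · simp at hz
  have hpay : ∀ a b, S.H.Adj a b → Bd n (c + 2) (S.pay s(a, b)).1 := fun a b hab =>
    Bd.int hn (h.weight _ hab)
  have big : 1000 * (c + 1) ≤ bigExp c := by unfold bigExp; omega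
  have big' : 2 * (c + 416) ≤ bigExp c := by unfold bigExp; linarith
  match t, hy, hci, hend with
  | 0, hy, _, _ =>
    have hp : ∀ z ∈ x.pend, Bd n (4 * (c + 3)) z := fun z hz => bd_upd hn (hx.pend z hz)
    exact key hp (by omega) hy
  | 1, hy, _, _ =>
    refine key (p := 52) (fun z hz => ?_) (by omega) hy
    obtain ⟨p, _, hp⟩ := Option.bind_eq_some_iff.1 hz
    exact hvinfo _ z hp
  | 2, hy, _, _ =>
    refine key (p := 52) (fun z hz => ?_) (by omega) hy
    obtain ⟨p, _, hp⟩ := Option.bind_eq_some_iff.1 hz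
    exact hvinfo _ z hp
  | 3, hy, _, _ =>
    refine key (p := 2 * (c + 96)) (fun z hz => ?_) (by omega) hy
    obtain ⟨⟨p, hp⟩, _⟩ := pick_some hz
    simp only [cutCandidate] at hp
    split at hp
    · obtain ⟨r, hr, hp⟩ := Option.bind_eq_some_iff.1 hp
      simp only [GState.view] at hr
      split_ifs at hr with h1
      obtain rfl := Option.some.inj hr
      obtain ⟨l, hl, hp⟩ := Option.bind_eq_some_iff.1 hp
      simp only [GState.record] at hl
      split_ifs at hl with h2
      obtain rfl := Option.some.inj hl
      split_ifs at hp with h3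
      obtain rfl := Option.some.inj hp
      exact Bd.pair ((hpay _ _ h1.2).mono hn (by omega)) ((h.bd_cutInfo hn h2).mono hn (by omega))
    · simp at hp
  | 4, hy, _, hend =>
    refine key (p := 52) (fun z hz => ?_) (by omega) hy
    obtain ⟨ci, hc, hp⟩ := Option.bind_eq_some_iff.1 hz
    exact hend (Or.inl rfl) ci hc _ (Or.inl rfl) z hp
  | 5, hy, _, hend =>
    refine key (p := 52) (fun z hz => ?_) (by omega) hy
    obtain ⟨ci, hc, hp⟩ := Option.bind_eq_some_iff.1 hz
    exact hend (Or.inr rfl) ci hc _ (Or.inr rfl) z hp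
  | 6, hy, _, _ =>
    refine key (p := 2 * (c + 416)) (fun z hz => ?_) big' hy
    obtain ⟨⟨p, hp⟩, _⟩ := pick_some hz
    obtain ⟨_, h1, _, rfl⟩ := linkCandidate_eq_some.1 hp
    exact Bd.pair ((hpay _ _ h1).mono hn (by omega)) ((h.bd_item hn _ _).mono hn (by omega))

/-- How the graph changes: `w` is the weight of an inserted edge, or `none`. -/
structure Change (c : ℕ) (G G' : WGraph n) (u v : Fin n) (w : Option ℤ) : Prop where
  ne : u ≠ v
  weight : ∀ e ∈ G.graph.edgeSet, G'.weight e = G.weight e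
  insert : ∀ y, w = some y → ¬ G.graph.Adj u v ∧ |y| ≤ (n : ℤ) ^ c ∧
    G'.graph = G.graph ⊔ edge u v ∧ G'.weight s(u, v) = y
  delete : w = none → G.graph.Adj u v ∧ G'.graph = G.graph.deleteEdges {s(u, v)}

theorem Rep.insert_msf {G G' : WGraph n} {S : GState n} (hS : Rep c G S) {u v : Fin n} {y : ℤ}
    (hG : Change c G G' u v (some y)) : (S.add u v (y, false)).Good c ∧
    (S.add u v (y, false)).H = G'.graph ∧
    ∀ e ∈ G'.graph.edgeSet, ((S.add u v (y, false)).pay e).1 = G'.weight e := by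
  classical
  obtain ⟨h1, h2, h3, h4⟩ := hG.insert y rfl
  refine ⟨hS.good.add hG.ne h2, ?_, ?_⟩
  · rw [h3, ← hS.graph]; rfl
  · intro e he
    simp only [GState.add]
    by_cases hu : e = s(u, v)
    · subst hu; simp [h4]
    · rw [Function.update_of_ne hu]
      have : e ∈ G.graph.edgeSet := by
        rw [h3] at he; simpa [edgeSet_edge_of_ne hG.ne, hu] using he
      rw [hS.weight e this, hG.weight e this]

theorem update_run (hn : 2 ≤ n) {G G' : WGraph n} {S : GState n} (hS : Rep c G S)
    {u v : Fin n} {w : Option ℤ} (hG : Change c G G' u v w) (home : Fin n → Fin k)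
    (s : Fin k → MState n)
    (hs : s = fun i => ({ (Aux.idle : Aux n) with
      pend := if home u = i ∨ home v = i then some (u, v, w) else none }, S.view (hosted home i))) :
    (∀ t < 7, ∀ i j y, (updateBig n k).send i (hosted home i) t ((updateBig n k).run home s t i) j =
      some y → y < 2 ^ (Nat.log 2 n * (2 * bigExp c))) ∧
    (∀ t ≤ 7, ∀ i, SmallState c home i (localEdges home G'.graph i)
      ((updateBig n k).run home s t i)) ∧
    ∃ S', Rep c G' S' ∧ (updateBig n k).run home s 7 = S'.states Aux.idle home := by
  have hgood := hS.good
  have hTG : S.T ≤ G.graph := hS.graph ▸ hgood.le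
  have hsmall : ∀ x : Aux n, x.pend = some (u, v, w) ∨ x.pend = none → x.offset = 0 →
      x.relay = none → (∀ z ∈ x.pu, Bd n 52 z) → (∀ z ∈ x.pv, Bd n 52 z) →
      (∀ z ∈ x.ci, Bd n 96 z) → (∀ z ∈ x.vx, Bd n 52 z) → x.Small c := by
    intro x h1 h2 h3 h4 h5 h6 h7
    refine ⟨?_, h4, h5, h6, h7, by rw [h2]; exact Nat.pow_pos (by omega), by simp [h3]⟩
    rintro z hz y hy
    rcases h1 with h1 | h1
    · rw [h1, Option.mem_some_iff] at hz
      subst hz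
      exact (hG.insert y hy).2.1
    · simp [h1] at hz
  -- All graphs stored during the update lie within `G'` and `uv`, since a deleted edge is kept
  -- until the cut is over. This costs at most one extra edge on each machine.
  have hGH : G.graph ≤ G'.graph ⊔ edge u v := by
    cases w with
    | some y => rw [(hG.insert y rfl).2.2.1]; exact le_sup_left.trans le_sup_left
    | none =>
      rw [(hG.delete rfl).2]
      intro a b hab
      rw [sup_edge_adj hG.ne, deleteEdges_singleton_adj]
      by_cases he : s(a, b) = s(u, v)
      · exact Or.inr (Sym2.eq_iff.1 he)
      · exact Or.inl ⟨hab, he⟩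
  -- the first three rounds
  set P := updateBig n k with hP
  set x1 : Aux n := { (Aux.idle : Aux n) with pend := some (u, v, w) } with hx1
  set x2 : Aux n := { x1 with pu := some (S.vinfo u) } with hx2
  set x3 : Aux n := { x2 with pv := some (S.vinfo v) } with hx3
  have r1 : P.run home s 1 = S.states x1 home := by
    rw [BigProtocol.run_succ]
    change P.step home 0 s = _
    rw [hs]
    refine step_zero (fun i => rfl) ?_ ⟨home u, by simp⟩
    intro i z hz
    simp only at hz
    split_ifs at hz
    exact (Option.some.inj hz).symm
  have r2 : P.run home s 2 = S.states x2 home := by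
    rw [BigProtocol.run_succ, r1]; exact step_one hgood rfl
  have hnT : w.isSome → ¬ S.T.Adj u v := by
    intro hw h
    obtain ⟨y, rfl⟩ := Option.isSome_iff_exists.1 hw
    exact (hG.insert y rfl).1 (hTG h)
  obtain ⟨S1, hS1, g1, T1, H1, hpay1, r3⟩ : ∃ S1 : GState n,
      S1 = S.insertEdge u v w ∧ S1.Good c ∧
      S1.T = S.T ∧ S1.H ≤ G'.graph ⊔ edge u v ∧
      (∀ z, S1.vinfo z = S.vinfo z) ∧ P.run home s 3 = S1.states x3 home := by
    refine ⟨_, rfl, ?_, ?_, ?_, ?_, ?_⟩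
    · cases w with
      | none => exact hgood
      | some y => exact hgood.add hG.ne (hG.insert y rfl).2.1
    · cases w <;> rfl
    · cases w with
      | none => simp only [GState.insertEdge, hS.graph]; exact hGH
      | some y =>
        refine le_trans (le_of_eq ?_) (le_sup_left (b := edge u v))
        exact (hS.insert_msf hG).2.1
    · intro z; cases w <;> rfl
    · rw [BigProtocol.run_succ, r2]
      exact step_two (x := x2) hgood rfl rfl hG.ne hnT
  have b1 : x1.Small c := hsmall x1 (Or.inl rfl) rfl rfl (by simp [hx1, Aux.idle])
    (by simp [hx1, Aux.idle]) (by simp [hx1, Aux.idle]) (by simp [hx1, Aux.idle])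
  have b2 : x2.Small c := hsmall x2 (Or.inl rfl) rfl rfl
    (by simpa [hx2] using hgood.bd_vinfo hn u)
    (by simp [hx2, hx1, Aux.idle]) (by simp [hx2, hx1, Aux.idle]) (by simp [hx2, hx1, Aux.idle])
  have b3 : x3.Small c := hsmall x3 (Or.inl rfl) rfl rfl
    (by simpa [hx2, hx3] using hgood.bd_vinfo hn u) (by simpa [hx3] using hgood.bd_vinfo hn v)
    (by simp [hx3, hx2, hx1, Aux.idle]) (by simp [hx3, hx2, hx1, Aux.idle])
  have hSH : S.H ≤ G'.graph ⊔ edge u v := hS.graph ▸ hGH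
  -- the choice of the cut
  obtain ⟨ci, r4, hci⟩ := step_three (home := home) g1 (x := x3) (u := u) (v := v) (w := w) rfl
    (by rw [hpay1]) (by rw [hpay1])
  rw [← hP, ← r3, ← BigProtocol.run_succ] at r4
  simp only [T1] at hci
  set x4 : Aux n := { x3 with ci := ci } with hx4
  have hci' : ∀ z ∈ x4.ci, ∃ a b, z = S1.cutInfo a b ∧ S1.T.Adj a b := by
    intro z hz
    rcases hci with ⟨h1, _⟩ | ⟨a, b, h1, h2, _⟩
    · simp [hx4, h1] at hz
    · simp only [hx4, h1, Option.mem_some_iff] at hz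
      exact ⟨a, b, hz.symm, T1 ▸ h2.1⟩
  have bci : ∀ z ∈ x4.ci, Bd n 96 z := by
    intro z hz
    obtain ⟨a, b, rfl, hab⟩ := hci' z hz
    exact g1.bd_cutInfo hn hab
  have b4 : x4.Small c := hsmall x4 (Or.inl rfl) rfl rfl b3.pu b3.pv bci b3.vx
  -- the cut
  obtain ⟨x5, S2, r5, r6, b5, hci5, g2, hS2⟩ : ∃ (x5 : Aux n) (S2 : GState n),
      P.run home s 5 = S1.states x5 home ∧ P.run home s 6 = S2.states x5 home ∧ x5.Small c ∧
      x5.ci = x4.ci ∧ S2.Good c ∧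
      ((ci = none ∧ S2 = S1.deleteEdge u v w) ∨
      ∃ a b, ci = some (S1.cutInfo a b) ∧ S1.T.Adj a b ∧
        S2 = (S1.cut a b).deleteEdge u v w) := by
    rcases hci with ⟨h1, h2⟩ | ⟨a, b, h1, h2, _⟩
    · have e5 : P.run home s 5 = S1.states x4 home := by
        rw [BigProtocol.run_succ, r4]; exact step_four_none h1 rfl
      refine ⟨x4, _, e5, ?_, b4, rfl, ?_, Or.inl ⟨h1, rfl⟩⟩
      · rw [BigProtocol.run_succ, e5]; exact step_five_none (x := x4) h1 rfl
      · cases w with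
        | some y => exact g1
        | none =>
          refine g1.remove ?_
          rw [T1]
          intro h
          exact h2 u v ⟨h, Or.inr ⟨rfl, rfl⟩⟩
    · have hab : S1.T.Adj a b := T1 ▸ h2.1
      have e5 : P.run home s 5 =
          S1.states { x4 with vx := some ((S1.cut a b).vinfo a) } home := by
        rw [BigProtocol.run_succ, r4]; exact step_four g1 h1 hab
      refine ⟨_, _, e5, ?_, ?_, rfl, ?_, Or.inr ⟨a, b, h1, hab, rfl⟩⟩
      · rw [BigProtocol.run_succ, e5]; exact step_five (x := { x4 with vx := some ((S1.cut a b).vinfo a) }) g1 h1 rfl hab rfl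
      · exact hsmall _ (Or.inl rfl) rfl rfl b4.pu b4.pv b4.ci
          (by simpa using (g1.cut hab).bd_vinfo hn a)
      · cases w with
        | some y => exact g1.cut hab
        | none =>
          refine (g1.cut hab).remove ?_
          rcases h2.2 with ⟨h3, _⟩ | ⟨_, h3⟩
          · simp at h3
          · rw [← h3]; simp [GState.cut]
  -- the link
  obtain ⟨S3, r7, hS3⟩ := step_six (home := home) g2 (x := x5)
  rw [← hP, ← r6, ← BigProtocol.run_succ] at r7
  have H2 : S2.H ≤ S1.H := by
    rcases hS2 with ⟨_, rfl⟩ | ⟨a, b, _, _, rfl⟩ <;> cases w <;>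
      first | exact le_rfl | exact deleteEdges_le _
  have H3 : S3.H = S2.H := by
    rcases hS3 with ⟨rfl, _⟩ | ⟨a, b, rfl, _⟩ <;> rfl
  have P3 : S3.pay = S1.pay := by
    have e1 : S3.pay = S2.pay := by rcases hS3 with ⟨rfl, _⟩ | ⟨a, b, rfl, _⟩ <;> rfl
    have e2 : S2.pay = S1.pay := by
      rcases hS2 with ⟨_, rfl⟩ | ⟨a, b, _, _, rfl⟩ <;> cases w <;> rfl
    exact e1.trans e2
  have P2 : S2.pay = S1.pay := by
    rcases hS2 with ⟨_, rfl⟩ | ⟨a, b, _, _, rfl⟩ <;> cases w <;> rfl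
  have g3 : S3.Good c := by
    rcases hS3 with ⟨rfl, _⟩ | ⟨a, b, rfl, h1, h2, _⟩
    · exact g2
    · exact g2.link (fun h => h2 ((g2.comp.iff _ _).2 h)) h1
  have rep : Rep c G' S3 := by
    have hmsf := hS.msf
    cases w with
    | some y =>
      obtain ⟨_, hH, hpay⟩ := hS.insert_msf hG
      obtain ⟨_, _, hg, _⟩ := hG.insert y rfl
      simp only [GState.insertEdge] at hS1
      rw [← hS1] at hH hpay
      have huvG : G'.graph.Adj u v := hg ▸ (sup_edge_adj hG.ne).2 (by tauto)
      have hH2 : S2.H = G'.graph := by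
        rw [← hH]; rcases hS2 with ⟨_, rfl⟩ | ⟨a, b, _, _, rfl⟩ <;> rfl
      refine ⟨g3, H3.trans hH2, P3 ▸ hpay, ?_⟩
      rcases hci with ⟨h1, h2⟩ | ⟨a, b, h1, h2, h3⟩
      · have hS2' : S2 = S1 := by
          rcases hS2 with ⟨_, h⟩ | ⟨a, b, h, _⟩
          · exact h
          · simp [h1] at h
        -- If `u` and `v` were in one tree, an edge of the path between them would have been a
        -- candidate for the cut.
        have hnr : ¬ S.T.Reachable u v := fun hr => by
          obtain ⟨p, q, hpq, _, _, hsep⟩ := exists_separating_adj hgood.acyclic hr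
            (S := {u}) rfl (by simpa using hG.ne.symm)
          exact h2 p q ⟨hpq, Or.inl ⟨rfl, hr, hsep⟩⟩
        rw [hS2', T1, ← hS2', hH2] at hS3
        rcases hS3 with ⟨_, h4⟩ | ⟨p, q, rfl, h4, h5, _⟩
        · exact absurd (h4 u v huvG) hnr
        · have := hmsf.insert_link hg hG.ne hG.weight hnr h4 h5
          simpa only [GState.link, hS2', T1] using this
      · have hab : S1.T.Adj a b := T1 ▸ h2.1
        have hS2' : S2 = S1.cut a b := by
          rcases hS2 with ⟨h, _⟩ | ⟨a', b', h, _, h'⟩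
          · simp [h1] at h
          · rw [h1] at h
            have h := Option.some.inj h
            have e1 : a = a' := congrArg CutInfo.x h
            have e2 : b = b' := congrArg CutInfo.y h
            subst e1; subst e2; exact h'
        have hT2 : S2.T = S.T.deleteEdges {s(a, b)} := by rw [hS2', ← T1]; rfl
        obtain ⟨_, ⟨_, hr, hsep⟩ | ⟨h, _⟩⟩ := h2
        · have hGT : ∀ {p q}, S.T.Adj p q → G'.graph.Adj p q := fun h =>
            hg ▸ Or.inl (hTG h)
          rw [hT2, hH2, P2] at hS3
          rcases hS3 with ⟨_, h4⟩ | ⟨p, q, rfl, h4, h5, h6⟩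
          -- The new edge itself crosses the cut, so a link is always found.
          · exact absurd (h4 u v huvG) hsep
          · have := hmsf.insert_exchange hg hG.ne hG.weight hr (T1 ▸ hab) hsep
              (fun x' y' hx' hs' => by
                have := h3 x' y' ⟨hx', Or.inl ⟨rfl, hr, hs'⟩⟩
                rwa [hpay _ (hGT hx'), hpay _ (hGT (T1 ▸ hab))] at this) h4 h5
              (fun a' b' ha' hb' => by
                have := h6 a' b' ha' hb'
                rwa [hpay _ h4, hpay _ ha'] at this)
            simpa only [GState.link, hT2] using this
        · simp at h
    | none =>
      obtain ⟨hGuv, hg⟩ := hG.delete rfl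
      have hS1 : S1 = S := hS1
      subst hS1
      have hH2 : S2.H = G'.graph := by
        rw [hg, ← hS.graph]
        rcases hS2 with ⟨_, rfl⟩ | ⟨a, b, _, _, rfl⟩ <;> rfl
      have hpay : ∀ e ∈ G'.graph.edgeSet, (S1.pay e).1 = G'.weight e := by
        intro e he
        have : e ∈ G.graph.edgeSet := edgeSet_mono (hg ▸ deleteEdges_le _) he
        rw [hS.weight e this, hG.weight e this]
      refine ⟨g3, H3.trans hH2, P3 ▸ hpay, ?_⟩
      rcases hci with ⟨h1, h2⟩ | ⟨a, b, h1, h2, _⟩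
      · have hS2' : S2 = S1.remove s(u, v) := by
          rcases hS2 with ⟨_, h⟩ | ⟨a, b, h, _⟩
          · exact h
          · simp [h1] at h
        -- No cut means that `uv` was not in the forest. The forest still spans, so no link can be
        -- found either.
        have hm := hmsf.delete_nontree hg hG.weight fun h => h2 u v ⟨h, Or.inr ⟨rfl, rfl⟩⟩
        have hT2 : S2.T = S1.T := by rw [hS2']; rfl
        rw [hT2, hH2] at hS3
        rcases hS3 with ⟨rfl, _⟩ | ⟨p, q, rfl, h4, h5, _⟩
        · exact hT2 ▸ hm
        · exact absurd (hm.spanningForest.spanning _ _ h4.reachable) h5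
      · have hS2' : S2 = (S1.cut a b).remove s(u, v) := by
          rcases hS2 with ⟨h, _⟩ | ⟨a', b', h, _, h'⟩
          · simp [h1] at h
          · rw [h1] at h
            have h := Option.some.inj h
            have e1 : a = a' := congrArg CutInfo.x h
            have e2 : b = b' := congrArg CutInfo.y h
            subst e1; subst e2; exact h'
        have hT2 : S2.T = S1.T.deleteEdges {s(a, b)} := by rw [hS2']; rfl
        obtain ⟨hab, ⟨h, _⟩ | ⟨_, he⟩⟩ := h2
        · simp at h
        · rw [← he] at hg
          rw [hT2, hH2, P2] at hS3
          rcases hS3 with ⟨rfl, h4⟩ | ⟨p, q, rfl, h4, h5, h6⟩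
          · exact hT2 ▸ hmsf.delete_bridge hg hG.weight hab h4
          · have := hmsf.delete_exchange hg hG.weight hab h4 h5 (fun a' b' ha' hb' => by
              have := h6 a' b' ha' hb'
              rwa [hpay _ h4, hpay _ ha'] at this)
            simpa only [GState.link, hT2] using this
  -- collecting
  have x0s : ∀ i : Fin k, ({ (Aux.idle : Aux n) with
      pend := if home u = i ∨ home v = i then some (u, v, w) else none } : Aux n).Small c := by
    intro i
    refine hsmall _ ?_ rfl rfl (by simp [Aux.idle]) (by simp [Aux.idle]) (by simp [Aux.idle])
      (by simp [Aux.idle])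
    simp only
    split_ifs
    · exact Or.inl rfl
    · exact Or.inr rfl
  have r0 : ∀ i, P.run home s 0 i = ({ (Aux.idle : Aux n) with
      pend := if home u = i ∨ home v = i then some (u, v, w) else none }, S.view (hosted home i)) := by
    intro i; simp [BigProtocol.run, hs]
  have ss : ∀ {x : Aux n} {S' : GState n}, x.Small c → S'.Good c →
      S'.H ≤ G'.graph ⊔ edge u v → ∀ i, SmallState c home i (localEdges home G'.graph i)
        (S'.states x home i) := fun hx hg hH i => ⟨_, _, hx, hg, localEdges_le hH i, rfl⟩
  refine ⟨?_, ?_, S3, rep, r7⟩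
  · intro t ht i j y hy
    have send : ∀ {x : Aux n} {S' : GState n}, x.Small c → S'.Good c →
        (t = 4 ∨ t = 5 → ∀ ci ∈ x.ci, ∃ a b, ci = S'.cutInfo a b ∧ S'.T.Adj a b) →
        P.run home s t i = (x, S'.view (hosted home i)) → _ := fun hx hg hc hr =>
      update_send_lt hn hx hg hc (hr ▸ hy)
    interval_cases t
    · exact send (x0s i) hgood (by omega) (r0 i)
    · exact send b1 hgood (by omega) (congrFun r1 i)
    · exact send b2 hgood (by omega) (congrFun r2 i)
    · exact send b3 g1 (by omega) (congrFun r3 i)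
    · exact send b4 g1 (fun _ => hci') (congrFun r4 i)
    · exact send b5 g1 (fun _ => hci5 ▸ hci') (congrFun r5 i)
    · exact send b5 g2 (by omega) (congrFun r6 i)
  · intro t ht i
    interval_cases t
    · exact ⟨_, _, x0s i, hgood, localEdges_le hSH i, r0 i⟩
    · rw [r1]; exact ss b1 hgood hSH i
    · rw [r2]; exact ss b2 hgood hSH i
    · rw [r3]; exact ss b3 g1 H1 i
    · rw [r4]; exact ss b4 g1 H1 i
    · rw [r5]; exact ss b5 g1 H1 i
    · rw [r6]; exact ss b5 g2 (H2.trans H1) i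
    · rw [r7]; exact ss (Aux.small_idle hn) g3 (H3 ▸ H2.trans H1) i

end KMachine

namespace KMachine
open SimpleGraph Encodable

variable {n k c : ℕ}

/-! ### Joining many trees -/

/-- All items carry data from before the first link, so each link has to translate the items that
are still to come. -/
def foldLinks : List (Item n) → View n → View n
  | [], V => V
  | it :: l, V => foldLinks (l.map it.mapItem) (it.mapView V)
  termination_by l => l.length

def GState.links (S : GState n) (l : List (Fin n × Fin n)) : GState n :=
  l.foldl (fun S p => S.link p.1 p.2) S

/-- The edges of `l` can be added to the forest one after the other. -/
def GState.Linkable : GState n → List (Fin n × Fin n) → Prop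
  | _, [] => True
  | S, p :: l => S.tid p.1 ≠ S.tid p.2 ∧ S.H.Adj p.1 p.2 ∧ GState.Linkable (S.link p.1 p.2) l

namespace GState
variable {S : GState n}

@[simp] theorem links_H (S : GState n) (l : List (Fin n × Fin n)) : (S.links l).H = S.H := by
  induction l generalizing S with
  | nil => rfl
  | cons p l ih => exact ih (S.link p.1 p.2)

@[simp] theorem links_pay (S : GState n) (l : List (Fin n × Fin n)) :
    (S.links l).pay = S.pay := by
  induction l generalizing S with
  | nil => rfl
  | cons p l ih => exact ih (S.link p.1 p.2)

theorem links_append (S : GState n) (l l' : List (Fin n × Fin n)) :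
    S.links (l ++ l') = (S.links l).links l' := List.foldl_append ..

theorem linkable_append {l l' : List (Fin n × Fin n)} :
    S.Linkable (l ++ l') ↔ S.Linkable l ∧ (S.links l).Linkable l' := by
  induction l generalizing S with
  | nil => simp [Linkable, links]
  | cons p l ih =>
    simp only [List.cons_append, Linkable, ih, links, List.foldl_cons]
    tauto

theorem Good.links (h : S.Good c) {l : List (Fin n × Fin n)} (hl : S.Linkable l) :
    (S.links l).Good c := by
  induction l generalizing S with
  | nil => exact h
  | cons p l ih => exact ih (h.link hl.1 hl.2.1) hl.2.2

theorem Good.foldLinks_view (h : S.Good c) {l : List (Fin n × Fin n)} (hl : S.Linkable l)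
    (hosts : Finset (Fin n)) :
    foldLinks (l.map fun p => S.item p.1 p.2) (S.view hosts) = (S.links l).view hosts := by
  induction l generalizing S with
  | nil => simp [foldLinks, GState.links]
  | cons p l ih =>
    rw [List.map_cons, foldLinks, ← h.view_link hl.1, List.map_map]
    have : (S.item p.1 p.2).mapItem ∘ (fun p => S.item p.1 p.2) =
        fun q : Fin n × Fin n => (S.link p.1 p.2).item q.1 q.2 := by
      funext q; exact h.mapItem_link hl.1 q.1 q.2
    rw [this]
    exact ih (h.link hl.1 hl.2.1) hl.2.2

/-- Each link removes at least one tree name. This bounds the number of edges that must be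
announced, and so the number of batches. -/
theorem Linkable.length_add_card_le {l : List (Fin n × Fin n)} (h : S.Good c)
    (hl : S.Linkable l) : l.length + (Finset.univ.image (S.links l).tid).card ≤
      (Finset.univ.image S.tid).card := by
  induction l generalizing S with
  | nil => simp [GState.links]
  | cons p l ih =>
    have h1 := ih (h.link hl.1 hl.2.1) hl.2.2
    have h2 : (Finset.univ.image (S.link p.1 p.2).tid).card < (Finset.univ.image S.tid).card := by
      refine Finset.card_lt_card (Finset.ssubset_iff_of_subset ?_ |>.2 ⟨S.tid p.2, by simp, ?_⟩)
      · intro z hz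
        simp only [Finset.mem_image, Finset.mem_univ, true_and, GState.link] at hz ⊢
        obtain ⟨v, rfl⟩ := hz
        split_ifs
        · exact ⟨_, rfl⟩
        · exact ⟨_, rfl⟩
      · simp only [Finset.mem_image, Finset.mem_univ, true_and, GState.link, not_exists]
        intro v hv
        split_ifs at hv with h3
        · exact hl.1 hv
        · exact h3 hv
    have : S.links (p :: l) = (S.link p.1 p.2).links l := rfl
    rw [this, List.length_cons]
    omega

theorem Linkable.length_le {l : List (Fin n × Fin n)} (h : S.Good c) (hl : S.Linkable l) :
    l.length ≤ n := by
  have h1 := hl.length_add_card_le h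
  have h2 : (Finset.univ.image S.tid).card ≤ n := by
    simpa using Finset.card_image_le (s := (Finset.univ : Finset (Fin n))) (f := S.tid)
  omega

theorem links_adj {l : List (Fin n × Fin n)} (hl : S.Linkable l) {a b : Fin n} :
    (S.links l).T.Adj a b ↔ S.T.Adj a b ∨ (a, b) ∈ l ∨ (b, a) ∈ l := by
  induction l generalizing S with
  | nil => simp [GState.links]
  | cons p l ih =>
    have : S.links (p :: l) = (S.link p.1 p.2).links l := rfl
    have hp : (S.link p.1 p.2).T.Adj a b ↔ _ := sup_edge_adj hl.2.1.ne
    rw [this, ih hl.2.2, hp]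
    simp only [List.mem_cons, Prod.ext_iff]
    tauto

/-- If earlier links had already connected the ends of `p`, then `p` would not be a bridge of `F`.
The condition `p.1 < p.2` keeps an edge from occurring in both orientations. -/
theorem linkable_of_acyclic {F : SimpleGraph (Fin n)} (hF : F.IsAcyclic) {l : List (Fin n × Fin n)}
    (h : S.Good c) (hl : ∀ p ∈ l, F.Adj p.1 p.2 ∧ p.1 < p.2 ∧ ¬ S.T.Adj p.1 p.2) (hnd : l.Nodup)
    (hS : S.T ≤ F) (hH : F ≤ S.H) : S.Linkable l := by
  induction l generalizing S with
  | nil => trivial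
  | cons p l ih =>
    obtain ⟨h1, h2, h3⟩ := hl p (by simp)
    rw [List.nodup_cons] at hnd
    have ht : S.tid p.1 ≠ S.tid p.2 := by
      intro ht
      refine deleteEdge_not_reachable hF h1 (((h.comp.iff _ _).2 ht).mono ?_)
      intro a b hab
      refine deleteEdges_singleton_adj.2 ⟨hS hab, fun he => h3 ?_⟩
      rcases Sym2.eq_iff.1 he with ⟨rfl, rfl⟩ | ⟨rfl, rfl⟩
      · exact hab
      · exact hab.symm
    have hadj : ∀ {a b}, (S.link p.1 p.2).T.Adj a b ↔ _ := sup_edge_adj h1.ne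
    refine ⟨ht, hH h1, ih (h.link ht (hH h1)) ?_ hnd.2 ?_ hH⟩
    · intro q hq
      obtain ⟨h4, h5, h6⟩ := hl q (by simp [hq])
      refine ⟨h4, h5, fun h7 => ?_⟩
      rcases hadj.1 h7 with h7 | ⟨h8, h9⟩ | ⟨h8, h9⟩
      · exact h6 h7
      · exact hnd.1 (Prod.ext h8 h9 ▸ hq)
      · rw [h8, h9] at h5; exact lt_asymm h2 h5
    · intro a b hab
      rcases hadj.1 hab with h7 | ⟨rfl, rfl⟩ | ⟨rfl, rfl⟩
      · exact hS h7
      · exact h1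
      · exact h1.symm

end GState

/-! ### Concatenated lists -/

section Concat
variable {α : Type*} (l : ℕ → List α)

def concat (m : ℕ) : List α := (List.range m).flatMap l

theorem concat_succ (m : ℕ) : concat l (m + 1) = concat l m ++ l m := by
  simp [concat, List.range_succ]

theorem concat_getElem? {i m : ℕ} (hi : i < m) {t : ℕ} {p : α} (ht : (l i)[t]? = some p) :
    (concat l m)[(concat l i).length + t]? = some p := by
  have hlt : t < (l i).length := (List.getElem?_eq_some_iff.1 ht).1
  have hlen : ∀ m', i < m' → (concat l i).length + t < (concat l m').length := by
    intro m' hm'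
    induction m', hm' using Nat.le_induction with
    | base => rw [concat_succ, List.length_append]; omega
    | succ m' _ ih => rw [concat_succ, List.length_append]; omega
  induction m, hi using Nat.le_induction with
  | base => rw [concat_succ, List.getElem?_append_right (by omega)]; simpa using ht
  | succ m' hm' ih => rw [concat_succ, List.getElem?_append_left (hlen m' hm'), ih]

theorem exists_of_concat {m q : ℕ} {p : α} (h : (concat l m)[q]? = some p) :
    ∃ i < m, (concat l i).length ≤ q ∧ (l i)[q - (concat l i).length]? = some p := by
  induction m with
  | zero => simp [concat] at h
  | succ m ih =>
    rw [concat_succ] at h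
    rcases Nat.lt_or_ge q (concat l m).length with hq | hq
    · rw [List.getElem?_append_left hq] at h
      obtain ⟨i, hi, h'⟩ := ih h
      exact ⟨i, by omega, h'⟩
    · rw [List.getElem?_append_right hq] at h
      exact ⟨m, by omega, hq, h⟩

theorem length_concat (m : ℕ) : (concat l m).length = ∑ j ∈ Finset.range m, (l j).length := by
  induction m with
  | zero => simp [concat]
  | succ m ih => rw [concat_succ, List.length_append, ih, Finset.sum_range_succ]

/-- From the list lengths announced in round 0 a machine computes the left side, which is its offset
in the global numbering of the forest edges. -/
theorem sum_lt_length (i : Fin k) :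
    (∑ j : Fin k, if j < i then (l j).length else 0) = (concat l i).length := by
  rw [length_concat, ← Finset.sum_filter]
  refine Finset.sum_bij (fun j _ => j.val) (by simp) (fun _ _ _ _ => Fin.ext) ?_ (fun _ _ => rfl)
  intro b hb
  rw [Finset.mem_range] at hb
  refine ⟨⟨b, hb.trans i.2⟩, ?_, rfl⟩
  simp only [Finset.mem_filter, Finset.mem_univ, true_and]
  exact hb

end Concat

/-- Machine `j` relays entry `j` of the remaining list, or nothing past its end; the messages
together are the next batch. -/
theorem filterMap_getElem? {α : Type*} (D : List α) (k : ℕ) :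
    ((List.finRange k).filterMap fun j : Fin k => D[(j : ℕ)]?) = D.take k := by
  have h1 : ∀ k, (List.range k).filterMap (fun j => D[j]?) = D.take k := by
    intro k
    induction k with
    | zero => simp
    | succ k ih =>
      rw [List.range_succ, List.filterMap_append, ih, List.take_add_one]
      congr 1
  have h2 : List.range k = (List.finRange k).map Fin.val := by simp
  rw [← h1, h2, List.filterMap_map]
  rfl

/-! ### The protocol for the initialisation -/

open Classical in
/-- The marked edges of which a machine holds the smaller end. -/
noncomputable def View.owned (V : View n) (h : Finset (Fin n)) : List (Fin n × Fin n) :=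
  (Finset.univ : Finset (Fin n × Fin n)).toList.filter fun p =>
    p.1 ∈ h ∧ p.1 < p.2 ∧ ∃ r, V p.1 p.2 = some r ∧ r.pay.2 = true

def View.item (V : View n) (p : Fin n × Fin n) : Option (Item n) :=
  (V p.1 p.2).map fun r => ⟨p.1, p.2, r.src, r.dst⟩

/-- The owned edge with the number `q`, in a numbering that gives the first one the number `off`. -/
noncomputable def View.ownedAt (V : View n) (h : Finset (Fin n)) (off q : ℕ) :
    Option (Fin n × Fin n) :=
  if off ≤ q then (V.owned h)[q - off]? else none

/-- In round `0` the edges are numbered.  After that, `k` edges are made known to all machines in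
every two rounds: edge number `r * k + j` is first sent to machine `j`. -/
noncomputable def initBig (n k N : ℕ) : BigProtocol n k (MState n) where
  send _ h t s j :=
    if t = 0 then some (s.2.owned h).length
    -- For each recipient `j` there is at most one edge of the batch, so no link has to carry two
    -- messages even if a single machine owns the whole batch.
    else if t % 2 = 1 then
      ((s.2.ownedAt h s.1.offset ((t / 2) * k + j)).bind s.2.item).map encode
    else s.1.relay.map encode
  recv i _ t s ms :=
    if t = 0 then
      ({ (Aux.idle : Aux n) with offset := ∑ j : Fin k, if j < i then (ms j).getD 0 else 0 }, s.2)
    else if t % 2 = 1 then ({ s.1 with relay := pick (fun _ => 0) (received _ ms) }, s.2)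
    -- The last round clears the auxiliary data, because an update starts from idle machines.
    else (if t = 2 * N then Aux.idle else { s.1 with relay := none },
      foldLinks ((List.finRange k).filterMap (received _ ms)) s.2)

/-- The state before any edge is in the forest; the edges of `T` are marked. -/
noncomputable def GState.start (G : WGraph n) (T : SimpleGraph (Fin n)) : GState n :=
  open Classical in
  { H := G.graph
    pay := fun e => (G.weight e, decide (e ∈ T.edgeSet))
    T := ⊥
    lab := fun _ _ => 0
    tid := id
    sz := fun _ => 0
    nb := fun _ => none }

theorem GState.good_start {G : WGraph n} (hG : G.WeightsBounded c) (T : SimpleGraph (Fin n)) :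
    (GState.start G T).Good c where
  comp := ⟨fun u v => by simp [GState.start, reachable_bot], fun _ => rfl⟩
  acyclic := isAcyclic_bot
  tour := ⟨fun _ _ _ => rfl, fun _ _ h => h.elim, fun _ _ h => h.elim, fun _ _ _ _ h => h.elim,
    fun _ _ h => absurd h (Nat.not_lt_zero _), fun _ _ _ _ h => h.elim⟩
  le := bot_le
  nb_some _ _ h := by simp [GState.start] at h
  nb_none _ _ _ h := h.elim
  weight e he := hG e he

section Init
variable {G : WGraph n} {T : SimpleGraph (Fin n)} {home : Fin n → Fin k}

open Classical in
/-- The edges of `T` whose smaller end is on machine `i`. -/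
noncomputable def ownedEdges (T : SimpleGraph (Fin n)) (home : Fin n → Fin k) (i : ℕ) :
    List (Fin n × Fin n) :=
  (Finset.univ : Finset (Fin n × Fin n)).toList.filter fun p =>
    (home p.1 : ℕ) = i ∧ p.1 < p.2 ∧ T.Adj p.1 p.2

/-- Links change neither the graph nor the marks, so the numbering of round 0 stays valid
throughout. -/
theorem owned_eq (hT : T ≤ G.graph) (l : List (Fin n × Fin n)) (i : Fin k) :
    (((GState.start G T).links l).view (hosted home i)).owned (hosted home i) =
      ownedEdges T home i := by
  classical
  unfold View.owned ownedEdges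
  congr 1
  funext p
  rw [decide_eq_decide, mem_hosted, Fin.ext_iff]
  refine and_congr_right fun h1 => and_congr_right fun _ => ?_
  have h1' : home p.1 = i := Fin.ext h1
  simp only [GState.view, mem_hosted, h1', true_and, GState.links_H]
  constructor
  · rintro ⟨r, hr, hp⟩
    split_ifs at hr with h2
    obtain rfl := Option.some.inj hr
    simpa [GState.record, GState.start] using hp
  · intro h
    exact ⟨_, if_pos (hT h), by simpa [GState.record, GState.start] using h⟩

theorem mem_concat_owned {p : Fin n × Fin n} :
    p ∈ concat (ownedEdges T home) k ↔ p.1 < p.2 ∧ T.Adj p.1 p.2 := by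
  simp only [concat, List.mem_flatMap, List.mem_range, ownedEdges, List.mem_filter,
    Finset.mem_toList, Finset.mem_univ, true_and, decide_eq_true_eq]
  constructor
  · rintro ⟨i, _, _, h⟩; exact h
  · intro h; exact ⟨home p.1, (home p.1).2, rfl, h⟩

theorem nodup_concat_owned : (concat (ownedEdges T home) k).Nodup := by
  rw [concat, List.nodup_flatMap]
  refine ⟨fun i _ => (Finset.nodup_toList _).filter _, List.nodup_range.imp ?_⟩
  intro i j hij p hp hp'
  simp only [ownedEdges, List.mem_filter, decide_eq_true_eq] at hp hp'
  exact hij (hp.2.1.symm.trans hp'.2.1)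

theorem linkable_owned (hG : G.WeightsBounded c) (hT : T ≤ G.graph) (hac : T.IsAcyclic) :
    (GState.start G T).Linkable (concat (ownedEdges T home) k) :=
  GState.linkable_of_acyclic hac (GState.good_start hG T)
    (fun _ hp => ⟨(mem_concat_owned.1 hp).2, (mem_concat_owned.1 hp).1, fun h => h.elim⟩)
    nodup_concat_owned bot_le hT

end Init
end KMachine

namespace KMachine
open SimpleGraph Encodable

variable {n k c : ℕ}

/-! ### The run of the initialisation -/

section InitRun
variable (G : WGraph n) (T : SimpleGraph (Fin n)) (home : Fin n → Fin k)

/-- The edges of `T` in the order in which they are announced. -/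
noncomputable abbrev announced : List (Fin n × Fin n) := concat (ownedEdges T home) k

/-- The state after the first `q` edges of `T` are known to all machines. -/
noncomputable def initState (q : ℕ) : GState n :=
  (GState.start G T).links ((announced T home).take q)

/-- The auxiliary data of machine `i` between the announcements. -/
noncomputable def initAux (i : Fin k) : Aux n :=
  { (Aux.idle : Aux n) with offset := (concat (ownedEdges T home) i).length }

variable {G T home}

theorem initState_good (hG : G.WeightsBounded c) (hT : T ≤ G.graph) (hac : T.IsAcyclic) (q : ℕ) :
    (initState G T home q).Good c := by
  refine (GState.good_start hG T).links (GState.linkable_append (l' := (announced T home).drop q)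
    |>.1 ?_).1
  rw [List.take_append_drop]
  exact linkable_owned hG hT hac

theorem initState_view_add (hG : G.WeightsBounded c) (hT : T ≤ G.graph) (hac : T.IsAcyclic)
    (q m : ℕ) (hosts : Finset (Fin n)) :
    foldLinks ((((announced T home).drop q).take m).map fun p =>
      (initState G T home q).item p.1 p.2) ((initState G T home q).view hosts) =
      (initState G T home (q + m)).view hosts := by
  have h : (initState G T home q).Linkable (((announced T home).drop q).take m) := by
    refine (GState.linkable_append (l' := ((announced T home).drop q).drop m) |>.1 ?_).1
    rw [List.take_append_drop]
    refine (GState.linkable_append (S := GState.start G T) (l := (announced T home).take q)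
      |>.1 ?_).2
    rw [List.take_append_drop]
    exact linkable_owned hG hT hac
  rw [(initState_good hG hT hac q).foldLinks_view h, initState, initState, ← GState.links_append,
    ← List.take_add]

/-- Each number in use falls into the list of exactly one machine, and its offset tells a machine
which numbers are its own. -/
theorem ownedAt_eq_some (hT : T ≤ G.graph) {q r : ℕ} {i : Fin k} {p : Fin n × Fin n} :
    ((initState G T home q).view (hosted home i)).ownedAt (hosted home i)
      (concat (ownedEdges T home) i).length r = some p ↔
    (announced T home)[r]? = some p ∧ home p.1 = i := by
  rw [View.ownedAt, initState, owned_eq hT]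
  have hmem : ∀ {j t : ℕ} {p : Fin n × Fin n}, (ownedEdges T home j)[t]? = some p → (home p.1 : ℕ) = j := by
    intro j t p h
    have := List.mem_of_getElem? h
    simp only [ownedEdges, List.mem_filter, decide_eq_true_eq] at this
    exact this.2.1
  constructor
  · intro h
    split_ifs at h with h1
    have := concat_getElem? (ownedEdges T home) i.2 h
    rw [Nat.add_sub_cancel' h1] at this
    exact ⟨this, Fin.ext (hmem h)⟩
  · rintro ⟨h, rfl⟩
    obtain ⟨j, _, h1, h2⟩ := exists_of_concat _ h
    obtain rfl := hmem h2
    rw [if_pos h1, h2]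

theorem view_item (hT : T ≤ G.graph) {q : ℕ} {i : Fin k} {p : Fin n × Fin n} (hp : home p.1 = i)
    (hadj : T.Adj p.1 p.2) : ((initState G T home q).view (hosted home i)).item p =
      some ((initState G T home q).item p.1 p.2) := by
  have : p.1 ∈ hosted home i ∧ (initState G T home q).H.Adj p.1 p.2 :=
    ⟨mem_hosted.2 hp, by rw [initState, GState.links_H]; exact hT hadj⟩
  rw [View.item, GState.view, if_pos this]
  rfl

theorem announced_adj {r : ℕ} {p : Fin n × Fin n} (h : (announced T home)[r]? = some p) :
    T.Adj p.1 p.2 := (mem_concat_owned.1 (List.mem_of_getElem? h)).2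

/-- What the owner of the edge with number `r` sends. -/
theorem ownedAt_bind (hT : T ≤ G.graph) (q r : ℕ) (i : Fin k) :
    (((initState G T home q).view (hosted home i)).ownedAt (hosted home i)
      (concat (ownedEdges T home) i).length r).bind
      ((initState G T home q).view (hosted home i)).item =
    ((announced T home)[r]?.bind fun p => if home p.1 = i then
      some ((initState G T home q).item p.1 p.2) else none) := by
  cases h : (announced T home)[r]? with
  | none =>
    cases h' : ((initState G T home q).view (hosted home i)).ownedAt (hosted home i)
      (concat (ownedEdges T home) i).length r with
    | none => rfl
    | some p => simp [((ownedAt_eq_some hT).1 h').1] at h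
  | some p =>
    rw [Option.bind_some]
    split_ifs with hp
    · rw [(ownedAt_eq_some hT).2 ⟨h, hp⟩, Option.bind_some, view_item hT hp (announced_adj h)]
    · cases h' : ((initState G T home q).view (hosted home i)).ownedAt (hosted home i)
        (concat (ownedEdges T home) i).length r with
      | none => rfl
      | some p' =>
        obtain ⟨h1, h2⟩ := (ownedAt_eq_some hT).1 h'
        rw [h] at h1
        exact absurd (Option.some.inj h1 ▸ h2) hp

/-- The auxiliary data of machine `i` when it is to announce the edge with number `q + i`. -/
noncomputable def relayAux (G : WGraph n) (T : SimpleGraph (Fin n)) (home : Fin n → Fin k) (q : ℕ)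
    (i : Fin k) : Aux n :=
  { initAux T home i with
    relay := (announced T home)[q + i]?.map fun p => (initState G T home q).item p.1 p.2 }

theorem init_step_zero (hT : T ≤ G.graph) (N : ℕ) : (initBig n k N).step home 0
    (fun i => (Aux.idle, (initState G T home 0).view (hosted home i))) =
      fun i => (initAux T home i, (initState G T home 0).view (hosted home i)) := by
  funext i
  simp only [BigProtocol.step, initBig, if_true, Option.getD_some, initAux]
  rw [← sum_lt_length]
  simp only [initState, owned_eq hT]

theorem init_step_odd (hT : T ≤ G.graph) (N r : ℕ) : (initBig n k N).step home (2 * r + 1)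
    (fun i => (initAux T home i, (initState G T home (r * k)).view (hosted home i))) =
      fun i => (relayAux G T home (r * k) i, (initState G T home (r * k)).view (hosted home i)) := by
  funext i
  have h1 : (2 * r + 1) % 2 = 1 := by omega
  have h2 : (2 * r + 1) / 2 = r := by omega
  simp only [BigProtocol.step, initBig, h1, h2, if_true, Nat.add_one_ne_zero, if_false, initAux,
    ownedAt_bind hT]
  rw [received_encode fun j : Fin k => ((announced T home)[r * k + (i : ℕ)]?.bind fun p =>
    if home p.1 = j then some ((initState G T home (r * k)).item p.1 p.2) else none)]
  rw [relayAux, initAux]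
  congr 2
  cases h : (announced T home)[r * k + (i : ℕ)]? with
  | none => exact pick_eq_none fun _ => rfl
  | some p =>
    refine pick_eq_some (home p.1) (by simp) ?_
    intro j b hb
    simp only [Option.bind_some] at hb
    split_ifs at hb
    exact (Option.some.inj hb).symm

theorem init_step_even (hG : G.WeightsBounded c) (hT : T ≤ G.graph) (hac : T.IsAcyclic)
    (N r : ℕ) : (initBig n k N).step home (2 * r + 2)
    (fun i => (relayAux G T home (r * k) i, (initState G T home (r * k)).view (hosted home i))) =
      fun i => (if r + 1 = N then Aux.idle else initAux T home i,
        (initState G T home ((r + 1) * k)).view (hosted home i)) := by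
  funext i
  have h1 : ¬ (2 * r + 2) % 2 = 1 := by omega
  have h2 : 2 * r + 2 = 2 * N ↔ r + 1 = N := by omega
  have h3 : ¬ 2 * r + 2 = 0 := by omega
  simp only [BigProtocol.step, initBig, h1, h2, h3, if_false]
  rw [received_encode fun j : Fin k => (relayAux G T home (r * k) j).relay, Nat.succ_mul,
    ← initState_view_add hG hT hac]
  congr 2
  rw [← filterMap_getElem? _ k, List.map_filterMap]
  simp only [relayAux, List.getElem?_drop]

/-- One round goes to the numbering and two to each batch, so `r` batches are linked after `2 * r +
1` rounds. The case `r = N` is separate because the last round also clears the offsets. -/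
theorem init_run (hG : G.WeightsBounded c) (hT : T ≤ G.graph) (hac : T.IsAcyclic) {N : ℕ}
    (hN : 0 < N) {s : Fin k → MState n}
    (hs : s = fun i => (Aux.idle, (initState G T home 0).view (hosted home i))) (r : ℕ) :
    (r < N → (initBig n k N).run home s (2 * r + 1) =
      fun i => (initAux T home i, (initState G T home (r * k)).view (hosted home i))) ∧
    (r < N → (initBig n k N).run home s (2 * r + 2) =
      fun i => (relayAux G T home (r * k) i, (initState G T home (r * k)).view (hosted home i))) ∧
    (r = N → (initBig n k N).run home s (2 * r + 1) =
      fun i => (Aux.idle, (initState G T home (r * k)).view (hosted home i))) := by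
  have second : ∀ r, (initBig n k N).run home s (2 * r + 1) =
      (fun i => (initAux T home i, (initState G T home (r * k)).view (hosted home i))) →
      (initBig n k N).run home s (2 * r + 2) = fun i =>
        (relayAux G T home (r * k) i, (initState G T home (r * k)).view (hosted home i)) := by
    intro r h
    rw [BigProtocol.run_succ, h, init_step_odd hT]
  induction r with
  | zero =>
    have h0 : (initBig n k N).run home s (2 * 0 + 1) =
        fun i => (initAux T home i, (initState G T home (0 * k)).view (hosted home i)) := by
      rw [BigProtocol.run_succ, Nat.zero_mul, ← init_step_zero hT N, ← hs]; rfl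
    exact ⟨fun _ => h0, fun _ => second 0 h0, fun h => by omega⟩
  | succ r ih =>
    have h1 : r < N → (initBig n k N).run home s (2 * (r + 1) + 1) = fun i =>
        (if r + 1 = N then Aux.idle else initAux T home i,
          (initState G T home ((r + 1) * k)).view (hosted home i)) := by
      intro hr
      rw [BigProtocol.run_succ, show 2 * (r + 1) = 2 * r + 2 by ring, ih.2.1 hr,
        init_step_even hG hT hac]
    have h2 : r + 1 < N → (initBig n k N).run home s (2 * (r + 1) + 1) = fun i =>
        (initAux T home i, (initState G T home ((r + 1) * k)).view (hosted home i)) := by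
      intro hr
      rw [h1 (by omega)]
      simp only [if_neg hr.ne]
    refine ⟨h2, fun hr => second _ (h2 hr), fun hr => ?_⟩
    rw [h1 (by omega)]
    simp only [if_pos hr]

theorem initState_H (q : ℕ) : (initState G T home q).H = G.graph := GState.links_H _ _

theorem length_announced_le (hG : G.WeightsBounded c) (hT : T ≤ G.graph) (hac : T.IsAcyclic) :
    (announced T home).length ≤ n :=
  (linkable_owned hG hT hac).length_le (GState.good_start hG T)

theorem length_concat_le {α : Type*} (l : ℕ → List α) {i m : ℕ} (h : i ≤ m) :
    (concat l i).length ≤ (concat l m).length := by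
  rw [length_concat, length_concat]
  exact Finset.sum_le_sum_of_subset (Finset.range_subset_range.2 h)

theorem initState_T (hG : G.WeightsBounded c) (hT : T ≤ G.graph) (hac : T.IsAcyclic) {q : ℕ}
    (hq : n ≤ q) : (initState G T home q).T = T := by
  have he : (announced T home).take q = announced T home :=
    List.take_of_length_le ((length_announced_le hG hT hac).trans hq)
  ext a b
  rw [initState, he, GState.links_adj (linkable_owned hG hT hac), mem_concat_owned,
    mem_concat_owned]
  constructor
  · rintro (h | ⟨_, h⟩ | ⟨_, h⟩)
    · exact h.elim
    · exact h
    · exact h.symm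
  · intro h
    rcases lt_or_gt_of_ne h.ne with h' | h'
    · exact Or.inr (Or.inl ⟨h', h⟩)
    · exact Or.inr (Or.inr ⟨h', h.symm⟩)

theorem initState_rep (hG : G.WeightsBounded c) (hT : IsMSF G T) {q : ℕ} (hq : n ≤ q) :
    Rep c G (initState G T home q) := by
  have hle := hT.spanningForest.le
  have hac := hT.spanningForest.acyclic
  refine ⟨initState_good hG hle hac q, initState_H q, fun e _ => ?_, ?_⟩
  · rw [initState, GState.links_pay]; rfl
  · rwa [initState_T hG hle hac hq]

theorem init_correct (hn : 2 ≤ n) (hG : G.WeightsBounded c) (hT : IsMSF G T) {N : ℕ}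
    (hN : n ≤ N * k) (s : Fin k → MState n)
    (hs : s = fun i => (Aux.idle, (GState.start G T).view (hosted home i))) :
    (∀ t < 2 * N + 1, ∀ i j y, (initBig n k N).send i (hosted home i) t
      ((initBig n k N).run home s t i) j = some y → y < 2 ^ (Nat.log 2 n * (2 * bigExp c))) ∧
    (∀ t ≤ 2 * N + 1, ∀ i, SmallState c home i (localEdges home G.graph i)
      ((initBig n k N).run home s t i)) ∧
    ∃ S, Rep c G S ∧ S.T = T ∧ (initBig n k N).run home s (2 * N + 1) = S.states Aux.idle home := by
  have hle := hT.spanningForest.le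
  have hac := hT.spanningForest.acyclic
  have hN0 : 0 < N := by
    rcases Nat.eq_zero_or_pos N with rfl | h
    · omega
    · exact h
  have hs' : s = fun i => (Aux.idle, (initState G T home 0).view (hosted home i)) := hs
  have run := init_run hG hle hac hN0 hs'
  have good := initState_good (home := home) hG hle hac
  have hn3 : n < n ^ 3 := by
    calc n = n ^ 1 := (pow_one n).symm
      _ < n ^ 3 := Nat.pow_lt_pow_right (by omega) (by omega)
  have hoff : ∀ i : Fin k, (concat (ownedEdges T home) i).length < n ^ 3 := fun i =>
    ((length_concat_le _ i.2.le).trans (length_announced_le hG hle hac)).trans_lt hn3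
  have hitem : ∀ q r : ℕ, ∀ z ∈ ((announced T home)[r]?.map fun p : Fin n × Fin n =>
      (initState G T home q).item p.1 p.2), Bd n 416 z := by
    intro q r z hz
    obtain ⟨p, _, rfl⟩ := Option.map_eq_some_iff.1 hz
    exact (good q).bd_item hn _ _
  have sidle : (Aux.idle : Aux n).Small c := Aux.small_idle hn
  have sinit : ∀ i, (initAux T home i).Small c := fun i =>
    { sidle with offset := hoff i }
  have srelay : ∀ q i, (relayAux G T home q i).Small c := fun q i =>
    { sinit i with relay := hitem _ _ }
  have hbig : 416 ≤ bigExp c := by unfold bigExp; omega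
  have key : ∀ {β : Type} [Encodable β] {o : Option β} {y : ℕ}, (∀ z ∈ o, Bd n 416 z) →
      o.map encode = some y → y < 2 ^ (Nat.log 2 n * (2 * bigExp c)) := by
    intro β _ o y ho hoy
    obtain ⟨z, hz, rfl⟩ := Option.map_eq_some_iff.1 hoy
    exact ((ho z hz).mono hn hbig).lt_pow hn
  have small : ∀ {x : Aux n} q i, x.Small c → SmallState c home i (localEdges home G.graph i)
      (x, (initState G T home q).view (hosted home i)) := fun q i hx =>
    ⟨_, _, hx, good q, by rw [initState_H]; omega, rfl⟩
  have cases : ∀ t ≤ 2 * N + 1, t = 0 ∨ (∃ r < N, t = 2 * r + 1) ∨ (∃ r < N, t = 2 * r + 2) ∨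
      t = 2 * N + 1 := by
    intro t ht
    rcases Nat.even_or_odd' t with ⟨r, rfl | rfl⟩
    · rcases Nat.eq_zero_or_pos r with rfl | h
      · exact Or.inl rfl
      · exact Or.inr (Or.inr (Or.inl ⟨r - 1, by omega, by omega⟩))
    · rcases Nat.lt_or_ge r N with h | h
      · exact Or.inr (Or.inl ⟨r, h, rfl⟩)
      · exact Or.inr (Or.inr (Or.inr (by omega)))
  refine ⟨?_, ?_, _, initState_rep hG hT hN, initState_T hG hle hac hN, (run N).2.2 rfl⟩
  · intro t ht i j y hy
    rcases cases t ht.le with rfl | ⟨r, hr, rfl⟩ | ⟨r, hr, rfl⟩ | rfl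
    · have : (initBig n k N).run home s 0 i =
          (Aux.idle, (initState G T home 0).view (hosted home i)) := congrFun hs' i
      rw [this] at hy
      simp only [initBig, if_true, initState, owned_eq hle, Option.some.injEq] at hy
      have h1 := length_concat_le (ownedEdges T home) (show (i : ℕ) + 1 ≤ k from i.2)
      have h2 : (concat (ownedEdges T home) k).length ≤ n := length_announced_le hG hle hac
      rw [concat_succ, List.length_append] at h1
      refine Bd.lt_pow (α := ℕ) (Bd.nat ?_) hn
      calc y ≤ n := by omega
        _ < n ^ 3 := hn3
        _ ≤ n ^ bigExp c := Nat.pow_le_pow_right (by omega) (by omega)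
    · rw [(run r).1 hr] at hy
      have h1 : (2 * r + 1) % 2 = 1 := by omega
      have h2 : (2 * r + 1) / 2 = r := by omega
      simp only [initBig, h1, h2, if_true, Nat.add_one_ne_zero, if_false, initAux,
        ownedAt_bind hle] at hy
      refine key (fun z hz => ?_) hy
      obtain ⟨p, _, hp⟩ := Option.bind_eq_some_iff.1 hz
      split_ifs at hp
      exact Option.some.inj hp ▸ (good _).bd_item hn _ _
    · rw [(run r).2.1 hr] at hy
      have h1 : ¬ (2 * r + 2) % 2 = 1 := by omega
      have h3 : ¬ 2 * r + 2 = 0 := by omega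
      simp only [initBig, h1, h3, if_false] at hy
      exact key (srelay _ i).relay hy
    · omega
  · intro t ht i
    rcases cases t ht with rfl | ⟨r, hr, rfl⟩ | ⟨r, hr, rfl⟩ | rfl
    · have : (initBig n k N).run home s 0 i =
          (Aux.idle, (initState G T home 0).view (hosted home i)) := congrFun hs' i
      rw [this]
      exact small _ i sidle
    · rw [(run r).1 hr]; exact small _ i (sinit i)
    · rw [(run r).2.1 hr]; exact small _ i (srelay _ i)
    · rw [(run N).2.2 rfl]; exact small _ i sidle

end InitRun
end KMachine

namespace KMachine
open SimpleGraph Encodable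

variable {n k c : ℕ}

/-! ### The algorithm -/

/-- The weight of an inserted edge. -/
def Update.newWeight : Update n → Option ℤ
  | .insert _ x => some x
  | .delete _ => none

/-- The edge and the new weight. -/
noncomputable def Update.data (u : Update n) : Fin n × Fin n × Option ℤ :=
  ((Quot.out u.edge).1, (Quot.out u.edge).2, u.newWeight)

theorem mk_out_edge (e : Sym2 (Fin n)) : s((Quot.out e).1, (Quot.out e).2) = e := Quot.out_eq e

/-- The order of the two ends is a function of the edge, so machines that see the update
independently announce the same triple. -/
theorem Update.Valid.change {G : WGraph n} {u : Update n} (h : u.Valid c G) :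
    Change c G (G.apply u) u.data.1 u.data.2.1 u.data.2.2 := by
  classical
  cases u with
  | insert e x =>
    obtain ⟨h1, h2, h3⟩ := h
    obtain ⟨⟨a, b⟩, rfl⟩ : ∃ p : Fin n × Fin n, s(p.1, p.2) = e := ⟨_, mk_out_edge e⟩
    have he := mk_out_edge s(a, b)
    have hd : ((Update.insert s(a, b) x).data) =
      ((Quot.out s(a, b)).1, (Quot.out s(a, b)).2, some x) := rfl
    rw [hd]
    generalize (Quot.out s(a, b)).1 = a', (Quot.out s(a, b)).2 = b' at he
    simp only at h1 h2 ⊢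
    rw [← he] at h1 h2
    refine ⟨h1, ?_, ?_, by simp⟩
    · intro e' he'
      simp only [WGraph.apply]
      refine Function.update_of_ne ?_ _ _
      rintro rfl
      exact h2 (he ▸ he')
    · rintro y hy
      obtain rfl := Option.some.inj hy
      refine ⟨h2, h3, ?_, ?_⟩
      · rw [← he]; rfl
      · simp only [WGraph.apply]; rw [he]; exact Function.update_self ..
  | delete e =>
    have he := mk_out_edge e
    have hd : ((Update.delete e).data) = ((Quot.out e).1, (Quot.out e).2, none) := rfl
    rw [hd]
    generalize (Quot.out e).1 = a', (Quot.out e).2 = b' at he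
    subst he
    have h' : G.graph.Adj a' b' := h
    exact ⟨h'.ne, fun _ _ => rfl, by simp, fun _ => ⟨h', rfl⟩⟩

theorem livesOn_edge {home : Fin n → Fin k} {u : Update n} {i : Fin k} :
    LivesOn home u.edge i ↔ home u.data.1 = i ∨ home u.data.2.1 = i := by
  have : LivesOn home s(u.data.1, u.data.2.1) i ↔ home u.data.1 = i ∨ home u.data.2.1 = i := by
    simp [LivesOn, Sym2.mem_iff, or_and_right, exists_or]
  rwa [show s(u.data.1, u.data.2.1) = u.edge from mk_out_edge _] at this

/-- The view before any edge is in the forest. -/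
def loadView (h : Finset (Fin n)) (inp : LocalInput n) : View n := fun a b =>
  if a ∈ h then (inp s(a, b)).map fun p => ⟨p, ⟨a, 0, none⟩, ⟨b, 0, none⟩, none⟩ else none

theorem loadView_eq (G : WGraph n) (T : SimpleGraph (Fin n)) (home : Fin n → Fin k) (i : Fin k) :
    loadView (hosted home i) (localInput home G T i) =
      (GState.start G T).view (hosted home i) := by
  classical
  funext a b
  unfold loadView GState.view localInput
  by_cases ha : a ∈ hosted home i
  · have hl : LivesOn home s(a, b) i := ⟨a, by simp, mem_hosted.1 ha⟩
    by_cases hab : G.graph.Adj a b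
    · rw [if_pos ha, if_pos ⟨hab, hl⟩, if_pos ⟨ha, hab⟩]
      simp [GState.record, GState.start, GState.vinfo]
    · rw [if_pos ha, if_neg (fun h => hab h.1), if_neg (fun h => hab h.2)]
      rfl
  · rw [if_neg ha, if_neg (fun h => ha h.1)]

def View.tourInfo (V : View n) (u v : Fin n) : Option TourInfo :=
  (V u v).bind fun r => r.tree.map fun l => ⟨l.1, l.2, r.src.sz⟩

noncomputable def View.neighbourInfo (V : View n) (v : Fin n) : Option (Fin n × TourInfo) :=
  (someNbr fun u => ∃ r, V u v = some r).bind fun u => (V u v).bind fun r =>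
    r.dst.nb.map fun z => (z.1, ⟨z.2.1, z.2.2, r.dst.sz⟩)

/-- Each message is sent in `2 * bigExp c` parts. -/
noncomputable def mstAlg (c n k : ℕ) : DynAlg n k where
  startEmpty _ _ := enc ((Aux.idle, fun _ _ => none) : MState n)
  load _ h inp := enc ((Aux.idle, loadView h inp) : MState n)
  initProtocol := (initBig n k ⌈(n : ℚ) / k⌉₊).toProtocol enc dec (2 * bigExp c)
  accept _ _ u m := enc ({ (dec m : MState n).1 with pend := u.map Update.data }, (dec m).2)
  updateProtocol := (updateBig n k).toProtocol enc dec (2 * bigExp c)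
  readEdge _ _ m u v := (dec m).2.tourInfo u v
  readNeighbour _ _ m v := (dec m).2.neighbourInfo v

/-- The memories that represent a global state. -/
noncomputable def GState.config (S : GState n) (home : Fin n → Fin k) : Config k :=
  fun i => enc (S.states Aux.idle home i)

theorem Rep.represents {G : WGraph n} {S : GState n} (h : Rep c G S) (home : Fin n → Fin k) :
    (mstAlg c n k).Represents home G.graph S.T (S.config home) := by
  classical
  have size : ∀ v, S.sz v = tourSize S.T v := fun v =>
    (h.good.tour.tourSize_eq h.good.comp v).symm
  refine ⟨S.lab, h.good.tour.isEulerTour h.good.comp, fun u v huv => ?_⟩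
  have hd : (dec (S.config home (home u))).2 = S.view (hosted home (home u)) := by
    rw [GState.config, dec_enc]; rfl
  have hV : S.view (hosted home (home u)) u v = some (S.record u v) :=
    if_pos ⟨mem_hosted.2 rfl, h.graph ▸ huv⟩
  simp only [mstAlg, hd]
  refine ⟨fun ht => ?_, fun ht => ?_, ?_⟩
  · simp [View.tourInfo, hV, GState.record, ht, KMachine.tourInfo, GState.vinfo, size]
  · simp [View.tourInfo, hV, GState.record, ht]
  -- `v` has an edge in `G` and the forest spans, so `v` has a forest edge. Its data are in the
  -- record of any stored edge that ends at `v`, even if `v` is on another machine.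
  · obtain ⟨x, hx⟩ : ∃ x, S.nb v = some x := by
      by_contra hno
      have hno := h.good.nb_none v (Option.eq_none_iff_forall_ne_some.2 fun x hx => hno ⟨x, hx⟩)
      have hr := h.msf.spanningForest.spanning v u huv.symm.reachable
      obtain ⟨w⟩ := hr
      cases w with
      | nil => exact huv.ne rfl
      | cons hadj _ => exact hno _ hadj
    refine ⟨x, h.good.nb_some v x hx, ?_⟩
    cases hs : someNbr (fun u' => ∃ r, S.view (hosted home (home u)) u' v = some r) with
    | none => exact absurd ⟨_, hV⟩ (someNbr_none hs u)
    | some u' =>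
      obtain ⟨r, hr⟩ := someNbr_some hs
      have hr' := hr
      unfold GState.view at hr'
      split_ifs at hr'
      obtain rfl := Option.some.inj hr'
      simp [View.neighbourInfo, hs, hr, GState.record, GState.vinfo, hx, KMachine.tourInfo, size]

theorem FitsIn.mono {C C' s : ℕ} {m : Memory} (h : FitsIn n C s m) (hC : C ≤ C') :
    FitsIn n C' s m :=
  ⟨h.1.trans (Nat.mul_le_mul_right _ hC), fun x hx => (h.2 x hx).trans_le
    (Nat.pow_le_pow_right (by omega) (Nat.mul_le_mul_right _ hC))⟩

theorem bigExp_pos (c : ℕ) : 0 < bigExp c := by unfold bigExp; omega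

theorem SmallState.fitsIn (hn : 2 ≤ n) (hk : 0 < k) {home : Fin n → Fin k} {i : Fin k} {m : ℕ}
    {s : MState n} (h : SmallState c home i m s) : FitsIn n (2 * bigExp c) (k + m) (enc s) := by
  obtain ⟨x, S, hx, hS, hm, rfl⟩ := h
  exact fitsIn_enc hn hx hS home hk i hm

theorem Rep.spaceOK (hn : 2 ≤ n) (hk : 0 < k) {G : WGraph n} {S : GState n} (h : Rep c G S)
    (home : Fin n → Fin k) : SpaceOK (14 * bigExp c) home G.graph (S.config home) := fun i =>
  FitsIn.mono (fitsIn_enc hn (Aux.small_idle hn) h.good home hk i (by rw [h.graph]; omega))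
    (by omega)

/-- Seven rounds in `2 * bigExp c` pieces each give the constant `14 * bigExp c`. It also covers the
space factor of the simulation, which is `4 * bigExp c + 1`. -/
theorem Rep.update (hn : 2 ≤ n) (hk : 0 < k) {G : WGraph n} {S : GState n} (h : Rep c G S)
    (home : Fin n → Fin k) {u : Update n} (hu : u.Valid c G) :
    (∀ t ≤ 7 * (2 * bigExp c), SpaceOK (14 * bigExp c) home (G.apply u).graph
      ((mstAlg c n k).updateConfig home (S.config home) u t)) ∧
    ∃ S', Rep c (G.apply u) S' ∧ (mstAlg c n k).updateConfig home (S.config home) u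
      (7 * (2 * bigExp c)) = S'.config home := by
  have hD := bigExp_pos c
  obtain ⟨h1, h2, S', hS', h3⟩ := update_run hn h hu.change home _ rfl
  have hstart : (mstAlg c n k).deliver home (S.config home) u = fun i => enc ({ (Aux.idle : Aux n)
      with pend := if home u.data.1 = i ∨ home u.data.2.1 = i then
        some (u.data.1, u.data.2.1, u.data.2.2) else none }, S.view (hosted home i)) := by
    funext i
    simp only [DynAlg.deliver, mstAlg, GState.config, dec_enc, GState.states, livesOn_edge]
    split_ifs <;> rfl
  refine ⟨fun t ht i => ?_, S', hS', ?_⟩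
  · unfold DynAlg.updateConfig
    rw [hstart]
    exact (BigProtocol.toProtocol_fitsIn dec_enc h1 (by omega) hn
      (fun q hq i => (h2 q hq i).fitsIn hn hk) ht i).mono (by omega)
  · unfold DynAlg.updateConfig
    rw [hstart]
    refine (BigProtocol.toProtocol_run_mul dec_enc h1 (by omega)).trans ?_
    rw [h3]
    rfl

theorem Rep.maintains (hn : 2 ≤ n) (hk : 0 < k) {G : WGraph n} {S : GState n} (h : Rep c G S)
    (home : Fin n → Fin k) : (mstAlg c n k).Maintains c (14 * bigExp c) (7 * (2 * bigExp c)) home G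
      (S.config home) := by
  have key : ∀ us : List (Update n), ∀ (G : WGraph n) (S : GState n), Rep c G S →
      ValidSeq c G us → ∃ S', Rep c (G.after us) S' ∧
        (mstAlg c n k).after home (7 * (2 * bigExp c)) (S.config home) us = S'.config home := by
    intro us
    induction us with
    | nil => exact fun G S h _ => ⟨S, h, rfl⟩
    | cons u us ih =>
      intro G S h hv
      obtain ⟨_, S', hS', he⟩ := h.update hn hk home hv.1
      obtain ⟨S'', hS'', he'⟩ := ih _ S' hS' hv.2
      refine ⟨S'', hS'', ?_⟩
      rw [← he', ← he]
      simp only [DynAlg.after, List.foldl_cons]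
  intro us hus
  obtain ⟨S', hS', he⟩ := key us G S h hus
  rw [he]
  exact ⟨⟨S'.T, hS'.msf, hS'.represents home⟩, hS'.spaceOK hn hk home,
    fun u hu t ht => (hS'.update hn hk home hu).1 t ht⟩

theorem rep_start_bot {G : WGraph n} (hG : G.graph = ⊥) : Rep c G (GState.start G ⊥) where
  good := GState.good_start (fun e he => by simp [hG] at he) ⊥
  graph := rfl
  weight _ _ := rfl
  msf := by
    have h : ∀ T', IsSpanningForest G.graph T' → T' = ⊥ := fun T' h => le_bot_iff.1 (hG ▸ h.le)
    exact ⟨⟨bot_le, isAcyclic_bot, fun u v huv => by rwa [hG] at huv⟩,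
      fun T' hT' => by rw [h T' hT']; exact le_rfl⟩

theorem emptyConfig_eq {G : WGraph n} (hG : G.graph = ⊥) (home : Fin n → Fin k) :
    (mstAlg c n k).emptyConfig home = (GState.start G ⊥).config home := by
  funext i
  simp only [DynAlg.emptyConfig, mstAlg, GState.config, GState.states]
  congr 2
  funext a b
  exact (if_neg fun h => by simp [GState.start, hG] at h).symm

theorem initConfig_spec (hn : 2 ≤ n) (hk : 0 < k) {G : WGraph n} {T : SimpleGraph (Fin n)}
    (hG : G.WeightsBounded c) (hT : IsMSF G T) (home : Fin n → Fin k) {Q : ℕ}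
    (hQ : Q = (2 * ⌈(n : ℚ) / k⌉₊ + 1) * (2 * bigExp c)) :
    (∀ t ≤ Q, SpaceOK (14 * bigExp c) home G.graph ((mstAlg c n k).initConfig home G T t)) ∧
    ∃ S, Rep c G S ∧ S.T = T ∧ (mstAlg c n k).initConfig home G T Q = S.config home := by
  have hD := bigExp_pos c
  have hN : n ≤ ⌈(n : ℚ) / k⌉₊ * k := by
    have h1 : (n : ℚ) / k ≤ ⌈(n : ℚ) / k⌉₊ := Nat.le_ceil _
    rw [div_le_iff₀ (by exact_mod_cast hk)] at h1
    exact_mod_cast h1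
  obtain ⟨h1, h2, S, hS, hST, h3⟩ := init_correct (home := home) hn hG hT hN _ rfl
  have hstart : (fun i => (mstAlg c n k).load i (hosted home i) (localInput home G T i)) =
      fun i => enc ((Aux.idle, (GState.start G T).view (hosted home i)) : MState n) := by
    funext i
    simp only [mstAlg, loadView_eq]
  subst hQ
  refine ⟨fun t ht i => ?_, S, hS, hST, ?_⟩
  · unfold DynAlg.initConfig
    rw [hstart]
    exact (BigProtocol.toProtocol_fitsIn dec_enc h1 (by omega) hn
      (fun q hq i => (h2 q hq i).fitsIn hn hk) ht i).mono (by omega)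
  · unfold DynAlg.initConfig
    rw [hstart]
    refine (BigProtocol.toProtocol_run_mul dec_enc h1 (by omega)).trans ?_
    rw [h3]
    rfl

/-! ### Graphs with at most one vertex -/

/-- The algorithm that does nothing. -/
def emptyAlg (n k : ℕ) : DynAlg n k where
  startEmpty _ _ := []
  load _ _ _ := []
  initProtocol := ⟨fun _ _ _ _ _ => none, fun _ _ _ _ _ => []⟩
  accept _ _ _ _ := []
  updateProtocol := ⟨fun _ _ _ _ _ => none, fun _ _ _ _ _ => []⟩
  readEdge _ _ _ _ _ := none
  readNeighbour _ _ _ _ := none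

theorem emptyAlg_spaceOK (C : ℕ) (home : Fin n → Fin k) (G : SimpleGraph (Fin n)) :
    SpaceOK C home G (fun _ => []) := fun _ => ⟨Nat.zero_le _, by simp⟩

/-- Without edges there is nothing to store. The case is separate because `log n = 0` leaves
messages without bits and words with 0 as their only value. -/
theorem emptyAlg_represents (hn : n ≤ 1) (home : Fin n → Fin k) (G T : SimpleGraph (Fin n))
    (σ : Config k) : (emptyAlg n k).Represents home G T σ := by
  have : Subsingleton (Fin n) := Fin.subsingleton_iff_le_one.2 hn
  exact ⟨fun _ _ => 0, ⟨fun u v h => absurd (Subsingleton.elim u v) h.ne,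
    fun u v _ _ h => absurd (Subsingleton.elim u v) h.ne,
    fun u v _ _ h => absurd (Subsingleton.elim u v) h.ne⟩,
    fun u v h => absurd (Subsingleton.elim u v) h.ne⟩

theorem emptyAlg_maintains (hn : n ≤ 1) (C : ℕ) (home : Fin n → Fin k) (G : WGraph n) :
    (emptyAlg n k).Maintains c C 0 home G (fun _ => []) := by
  have : Subsingleton (Fin n) := Fin.subsingleton_iff_le_one.2 hn
  have hbot : ∀ G : SimpleGraph (Fin n), G = ⊥ := fun G => Subsingleton.elim _ _
  intro us _
  have hσ : ∀ us, (emptyAlg n k).after home 0 (fun _ => []) us = fun _ => [] := by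
    intro us
    induction us with
    | nil => rfl
    | cons u us ih => exact ih
  rw [hσ]
  refine ⟨⟨(G.after us).graph, ⟨⟨le_rfl, ?_, fun _ _ h => h⟩, fun T' _ => ?_⟩,
    emptyAlg_represents hn home _ _ _⟩, emptyAlg_spaceOK C home _, fun u _ t ht => ?_⟩
  · rw [hbot (G.after us).graph]; exact isAcyclic_bot
  · rw [hbot T', hbot (G.after us).graph]
  · obtain rfl : t = 0 := by omega
    exact emptyAlg_spaceOK C home _

end KMachine

theorem mainTheorem3 (c : ℕ) :
    ∃ C : ℕ, ∀ n k : ℕ, 0 < k →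
      ∃ (A : KMachine.DynAlg n k) (R Rinit : ℕ),
        R ≤ C ∧ Rinit ≤ C * ⌈(n : ℚ) / k⌉₊ ∧
        ∀ home : Fin n → Fin k,
          -- the graph is initially empty
          (∀ G : KMachine.WGraph n, G.graph = ⊥ →
            A.Maintains c C R home G (A.emptyConfig home)) ∧
          -- the graph is arbitrary, and a minimum spanning forest has been computed
          (∀ (G : KMachine.WGraph n) (T : SimpleGraph (Fin n)),
            G.WeightsBounded c → KMachine.IsMSF G T →
              (∀ t ≤ Rinit, KMachine.SpaceOK C home G.graph (A.initConfig home G T t)) ∧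
              A.Represents home G.graph T (A.initConfig home G T Rinit) ∧
              A.Maintains c C R home G (A.initConfig home G T Rinit)) := by
  refine ⟨14 * KMachine.bigExp c, fun n k hk => ?_⟩
  rcases Nat.lt_or_ge n 2 with hn | hn
  · have hn' : n ≤ 1 := by omega
    refine ⟨KMachine.emptyAlg n k, 0, 0, Nat.zero_le _, Nat.zero_le _, fun home =>
      ⟨fun G _ => KMachine.emptyAlg_maintains hn' _ home G, fun G T _ _ => ⟨fun t ht => ?_,
        KMachine.emptyAlg_represents hn' home _ _ _, KMachine.emptyAlg_maintains hn' _ home G⟩⟩⟩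
    obtain rfl : t = 0 := by omega
    exact KMachine.emptyAlg_spaceOK _ home _
  · refine ⟨KMachine.mstAlg c n k, 7 * (2 * KMachine.bigExp c),
      (2 * ⌈(n : ℚ) / k⌉₊ + 1) * (2 * KMachine.bigExp c), by omega, ?_, fun home =>
      ⟨fun G hG => ?_, fun G T hG hT => ?_⟩⟩
    · have h0 : 0 < ⌈(n : ℚ) / k⌉₊ := Nat.ceil_pos.2 (by positivity)
      -- With `N = ⌈n / k⌉ ≥ 1`, the factor `(2 * N + 1) * 2` is at most `6 * N`, well below `14 *
      -- N`.
      nlinarith [KMachine.bigExp_pos c, Nat.zero_le (KMachine.bigExp c * (⌈(n : ℚ) / k⌉₊ - 1))]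
    · rw [KMachine.emptyConfig_eq hG]
      exact (KMachine.rep_start_bot hG).maintains hn hk home
    · obtain ⟨h1, S, hS, rfl, h2⟩ := KMachine.initConfig_spec hn hk hG hT home rfl
      refine ⟨h1, ?_⟩
      rw [h2]
      exact ⟨hS.represents home, hS.maintains hn hk home⟩
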